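/- An instance is a pair $(T,w)$, where $T=(V,E)$ is a (non-empty, finite) rooted tree with $n=|V|$ nodes and $w:V\to\mathbb{Z}_{\ge 0}$ assigns a non-negative integer weight to every node. Write $T_u$ for the subtree of $T$ rooted at $u$, $\Delta(T)$ for the maximum degree of $T$ and $w(T)=\sum_{v\in V}w(v)$. A search tree for $T$ is a binary tree $D$ in which every internal node has a left and a right child, together with an assignment $A$ of its nodes to nodes of $T$ such that (a) for every $v\in V$ there is exactly one leaf $\ell$ of $D$ with $A(\ell)=v$, and (b) if $y$ is in the right (left) subtree of $x$ in $D$, then $A(y)$ is (is not) a node of $T_{A(x)}$. Its cost is $\mathrm{cost}(D)=\sum_{\ell\text{ leaf of }D} d(\ell)\,w(A(\ell))$, where $d(\ell)$ is the distance from the root of $D$ to $\ell$. A search tree for $T$ is optimal if its cost is minimum, and $(1+\varepsilon)$-approximate if its cost is at most $(1+\varepsilon)$ times the minimum cost. Running times count elementary operations in a unit-cost model: programs (first-order recursive functions) on natural numbers and pairs, where building, projecting and testing for a pair, adding, subtracting and comparing two numbers, accessing or binding a variable and calling a function each cost one step. The tree is given as nested lists of children with the name and the weight of each node. **Theorem.**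 1. There is an algorithm which, on every instance $(T,w)$, where $\Delta(T)\le\Delta$ for a constant $\Delta$, outputs an optimal search tree for $(T,w)$ in time polynomial in $n\cdot w(T)$: for every $\Delta$ there are constants $C,k$, depending only on $\Delta$, such that the number of steps is at most $C\,(n\cdot\max\{1,w(T)\})^{k}$ for all instances with $\Delta(T)\le\Delta$. 2. There is an algorithm which, given a rational number $\varepsilon=p/q>0$ (as the pair of positive integers $p,q$) and an instance $(T,w)$, where $\Delta(T)\le\Delta$ for a constant $\Delta$, outputs a $(1+\varepsilon)$-approximate search tree for $(T,w)$ in time polynomial in $n/\varepsilon$ (and independent of $w$): for every $\Delta$ there are constants $C,k$, depending only on $\Delta$, such that the number of steps is at most $C\,(n\cdot\max\{1,1/\varepsilon\})^{k}$ for all instances with $\Delta(T)\le\Delta$ and all such $\varepsilon$. -/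

import Mathlib

namespace TreeSearch

/-! ### Rooted trees -/

/-- A rooted tree: the name of its root, and the list of the subtrees hanging from the root.
Nodes are named by natural numbers; `RTree.Valid` says that distinct nodes have distinct names. -/
inductive RTree : Type
  | node (v : ℕ) (children : List RTree) : RTree

namespace RTree

/-- The name of the root. -/
def root : RTree → ℕ
  | node v _ => v

/-- The subtrees hanging from the root. -/
def children : RTree → List RTree
  | node _ cs => cs

mutual
/-- The subtrees `T_u`, one for every node `u` of `T` (the tree itself comes first). -/
def subtrees : RTree → List RTree
  | node v cs => node v cs :: subtreesList cs
/-- The subtrees rooted at the nodes of a list of trees. -/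
def subtreesList : List RTree → List RTree
  | [] => []
  | c :: cs => subtrees c ++ subtreesList cs
end

/-- The nodes of `T`. -/
def nodes (T : RTree) : List ℕ :=
  T.subtrees.map root

/-- Distinct nodes have distinct names. -/
def Valid (T : RTree) : Prop :=
  T.nodes.Nodup

/-- `n = |V|`. -/
def size (T : RTree) : ℕ :=
  T.nodes.length

/-- `v` is a node of the subtree `T_u` of `T` rooted at `u`. -/
def Below (T : RTree) (u v : ℕ) : Prop :=
  ∃ S ∈ T.subtrees, S.root = u ∧ v ∈ S.nodes

/-- The degrees of the nodes of `T` (as an undirected tree): the root is adjacent to its children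
only, every other node to its children and its parent. -/
def degrees (T : RTree) : List ℕ :=
  T.children.length :: (subtreesList T.children).map fun S => S.children.length + 1

/-- The maximum degree `Δ(T)`. -/
def maxDegree (T : RTree) : ℕ :=
  T.degrees.foldr max 0

/-- The total weight `w(T)`. -/
def weight (T : RTree) (w : ℕ → ℕ) : ℕ :=
  (T.nodes.map w).sum

end RTree

/-! ### Search trees -/

/-- Binary decision trees: a leaf is assigned to a node `v`; an internal node is assigned to a node
`q` (the query to the edge from `q` to its parent), its left subtree is followed on the
answer "no" and its right subtree on the answer "yes". -/
inductive DTree : Type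
  | leaf (v : ℕ) : DTree
  | query (q : ℕ) (left right : DTree) : DTree

namespace DTree

/-- The assignments of the leaves. -/
def leaves : DTree → List ℕ
  | leaf v => [v]
  | query _ l r => l.leaves ++ r.leaves

/-- The assignments of all nodes, leaves and internal nodes. -/
def labels : DTree → List ℕ
  | leaf v => [v]
  | query q l r => q :: (l.labels ++ r.labels)

/-- The search property: if `y` is in the right (left) subtree of `x` then `A(y)` is (not) in the
subtree of `T` rooted at `A(x)`. -/
def SearchProperty (T : RTree) : DTree → Prop
  | leaf _ => True
  | query q l r =>
      (∀ a ∈ r.labels, T.Below q a) ∧ (∀ a ∈ l.labels, ¬ T.Below q a) ∧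
        SearchProperty T l ∧ SearchProperty T r

/-- `D` is a search tree for `T`: its assignment takes values in the nodes of `T`, every node of `T`
is assigned to exactly one leaf, and the search property holds. -/
def IsSearchTree (T : RTree) (D : DTree) : Prop :=
  (∀ a ∈ D.labels, a ∈ T.nodes) ∧ (∀ v ∈ T.nodes, D.leaves.count v = 1) ∧ D.SearchProperty T

/-- The sum of `(d + depth of ℓ) * w (A ℓ)` over the leaves `ℓ`. -/
def costFrom (w : ℕ → ℕ) : ℕ → DTree → ℕ
  | d, leaf v => d * w v
  | d, query _ l r => costFrom w (d + 1) l + costFrom w (d + 1) r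

/-- The cost: the sum over the leaves of depth times weight. -/
def cost (w : ℕ → ℕ) (D : DTree) : ℕ :=
  costFrom w 0 D

/-- `D` is a minimum cost search tree for `(T, w)`. -/
def IsOptimal (T : RTree) (w : ℕ → ℕ) (D : DTree) : Prop :=
  D.IsSearchTree T ∧ ∀ D' : DTree, D'.IsSearchTree T → D.cost w ≤ D'.cost w

/-- `D` is a search tree for `T` whose cost is at most `1 + ε` times the minimum cost. -/
def IsApprox (T : RTree) (w : ℕ → ℕ) (ε : ℚ) (D : DTree) : Prop :=
  D.IsSearchTree T ∧
    ∀ D' : DTree, D'.IsSearchTree T → (D.cost w : ℚ) ≤ (1 + ε) * (D'.cost w : ℚ)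

end DTree

/-! ### The machine model

Programs of a first-order functional language on natural numbers and (immutable, shared) pairs, with
a unit charge for every elementary operation: access to a variable, a constant, building or
projecting a pair, addition, truncated subtraction, comparison, testing for a pair, binding a
variable, calling a function. A random access machine executes each of them in a number of
unit-cost steps that depends on the program only: a value is a number or a pointer, and the
environment holds a bounded number of values. No multiplication or division is available, so that
in `t` steps the bit length of the numbers grows by at most `O(t)`. -/

/-- Values: natural numbers and pairs. -/
inductive Val : Type
  | nat (n : ℕ) : Val
  | pair (a b : Val) : Val

/-- Expressions; `var i` is the `i`-th innermost variable, starting from `0`. -/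
inductive Expr : Type
  | var (i : ℕ) : Expr
  | lit (n : ℕ) : Expr
  | pair (a b : Expr) : Expr
  | fst (a : Expr) : Expr
  | snd (a : Expr) : Expr
  | add (a b : Expr) : Expr
  | sub (a b : Expr) : Expr
  | ifLe (a b thn els : Expr) : Expr
  | ifPair (a thn els : Expr) : Expr
  | letIn (a body : Expr) : Expr
  | call (f : ℕ) (arg : Expr) : Expr

/-- A program is a finite list of function bodies, which may call each other and themselves. In a
body, the argument of the function is the only free variable, `var 0`. -/
abbrev Program : Type := List Expr

/-- `Eval P env e v t`: in the program `P` and the environment `env`, the call-by-value evaluation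
of the expression `e` terminates with the value `v` after `t` steps. -/
inductive Eval (P : Program) : List Val → Expr → Val → ℕ → Prop
  | var {env : List Val} {i : ℕ} {v : Val} (h : env[i]? = some v) : Eval P env (.var i) v 1
  | lit {env : List Val} {n : ℕ} : Eval P env (.lit n) (.nat n) 1
  | pair {env : List Val} {a b : Expr} {x y : Val} {s t : ℕ} :
      Eval P env a x s → Eval P env b y t → Eval P env (.pair a b) (.pair x y) (s + t + 1)
  | fst {env : List Val} {a : Expr} {x y : Val} {s : ℕ} :
      Eval P env a (.pair x y) s → Eval P env (.fst a) x (s + 1)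
  | snd {env : List Val} {a : Expr} {x y : Val} {s : ℕ} :
      Eval P env a (.pair x y) s → Eval P env (.snd a) y (s + 1)
  | add {env : List Val} {a b : Expr} {m n : ℕ} {s t : ℕ} :
      Eval P env a (.nat m) s → Eval P env b (.nat n) t →
        Eval P env (.add a b) (.nat (m + n)) (s + t + 1)
  | sub {env : List Val} {a b : Expr} {m n : ℕ} {s t : ℕ} :
      Eval P env a (.nat m) s → Eval P env b (.nat n) t →
        Eval P env (.sub a b) (.nat (m - n)) (s + t + 1)
  | ifLe_true {env : List Val} {a b c d : Expr} {m n : ℕ} {v : Val} {s t r : ℕ} (h : m ≤ n) :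
      Eval P env a (.nat m) s → Eval P env b (.nat n) t → Eval P env c v r →
        Eval P env (.ifLe a b c d) v (s + t + r + 1)
  | ifLe_false {env : List Val} {a b c d : Expr} {m n : ℕ} {v : Val} {s t r : ℕ} (h : ¬ m ≤ n) :
      Eval P env a (.nat m) s → Eval P env b (.nat n) t → Eval P env d v r →
        Eval P env (.ifLe a b c d) v (s + t + r + 1)
  | ifPair_true {env : List Val} {a c d : Expr} {x y v : Val} {s r : ℕ} :
      Eval P env a (.pair x y) s → Eval P env c v r →
        Eval P env (.ifPair a c d) v (s + r + 1)
  | ifPair_false {env : List Val} {a c d : Expr} {n : ℕ} {v : Val} {s r : ℕ} :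
      Eval P env a (.nat n) s → Eval P env d v r →
        Eval P env (.ifPair a c d) v (s + r + 1)
  | letIn {env : List Val} {a body : Expr} {x v : Val} {s r : ℕ} :
      Eval P env a x s → Eval P (x :: env) body v r →
        Eval P env (.letIn a body) v (s + r + 1)
  | call {env : List Val} {f : ℕ} {a body : Expr} {x v : Val} {s r : ℕ}
      (hf : P[f]? = some body) :
      Eval P env a x s → Eval P [x] body v r →
        Eval P env (.call f a) v (s + r + 1)

/-- On the input `x`, the program `P` halts with output `y` after `t` steps: the first function of
the program, applied to `x`, returns `y`. -/
def Program.Runs (P : Program) (x y : Val) (t : ℕ) : Prop :=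
  Eval P [x] (.call 0 (.var 0)) y t

/-- The result and the number of steps of an evaluation are unique. -/
theorem Eval.deterministic {P : Program} {env : List Val} {e : Expr} {v v' : Val} {t t' : ℕ}
    (h : Eval P env e v t) (h' : Eval P env e v' t') : v = v' ∧ t = t' := by
  induction h generalizing v' t' <;> cases h' <;> grind

/-! ### Inputs and outputs -/

mutual
/-- A weighted rooted tree as a value: the name of the root, its weight, and the list of the children
(a list is `0` if it is empty, and otherwise the pair of its head and its tail). -/
def RTree.encode (w : ℕ → ℕ) : RTree → Val
  | .node v cs => .pair (.nat v) (.pair (.nat (w v)) (RTree.encodeList w cs))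
/-- A list of weighted rooted trees as a value. -/
def RTree.encodeList (w : ℕ → ℕ) : List RTree → Val
  | [] => .nat 0
  | c :: cs => .pair (RTree.encode w c) (RTree.encodeList w cs)
end

/-- A decision tree as a value. -/
def DTree.encode : DTree → Val
  | .leaf v => .nat v
  | .query q l r => .pair (.nat q) (.pair l.encode r.encode)

end TreeSearch

namespace TreeSearch

/-! ### The dynamic program

A `Slots` value is the "no"-path of a search tree, laid out on a time axis: each slot is idle, or holds a query
and the subtree for the answer "yes". -/

-- The heart of the matter is that some optimal search tree has height `O(Δ log (n + w(T)))`. Let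
-- `D` be optimal for positive weights, `W` its total leaf weight, and `Y` the subtree reached after
-- `k` queries. Let `c` be a centroid of the weight of `D`: the outside of the subtree of `c`, and
-- the subtree of each child of `c`, carry at most `W / 2`. A competitor queries `c` and then its
-- children one after the other, and continues in each component with the restriction of `D` to it.
-- The new queries cost at most `(K + 1) W`, where `K` bounds the number of children. On the other
-- hand, a query of `D` survives in a restriction only if it separates two nodes of that component,
-- and each query does so in at most one component. So the part of `Y` in a component is relieved of
-- all `k` queries except those that belong to the component, and optimality gives `k w(Y) ≤ (K + 1)
-- W + k W / 2`. For `k = 4 (K + 1)` this reads `w(Y) ≤ 3 W / 4` (`four_mul_leafWeight_le`), and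
-- iteration bounds the height. Zero weights are handled by the perturbation `(n ^ 2 + 1) w + 1`
-- (`exists_isOptimal_height_le`).
--
-- With `B` logarithmic, there are only polynomially many sets of positions on a path of length `B`.
-- For the forest hanging from a node `p`, the dynamic program records which positions of the path
-- to the leaf `p` are occupied by queries from the forest, and minimizes the cost of the leaves in
-- the forest. A query to the child `v` is placed at a position that is idle in a row for the
-- children of `v`. From there on the paths to `v` and `p` part: later queries of the row move into
-- the "yes"-subtree, and their positions are free again on the path to `p`. Sibling forests are
-- combined by the union of disjoint sets of positions. Soundness (`sound_forestTable`) says that a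
-- row yields a genuine search tree of at most the recorded cost, since idle positions only get
-- removed. Completeness (`exists_mem_forestTable`) says that every search tree of height at most
-- `B` induces a row of at most its cost, because the paths to `v` and to its parent agree up to the
-- query `v` (`queryPath_adjacent`).
--
-- For the approximation, weights are replaced by `⌊w M / w(T)⌋` with `M = n ^ 2 E` and `E = ⌈q /
-- p⌉`. Rounding loses at most one unit per leaf and level, at most `n ^ 2` units in all, which is
-- worth `w(T) / E` in the original scale. If there are at least two nodes, every search tree costs
-- at least `w(T)`, so the loss is a factor of at most `1 + 1 / E`. The new total weight is at most
-- `n ^ 3 E`.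
--
-- Running times are obtained from a weakest-precondition calculus with upper bounds, in which each
-- function of the program is treated by an induction that follows its recursion.

abbrev Slots : Type := List (Option (ℕ × DTree))

abbrev Entry : Type := ℕ × Slots

namespace RTree

/-- The nodes of a forest. -/
def nodesList (cs : List RTree) : List ℕ :=
  (subtreesList cs).map root

end RTree

/-- The search tree whose "no"-path consists of the busy slots, and ends in the leaf `v`. -/
def build (v : ℕ) : Slots → DTree
  | [] => .leaf v
  | none :: z => build v z
  | some (q, r) :: z => .query q (build v z) r

/-- `w` times the length of `z` without the idle slots at the end. -/
def spanCost (w : ℕ) : Slots → ℕ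
  | [] => 0
  | some _ :: z => w + spanCost w z
  -- A vanishing cost of the rest means that no busy slot follows, unless `w = 0`, when both
  -- branches agree.
  | none :: z => if spanCost w z ≤ 0 then 0 else w + spanCost w z

/-- Idle slots only. -/
def blank (z : Slots) : Slots :=
  z.map fun _ => none

/-- All the ways of inserting the query to `v`, of weight `w`, in an idle slot. -/
def closings (v w c : ℕ) : Slots → List Entry
  | [] => []
  | x :: z =>
    -- A slot that precedes the query to `v` delays the leaf `v` by one even if it is idle: it may
    -- still receive a query from elsewhere in the tree.
    let r := (closings v w c z).map fun e => (e.1 + w, x :: e.2)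
    match x with
    | some _ => r
    -- The later slots become part of the "yes"-subtree of the new query, so on the "no"-path they
    -- are free again. Inside that subtree nothing will be added any more, so the leaf `v` only pays
    -- up to the last busy slot.
    | none => (c + (w + spanCost w z), some (v, build v z) :: blank z) :: r

/-- No slot is busy in both lists. -/
def disjointSlots : Slots → Slots → Bool
  | x :: z, y :: z' => !(x.isSome && y.isSome) && disjointSlots z z'
  | _, _ => true

/-- The union of two lists of slots. -/
def overlay : Slots → Slots → Slots
  | x :: z, y :: z' => x.or y :: overlay z z'
  | _, _ => []

/-- The same slots are busy. -/
def sameBusy : Slots → Slots → Bool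
  | x :: z, y :: z' => (x.isSome == y.isSome) && sameBusy z z'
  | _, _ => true

/-- Insert an entry into a table that keeps only the cheapest entry for each set of busy slots. -/
def insertMin (e : Entry) : List Entry → List Entry
  | [] => [e]
  | f :: L =>
    if sameBusy e.2 f.2 then (if e.1 ≤ f.1 then e :: L else f :: L) else f :: insertMin e L

def insertAll (L L' : List Entry) : List Entry :=
  L.foldr insertMin L'

def crossOne (e : Entry) : List Entry → List Entry
  | [] => []
  | f :: L =>
    if disjointSlots e.2 f.2 then (e.1 + f.1, overlay e.2 f.2) :: crossOne e L else crossOne e L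

/-- The products are merged row by row, so that intermediate tables also keep one row per set of
busy slots. -/
def cross : List Entry → List Entry → List Entry
  | [], _ => []
  | e :: L, L' => insertAll (crossOne e L') (cross L L')

def closeAll (v w : ℕ) : List Entry → List Entry
  | [] => []
  | e :: L => insertAll (closings v w e.1 e.2) (closeAll v w L)

mutual
def treeTable (w : ℕ → ℕ) (b : Slots) : RTree → List Entry
  | .node v cs => closeAll v (w v) (forestTable w b cs)
/-- The table of a forest: for every attainable set of busy slots, an entry of least cost. -/
def forestTable (w : ℕ → ℕ) (b : Slots) : List RTree → List Entry
  | [] => [(0, b)]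
  | c :: cs => cross (treeTable w b c) (forestTable w b cs)
end

/-- The best entry when the forest hangs from a root of weight `w`. -/
def best (w : ℕ) : List Entry → Option Entry
  | [] => none
  | e :: L =>
    match best w L with
    | none => some (e.1 + spanCost w e.2, e.2)
    | some r => if e.1 + spanCost w e.2 ≤ r.1 then some (e.1 + spanCost w e.2, e.2) else some r

/-- The set of busy slots. -/
def busy (z : Slots) : List Bool :=
  z.map Option.isSome

/-- The recursion pattern of all functions here: a nonempty forest consists of a root, the forest of
its children, and the forest of the remaining trees. A single motive on forests replaces the two
motives of the nested recursor. -/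
theorem RTree.forest_induction {p : List RTree → Prop} (nil : p [])
    (cons : ∀ v cs' cs, p cs' → p cs → p (.node v cs' :: cs)) (cs : List RTree) : p cs := by
  have key : ∀ T : RTree, ∀ v cs, T = .node v cs → p cs := by
    intro T
    refine RTree.rec (motive_1 := fun T => ∀ v cs, T = .node v cs → p cs) (motive_2 := p)
      ?_ nil ?_ T
    · intro v cs h v' cs' e
      cases e
      exact h
    · intro T cs hT hcs
      obtain ⟨v, cs'⟩ := T
      exact cons v cs' cs (hT v cs' rfl) hcs
  exact key (.node 0 cs) 0 cs rfl

@[simp] theorem RTree.nodesList_nil : RTree.nodesList [] = [] := by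
  simp [RTree.nodesList, RTree.subtreesList]

theorem RTree.nodesList_cons (v : ℕ) (cs' cs : List RTree) :
    RTree.nodesList (.node v cs' :: cs) = v :: (RTree.nodesList cs' ++ RTree.nodesList cs) := by
  simp [RTree.nodesList, RTree.subtreesList, RTree.subtrees, RTree.root]

theorem RTree.nodes_node (v : ℕ) (cs : List RTree) :
    (RTree.node v cs).nodes = v :: RTree.nodesList cs := by
  simp [RTree.nodesList, RTree.nodes, RTree.subtrees, RTree.root]

theorem forestTable_cons (w : ℕ → ℕ) (b : Slots) (v : ℕ) (cs' cs : List RTree) :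
    forestTable w b (.node v cs' :: cs) =
      cross (closeAll v (w v) (forestTable w b cs')) (forestTable w b cs) := by
  simp [forestTable, treeTable]

/-! ### Shape of the tables -/

/-- The rows of a table have `B` slots, and distinct sets of busy slots. -/
def TableOK (B : ℕ) (L : List Entry) : Prop :=
  (∀ e ∈ L, e.2.length = B) ∧ (L.map fun e => busy e.2).Nodup

/-- Equal lengths are needed because the comparison stops at the end of the shorter list; this is
why the number of slots is part of `TableOK`. -/
theorem sameBusy_iff {z z' : Slots} (h : z.length = z'.length) :
    sameBusy z z' = true ↔ busy z = busy z' := by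
  induction z generalizing z' with
  | nil => cases z' <;> simp_all [sameBusy, busy]
  | cons x z ih =>
    cases z' with
    | nil => simp at h
    | cons y z' =>
      simp only [List.length_cons, Nat.add_right_cancel_iff] at h
      simpa [sameBusy, busy] using fun _ => ih h

theorem TableOK.length_le {B : ℕ} {L : List Entry} (h : TableOK B L) : L.length ≤ 2 ^ B := by
  have h1 : (L.map fun e => busy e.2).toFinset ⊆
      (Finset.univ : Finset (List.Vector Bool B)).image List.Vector.toList := by
    intro k hk
    simp only [List.mem_toFinset, List.mem_map] at hk
    obtain ⟨e, he, rfl⟩ := hk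
    exact Finset.mem_image.2 ⟨⟨busy e.2, by simpa [busy] using h.1 e he⟩, Finset.mem_univ _, rfl⟩
  have h2 := Finset.card_le_card h1
  rw [List.toFinset_card_of_nodup h.2] at h2
  refine le_trans (by simpa using h2) (Finset.card_image_le.trans ?_)
  exact le_of_eq (by rw [Finset.card_univ, card_vector, Fintype.card_bool])

theorem mem_of_mem_insertMin {e x : Entry} {L : List Entry} (h : x ∈ insertMin e L) :
    x ∈ e :: L := by
  induction L with
  | nil => simpa [insertMin] using h
  | cons f L ih =>
    unfold insertMin at h
    split_ifs at h <;> simp at h ih ⊢ <;> tauto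

/-- A row is discarded only in favour of one with the same busy slots and no larger cost. This is
harmless, as `closings`, `overlay` and `spanCost` change the costs and busy sets in a way that
depends on the busy slots only. -/
theorem exists_mem_insertMin {B : ℕ} {e : Entry} {L : List Entry} (he : e.2.length = B)
    (hL : ∀ f ∈ L, f.2.length = B) {x : Entry} (hx : x ∈ e :: L) :
    ∃ y ∈ insertMin e L, busy y.2 = busy x.2 ∧ y.1 ≤ x.1 := by
  induction L with
  | nil => exact ⟨x, by simpa [insertMin] using hx, rfl, le_rfl⟩
  | cons f L ih =>
    have hf := hL f (by simp)
    have ih := ih (fun g hg => hL g (by simp [hg]))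
    have hs := sameBusy_iff (he.trans hf.symm)
    unfold insertMin
    simp only [List.mem_cons] at hx ih
    split_ifs with h1 h2
    · rcases hx with rfl | rfl | hx
      · exact ⟨x, by simp, rfl, le_rfl⟩
      · exact ⟨e, by simp, hs.1 h1, h2⟩
      · exact ⟨x, by simp [hx], rfl, le_rfl⟩
    · rcases hx with rfl | rfl | hx
      · exact ⟨f, by simp, (hs.1 h1).symm, by omega⟩
      · exact ⟨x, by simp, rfl, le_rfl⟩
      · exact ⟨x, by simp [hx], rfl, le_rfl⟩
    · rcases hx with hx | rfl | hx
      · obtain ⟨y, hy, h⟩ := ih (Or.inl hx)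
        exact ⟨y, by simp [hy], h⟩
      · exact ⟨x, by simp, rfl, le_rfl⟩
      · obtain ⟨y, hy, h⟩ := ih (Or.inr hx)
        exact ⟨y, by simp [hy], h⟩

theorem TableOK.insertMin {B : ℕ} {e : Entry} {L : List Entry} (he : e.2.length = B)
    (hL : TableOK B L) : TableOK B (insertMin e L) := by
  refine ⟨fun x hx => ?_, ?_⟩
  · rcases List.mem_cons.1 (mem_of_mem_insertMin hx) with rfl | hx
    exacts [he, hL.1 x hx]
  · induction L with
    | nil => simp [TreeSearch.insertMin]
    | cons f L ih =>
      have hf := hL.1 f (by simp)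
      have hs := sameBusy_iff (he.trans hf.symm)
      have hn := hL.2
      simp only [List.map_cons, List.nodup_cons] at hn
      have ih := ih ⟨fun g hg => hL.1 g (by simp [hg]), hn.2⟩
      unfold TreeSearch.insertMin
      split_ifs with h1 h2
      · simpa [hs.1 h1] using hn
      · simpa using hn
      · simp only [List.map_cons, List.nodup_cons]
        refine ⟨fun hm => ?_, ih⟩
        obtain ⟨g, hg, hgf⟩ := List.mem_map.1 hm
        rcases List.mem_cons.1 (mem_of_mem_insertMin hg) with rfl | hg
        · exact h1 (hs.2 hgf)
        · exact hn.1 (List.mem_map.2 ⟨g, hg, hgf⟩)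

theorem TableOK.insertAll {B : ℕ} {L L' : List Entry} (h : ∀ e ∈ L, e.2.length = B)
    (hL : TableOK B L') : TableOK B (insertAll L L') := by
  induction L with
  | nil => simpa [TreeSearch.insertAll] using hL
  | cons e L ih =>
    exact TableOK.insertMin (h e (by simp)) (ih fun f hf => h f (by simp [hf]))

theorem mem_of_mem_insertAll {x : Entry} {L L' : List Entry} (h : x ∈ insertAll L L') :
    x ∈ L ∨ x ∈ L' := by
  induction L with
  | nil => simpa [insertAll] using h
  | cons e L ih =>
    rcases List.mem_cons.1 (mem_of_mem_insertMin h) with rfl | hx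
    · simp
    · rcases ih hx with h | h <;> simp [h]

theorem exists_mem_insertAll {B : ℕ} {L L' : List Entry} (h : ∀ e ∈ L, e.2.length = B)
    (hL : TableOK B L') {x : Entry} (hx : x ∈ L ∨ x ∈ L') :
    ∃ y ∈ insertAll L L', busy y.2 = busy x.2 ∧ y.1 ≤ x.1 := by
  induction L with
  | nil => exact ⟨x, by simpa [insertAll] using hx, rfl, le_rfl⟩
  | cons e L ih =>
    have h' : ∀ f ∈ L, f.2.length = B := fun f hf => h f (by simp [hf])
    have hok := TableOK.insertAll h' hL
    have he := h e (by simp)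
    have key : ∀ u ∈ e :: insertAll L L', ∃ y ∈ insertAll (e :: L) L',
        busy y.2 = busy u.2 ∧ y.1 ≤ u.1 := fun u hu => exists_mem_insertMin he hok.1 hu
    by_cases hxe : x = e
    · exact key x (by simp [hxe])
    · obtain ⟨u, hu, h1, h2⟩ := ih h' (by simpa [hxe] using hx)
      obtain ⟨y, hy, h3, h4⟩ := key u (by simp [hu])
      exact ⟨y, hy, h3.trans h1, h4.trans h2⟩

-- Rows produced by closings and unions

/-- A closing is a choice of an idle slot, cutting the row into `z1` and `z2`. In this form the
recorded depth of `v` is visible: `z1.length`, one for the query itself, and the busy extent of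
`z2`. -/
theorem mem_closings {v w c : ℕ} {z : Slots} {e : Entry} :
    e ∈ closings v w c z ↔ ∃ z1 z2, z = z1 ++ none :: z2 ∧
      e = (c + w * z1.length + (w + spanCost w z2), z1 ++ some (v, build v z2) :: blank z2) := by
  induction z generalizing e with
  | nil => simp [closings]
  | cons x z ih =>
    have key : (∃ a ∈ closings v w c z, (a.1 + w, x :: a.2) = e) ↔
        ∃ z1 z2, x :: z = (x :: z1) ++ none :: z2 ∧
          e = (c + w * (x :: z1).length + (w + spanCost w z2),
            (x :: z1) ++ some (v, build v z2) :: blank z2) := by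
      constructor
      · rintro ⟨a, ha, rfl⟩
        obtain ⟨z1, z2, rfl, rfl⟩ := ih.1 ha
        refine ⟨z1, z2, by simp, ?_⟩
        simp only [List.length_cons, List.cons_append, Prod.mk.injEq, and_true]
        ring
      · rintro ⟨z1, z2, h, rfl⟩
        simp only [List.cons_append, List.cons.injEq, true_and] at h
        refine ⟨_, ih.2 ⟨z1, z2, h, rfl⟩, ?_⟩
        simp only [List.length_cons, List.cons_append, Prod.mk.injEq, and_true]
        ring
    -- Either the chosen slot is the first one, or the choice is made in the tail; `key` identifies
    -- the latter with the recursive call.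
    have split : (∃ z1 z2, x :: z = z1 ++ none :: z2 ∧
        e = (c + w * z1.length + (w + spanCost w z2), z1 ++ some (v, build v z2) :: blank z2)) ↔
        (x = none ∧ e = (c + (w + spanCost w z), some (v, build v z) :: blank z)) ∨
        ∃ z1 z2, x :: z = (x :: z1) ++ none :: z2 ∧
          e = (c + w * (x :: z1).length + (w + spanCost w z2),
            (x :: z1) ++ some (v, build v z2) :: blank z2) := by
      constructor
      · rintro ⟨z1, z2, h, rfl⟩
        cases z1 with
        | nil =>
          simp only [List.nil_append, List.cons.injEq] at h
          obtain ⟨rfl, rfl⟩ := h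
          left; simp
        | cons y z1 =>
          simp only [List.cons_append, List.cons.injEq] at h
          obtain ⟨rfl, rfl⟩ := h
          right; exact ⟨z1, z2, rfl, rfl⟩
      · rintro (⟨rfl, rfl⟩ | ⟨z1, z2, h, rfl⟩)
        · exact ⟨[], z, by simp⟩
        · exact ⟨x :: z1, z2, h, rfl⟩
    rw [split, ← key]
    cases x <;> simp [closings]

theorem length_closings_le (v w c : ℕ) (z : Slots) : (closings v w c z).length ≤ z.length := by
  induction z with
  | nil => simp [closings]
  | cons x z ih => cases x <;> simp [closings] <;> omega

theorem length_of_mem_closings {v w c : ℕ} {z : Slots} {e : Entry} (h : e ∈ closings v w c z) :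
    e.2.length = z.length := by
  obtain ⟨z1, z2, rfl, rfl⟩ := mem_closings.1 h
  simp [blank]

theorem length_overlay {z z' : Slots} (h : z.length = z'.length) :
    (overlay z z').length = z.length := by
  induction z generalizing z' with
  | nil => simp [overlay]
  | cons x z ih =>
    cases z' with
    | nil => simp at h
    | cons y z' => simpa [overlay] using ih (by simpa using h)

theorem mem_crossOne {e x : Entry} {L : List Entry} :
    x ∈ crossOne e L ↔
      ∃ f ∈ L, disjointSlots e.2 f.2 = true ∧ x = (e.1 + f.1, overlay e.2 f.2) := by
  induction L with
  | nil => simp [crossOne]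
  | cons f L ih =>
    unfold crossOne
    split_ifs with h <;> simp [ih, h]

theorem length_crossOne_le (e : Entry) (L : List Entry) : (crossOne e L).length ≤ L.length := by
  induction L with
  | nil => simp [crossOne]
  | cons f L ih => unfold crossOne; split_ifs <;> simp <;> omega

theorem length_of_mem_crossOne {B : ℕ} {e x : Entry} {L : List Entry} (he : e.2.length = B)
    (hL : TableOK B L) (h : x ∈ crossOne e L) : x.2.length = B := by
  obtain ⟨f, hf, -, rfl⟩ := mem_crossOne.1 h
  simpa [he] using length_overlay (he.trans (hL.1 f hf).symm)

theorem tableOK_nil (B : ℕ) : TableOK B [] := by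
  simp [TableOK]

theorem TableOK.tail {B : ℕ} {e : Entry} {L : List Entry} (h : TableOK B (e :: L)) :
    TableOK B L :=
  ⟨fun x hx => h.1 x (by simp [hx]), (List.nodup_cons.1 h.2).2⟩

theorem TableOK.cross {B : ℕ} {L L' : List Entry} (hL : TableOK B L) (hL' : TableOK B L') :
    TableOK B (cross L L') := by
  induction L with
  | nil => exact tableOK_nil B
  | cons e L ih =>
    exact TableOK.insertAll
      (fun x hx => length_of_mem_crossOne (hL.1 e (by simp)) hL' hx) (ih hL.tail)

theorem TableOK.closeAll {B : ℕ} (v w : ℕ) {L : List Entry} (hL : TableOK B L) :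
    TableOK B (closeAll v w L) := by
  induction L with
  | nil => exact tableOK_nil B
  | cons e L ih =>
    exact TableOK.insertAll
      (fun x hx => (length_of_mem_closings hx).trans (hL.1 e (by simp))) (ih hL.tail)

theorem tableOK_forestTable (w : ℕ → ℕ) (b : Slots) (cs : List RTree) :
    TableOK b.length (forestTable w b cs) := by
  induction cs using RTree.forest_induction with
  | nil => simp [forestTable, TableOK]
  | cons v cs' cs h' h =>
    rw [forestTable_cons]
    exact (h'.closeAll v (w v)).cross h

theorem mem_cross {x : Entry} {L L' : List Entry} (h : x ∈ cross L L') :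
    ∃ e ∈ L, ∃ f ∈ L', disjointSlots e.2 f.2 = true ∧ x = (e.1 + f.1, overlay e.2 f.2) := by
  induction L with
  | nil => simp [cross] at h
  | cons e L ih =>
    rcases mem_of_mem_insertAll h with h | h
    · exact ⟨e, by simp, mem_crossOne.1 h⟩
    · obtain ⟨e', he', h⟩ := ih h
      exact ⟨e', by simp [he'], h⟩

theorem exists_mem_cross {B : ℕ} {L L' : List Entry} (hL : TableOK B L) (hL' : TableOK B L')
    {e f : Entry} (he : e ∈ L) (hf : f ∈ L') (h : disjointSlots e.2 f.2 = true) :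
    ∃ y ∈ cross L L', busy y.2 = busy (overlay e.2 f.2) ∧ y.1 ≤ e.1 + f.1 := by
  induction L with
  | nil => simp at he
  | cons g L ih =>
    have hg : ∀ x ∈ crossOne g L', x.2.length = B :=
      fun x hx => length_of_mem_crossOne (hL.1 g (by simp)) hL' hx
    have hc := hL.tail.cross hL'
    rcases List.mem_cons.1 he with rfl | he
    · exact exists_mem_insertAll hg hc (x := (e.1 + f.1, overlay e.2 f.2))
        (Or.inl (mem_crossOne.2 ⟨f, hf, h, rfl⟩))
    · obtain ⟨u, hu, h1, h2⟩ := ih hL.tail he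
      obtain ⟨y, hy, h3, h4⟩ := exists_mem_insertAll hg hc (Or.inr hu)
      exact ⟨y, hy, h3.trans h1, h4.trans h2⟩

theorem mem_closeAll {x : Entry} {v w : ℕ} {L : List Entry} (h : x ∈ closeAll v w L) :
    ∃ e ∈ L, x ∈ closings v w e.1 e.2 := by
  induction L with
  | nil => simp [closeAll] at h
  | cons e L ih =>
    rcases mem_of_mem_insertAll h with h | h
    · exact ⟨e, by simp, h⟩
    · obtain ⟨e', he', h⟩ := ih h
      exact ⟨e', by simp [he'], h⟩

theorem exists_mem_closeAll {B : ℕ} {v w : ℕ} {L : List Entry} (hL : TableOK B L)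
    {e x : Entry} (he : e ∈ L) (hx : x ∈ closings v w e.1 e.2) :
    ∃ y ∈ closeAll v w L, busy y.2 = busy x.2 ∧ y.1 ≤ x.1 := by
  induction L with
  | nil => simp at he
  | cons g L ih =>
    have hg : ∀ x ∈ closings v w g.1 g.2, x.2.length = B :=
      fun x hx => (length_of_mem_closings hx).trans (hL.1 g (by simp))
    have hc := hL.tail.closeAll v w
    rcases List.mem_cons.1 he with rfl | he
    · exact exists_mem_insertAll hg hc (Or.inl hx)
    · obtain ⟨u, hu, h1, h2⟩ := ih hL.tail he
      obtain ⟨y, hy, h3, h4⟩ := exists_mem_insertAll hg hc (Or.inr hu)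
      exact ⟨y, hy, h3.trans h1, h4.trans h2⟩

theorem best_spec (w : ℕ) {L : List Entry} (hL : L ≠ []) :
    ∃ e ∈ L, best w L = some (e.1 + spanCost w e.2, e.2) ∧
      ∀ f ∈ L, e.1 + spanCost w e.2 ≤ f.1 + spanCost w f.2 := by
  induction L with
  | nil => exact absurd rfl hL
  | cons g L ih =>
    by_cases h : L = []
    · subst h
      exact ⟨g, by simp, by simp [best], by simp⟩
    · obtain ⟨e, he, h1, h2⟩ := ih h
      by_cases hle : g.1 + spanCost w g.2 ≤ e.1 + spanCost w e.2
      · refine ⟨g, by simp, by simp [best, h1, hle], fun f hf => ?_⟩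
        rcases List.mem_cons.1 hf with rfl | hf
        exacts [le_rfl, hle.trans (h2 f hf)]
      · refine ⟨e, by simp [he], by simp [best, h1, hle], fun f hf => ?_⟩
        rcases List.mem_cons.1 hf with rfl | hf
        exacts [by omega, h2 f hf]

/-! ### A calculus for running times -/

/-- The function `f` of the program `P`, applied to `x`, returns `v` after at most `b` steps. -/
def Call (P : Program) (f : ℕ) (x v : Val) (b : ℕ) : Prop :=
  ∃ body, P[f]? = some body ∧ ∃ t ≤ b, Eval P [x] body v t

/-- A sufficient condition for the evaluation of an expression to return a value `v` after at most `b`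
steps, such that `Q v b`. -/
def wp (P : Program) : List Val → Expr → (Val → ℕ → Prop) → Prop
  | env, .var i, Q => match env[i]? with
    | some v => Q v 1
    | none => False
  | _, .lit n, Q => Q (.nat n) 1
  | env, .pair a b, Q => wp P env a fun x s => wp P env b fun y t => Q (.pair x y) (s + t + 1)
  | env, .fst a, Q => wp P env a fun x s => match x with
    | .pair y _ => Q y (s + 1)
    | .nat _ => False
  | env, .snd a, Q => wp P env a fun x s => match x with
    | .pair _ y => Q y (s + 1)
    | .nat _ => False
  | env, .add a b, Q => wp P env a fun x s => wp P env b fun y t => match x, y with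
    | .nat m, .nat n => Q (.nat (m + n)) (s + t + 1)
    | _, _ => False
  | env, .sub a b, Q => wp P env a fun x s => wp P env b fun y t => match x, y with
    | .nat m, .nat n => Q (.nat (m - n)) (s + t + 1)
    | _, _ => False
  | env, .ifLe a b c d, Q => wp P env a fun x s => wp P env b fun y t => match x, y with
    | .nat m, .nat n =>
      (m ≤ n → wp P env c fun v r => Q v (s + t + r + 1)) ∧
      (¬ m ≤ n → wp P env d fun v r => Q v (s + t + r + 1))
    | _, _ => False
  | env, .ifPair a c d, Q => wp P env a fun x s => match x with
    | .pair _ _ => wp P env c fun v r => Q v (s + r + 1)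
    | .nat _ => wp P env d fun v r => Q v (s + r + 1)
  | env, .letIn a body, Q => wp P env a fun x s => wp P (x :: env) body fun v r => Q v (s + r + 1)
  | env, .call f a, Q => wp P env a fun x s => ∃ v b, Call P f x v b ∧ Q v (s + b + 1)

/-- Soundness of the calculus. A call contributes only its proven bound, so the computed `b`
dominates the true number of steps without being equal to it. -/
theorem exists_eval_of_wp {P : Program} {env : List Val} {e : Expr} {Q : Val → ℕ → Prop}
    (h : wp P env e Q) : ∃ v t b, Eval P env e v t ∧ t ≤ b ∧ Q v b := by
  induction e generalizing env Q with
  | var i =>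
    unfold wp at h
    split at h
    · exact ⟨_, _, _, .var ‹_›, le_rfl, h⟩
    · exact h.elim
  | lit n => exact ⟨_, _, _, .lit, le_rfl, h⟩
  | pair a b iha ihb =>
    obtain ⟨x, s, s', ha, hs, h⟩ := iha h
    obtain ⟨y, t, t', hb, ht, h⟩ := ihb h
    exact ⟨_, _, _, .pair ha hb, by omega, h⟩
  | fst a iha =>
    obtain ⟨x, s, s', ha, hs, h⟩ := iha h
    cases x with
    | nat => exact h.elim
    | pair x y => exact ⟨_, _, _, .fst ha, by omega, h⟩
  | snd a iha =>
    obtain ⟨x, s, s', ha, hs, h⟩ := iha h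
    cases x with
    | nat => exact h.elim
    | pair x y => exact ⟨_, _, _, .snd ha, by omega, h⟩
  | add a b iha ihb =>
    obtain ⟨x, s, s', ha, hs, h⟩ := iha h
    obtain ⟨y, t, t', hb, ht, h⟩ := ihb h
    cases x <;> cases y <;> first | exact h.elim | exact ⟨_, _, _, .add ha hb, by omega, h⟩
  | sub a b iha ihb =>
    obtain ⟨x, s, s', ha, hs, h⟩ := iha h
    obtain ⟨y, t, t', hb, ht, h⟩ := ihb h
    cases x <;> cases y <;> first | exact h.elim | exact ⟨_, _, _, .sub ha hb, by omega, h⟩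
  | ifLe a b c d iha ihb ihc ihd =>
    obtain ⟨x, s, s', ha, hs, h⟩ := iha h
    obtain ⟨y, t, t', hb, ht, h⟩ := ihb h
    cases x with
    | pair => exact h.elim
    | nat m =>
      cases y with
      | pair => exact h.elim
      | nat n =>
        by_cases hmn : m ≤ n
        · obtain ⟨v, r, r', hc, hr, h⟩ := ihc (h.1 hmn)
          exact ⟨_, _, _, .ifLe_true hmn ha hb hc, by omega, h⟩
        · obtain ⟨v, r, r', hd, hr, h⟩ := ihd (h.2 hmn)
          exact ⟨_, _, _, .ifLe_false hmn ha hb hd, by omega, h⟩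
  | ifPair a c d iha ihc ihd =>
    obtain ⟨x, s, s', ha, hs, h⟩ := iha h
    cases x with
    | pair =>
      obtain ⟨v, r, r', hc, hr, h⟩ := ihc h
      exact ⟨_, _, _, .ifPair_true ha hc, by omega, h⟩
    | nat =>
      obtain ⟨v, r, r', hd, hr, h⟩ := ihd h
      exact ⟨_, _, _, .ifPair_false ha hd, by omega, h⟩
  | letIn a body iha ihb =>
    obtain ⟨x, s, s', ha, hs, h⟩ := iha h
    obtain ⟨y, t, t', hb, ht, h⟩ := ihb h
    exact ⟨_, _, _, .letIn ha hb, by omega, h⟩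
  | call f a iha =>
    obtain ⟨x, s, s', ha, hs, v, b, ⟨body, hf, r, hr, hb⟩, h⟩ := iha h
    exact ⟨_, _, _, .call hf ha hb, by omega, h⟩

theorem Call.intro {P : Program} {f : ℕ} {x v : Val} {b : ℕ} {body : Expr} (hf : P[f]? = some body)
    (h : wp P [x] body fun v' t => v' = v ∧ t ≤ b) : Call P f x v b := by
  obtain ⟨v', t, t', he, ht, rfl, hb⟩ := exists_eval_of_wp h
  exact ⟨body, hf, t, ht.trans hb, he⟩

/-! ### The program -/

namespace Code

/-- `(v, z) ↦ build v z` -/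
def build : Expr :=
  .ifPair (.snd (.var 0))
    (.ifPair (.fst (.snd (.var 0)))
      (.pair (.fst (.fst (.snd (.var 0))))
        (.pair (.call 1 (.pair (.fst (.var 0)) (.snd (.snd (.var 0)))))
          (.snd (.fst (.snd (.var 0))))))
      (.call 1 (.pair (.fst (.var 0)) (.snd (.snd (.var 0))))))
    (.fst (.var 0))

/-- `(w, z) ↦ spanCost w z` -/
def spanCost : Expr :=
  .ifPair (.snd (.var 0))
    (.letIn (.call 2 (.pair (.fst (.var 0)) (.snd (.snd (.var 0)))))
      (.ifPair (.fst (.snd (.var 1)))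
        (.add (.fst (.var 1)) (.var 0))
        (.ifLe (.var 0) (.lit 0) (.lit 0) (.add (.fst (.var 1)) (.var 0)))))
    (.lit 0)

/-- `z ↦ blank z` -/
def blank : Expr :=
  .ifPair (.var 0) (.pair (.lit 0) (.call 3 (.snd (.var 0)))) (.lit 0)

/-- `((x, w), L) ↦ L.map fun e => (e.1 + w, x :: e.2)` -/
def mapCons : Expr :=
  .ifPair (.snd (.var 0))
    (.pair
      (.pair (.add (.fst (.fst (.snd (.var 0)))) (.snd (.fst (.var 0))))
        (.pair (.fst (.fst (.var 0))) (.snd (.fst (.snd (.var 0))))))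
      (.call 4 (.pair (.fst (.var 0)) (.snd (.snd (.var 0))))))
    (.lit 0)

/-- `((v, w), (c, z)) ↦ closings v w c z` -/
def closings : Expr :=
  .ifPair (.snd (.snd (.var 0)))
    (.letIn
      (.call 4 (.pair (.pair (.fst (.snd (.snd (.var 0)))) (.snd (.fst (.var 0))))
        (.call 5 (.pair (.fst (.var 0))
          (.pair (.fst (.snd (.var 0))) (.snd (.snd (.snd (.var 0)))))))))
      (.ifPair (.fst (.snd (.snd (.var 1))))
        (.var 0)
        (.pair
          (.pair
            (.add (.fst (.snd (.var 1))) (.add (.snd (.fst (.var 1)))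
              (.call 2 (.pair (.snd (.fst (.var 1))) (.snd (.snd (.snd (.var 1))))))))
            (.pair
              (.pair (.fst (.fst (.var 1)))
                (.call 1 (.pair (.fst (.fst (.var 1))) (.snd (.snd (.snd (.var 1)))))))
              (.call 3 (.snd (.snd (.snd (.var 1)))))))
          (.var 0))))
    (.lit 0)

/-- `(z, z') ↦ disjointSlots z z'` -/
def disjointSlots : Expr :=
  .ifPair (.fst (.var 0))
    (.ifPair (.snd (.var 0))
      (.ifPair (.fst (.fst (.var 0)))
        (.ifPair (.fst (.snd (.var 0)))
          (.lit 0)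
          (.call 6 (.pair (.snd (.fst (.var 0))) (.snd (.snd (.var 0))))))
        (.call 6 (.pair (.snd (.fst (.var 0))) (.snd (.snd (.var 0))))))
      (.lit 1))
    (.lit 1)

/-- `(z, z') ↦ overlay z z'` -/
def overlay : Expr :=
  .ifPair (.fst (.var 0))
    (.ifPair (.snd (.var 0))
      (.pair
        (.ifPair (.fst (.fst (.var 0))) (.fst (.fst (.var 0))) (.fst (.snd (.var 0))))
        (.call 7 (.pair (.snd (.fst (.var 0))) (.snd (.snd (.var 0))))))
      (.lit 0))
    (.lit 0)

/-- `(z, z') ↦ sameBusy z z'` -/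
def sameBusy : Expr :=
  .ifPair (.fst (.var 0))
    (.ifPair (.snd (.var 0))
      (.ifPair (.fst (.fst (.var 0)))
        (.ifPair (.fst (.snd (.var 0)))
          (.call 8 (.pair (.snd (.fst (.var 0))) (.snd (.snd (.var 0)))))
          (.lit 0))
        (.ifPair (.fst (.snd (.var 0)))
          (.lit 0)
          (.call 8 (.pair (.snd (.fst (.var 0))) (.snd (.snd (.var 0)))))))
      (.lit 1))
    (.lit 1)

/-- `(e, L) ↦ insertMin e L` -/
def insertMin : Expr :=
  .ifPair (.snd (.var 0))
    (.ifLe (.lit 1)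
        (.call 8 (.pair (.snd (.fst (.var 0))) (.snd (.fst (.snd (.var 0))))))
      (.ifLe (.fst (.fst (.var 0))) (.fst (.fst (.snd (.var 0))))
        (.pair (.fst (.var 0)) (.snd (.snd (.var 0))))
        (.snd (.var 0)))
      (.pair (.fst (.snd (.var 0)))
        (.call 9 (.pair (.fst (.var 0)) (.snd (.snd (.var 0)))))))
    (.pair (.fst (.var 0)) (.lit 0))

/-- `(L, L') ↦ insertAll L L'` -/
def insertAll : Expr :=
  .ifPair (.fst (.var 0))
    (.call 9 (.pair (.fst (.fst (.var 0)))
      (.call 10 (.pair (.snd (.fst (.var 0))) (.snd (.var 0))))))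
    (.snd (.var 0))

/-- `(e, L) ↦ crossOne e L` -/
def crossOne : Expr :=
  .ifPair (.snd (.var 0))
    (.letIn (.call 11 (.pair (.fst (.var 0)) (.snd (.snd (.var 0)))))
      (.ifLe (.lit 1)
          (.call 6 (.pair (.snd (.fst (.var 1))) (.snd (.fst (.snd (.var 1))))))
        (.pair
          (.pair (.add (.fst (.fst (.var 1))) (.fst (.fst (.snd (.var 1)))))
            (.call 7 (.pair (.snd (.fst (.var 1))) (.snd (.fst (.snd (.var 1)))))))
          (.var 0))
        (.var 0)))
    (.lit 0)

/-- `(L, L') ↦ cross L L'` -/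
def cross : Expr :=
  .ifPair (.fst (.var 0))
    (.call 10 (.pair (.call 11 (.pair (.fst (.fst (.var 0))) (.snd (.var 0))))
      (.call 12 (.pair (.snd (.fst (.var 0))) (.snd (.var 0))))))
    (.lit 0)

/-- `((v, w), L) ↦ closeAll v w L` -/
def closeAll : Expr :=
  .ifPair (.snd (.var 0))
    (.call 10 (.pair (.call 5 (.pair (.fst (.var 0)) (.fst (.snd (.var 0)))))
      (.call 13 (.pair (.fst (.var 0)) (.snd (.snd (.var 0)))))))
    (.lit 0)

/-- `(b, cs) ↦ forestTable w b cs` -/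
def forestTable : Expr :=
  .ifPair (.snd (.var 0))
    (.letIn (.fst (.snd (.var 0)))
      (.call 12 (.pair
        (.call 13 (.pair (.pair (.fst (.var 0)) (.fst (.snd (.var 0))))
          (.call 14 (.pair (.fst (.var 1)) (.snd (.snd (.var 0)))))))
        (.call 14 (.pair (.fst (.var 1)) (.snd (.snd (.var 1))))))))
    (.pair (.pair (.lit 0) (.fst (.var 0))) (.lit 0))

/-- `(w, L) ↦ best w L` -/
def best : Expr :=
  .ifPair (.snd (.var 0))
    (.letIn (.call 15 (.pair (.fst (.var 0)) (.snd (.snd (.var 0)))))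
      (.letIn
        (.add (.fst (.fst (.snd (.var 1))))
          (.call 2 (.pair (.fst (.var 1)) (.snd (.fst (.snd (.var 1)))))))
        (.ifPair (.var 1)
          (.ifLe (.var 0) (.fst (.var 1))
            (.pair (.var 0) (.snd (.fst (.snd (.var 2)))))
            (.var 1))
          (.pair (.var 0) (.snd (.fst (.snd (.var 2))))))))
    (.lit 0)

/-- `(cs, i) ↦ maxChildren cs i` -/
def maxChildren : Expr :=
  .ifPair (.fst (.var 0))
    (.letIn (.call 16 (.pair (.snd (.snd (.fst (.fst (.var 0))))) (.lit 0)))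
      (.letIn (.call 16 (.pair (.snd (.fst (.var 1))) (.add (.snd (.var 1)) (.lit 1))))
        (.ifLe (.var 0) (.var 1) (.var 1) (.var 0))))
    (.snd (.var 0))

/-- `cs ↦ (nodesList cs).length` -/
def size : Expr :=
  .ifPair (.var 0)
    (.add (.lit 1) (.add (.call 17 (.snd (.snd (.fst (.var 0))))) (.call 17 (.snd (.var 0)))))
    (.lit 0)

/-- `cs ↦ ((nodesList cs).map w).sum` -/
def weight : Expr :=
  .ifPair (.var 0)
    (.add (.fst (.snd (.fst (.var 0))))
      (.add (.call 18 (.snd (.snd (.fst (.var 0))))) (.call 18 (.snd (.var 0)))))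
    (.lit 0)

/-- `(a, k) ↦ a * k` -/
def mul : Expr :=
  .ifLe (.snd (.var 0)) (.lit 0) (.lit 0)
    (.add (.fst (.var 0)) (.call 19 (.pair (.fst (.var 0)) (.sub (.snd (.var 0)) (.lit 1)))))

/-- `(k, z) ↦ List.replicate k none ++ z` -/
def pad : Expr :=
  .ifLe (.fst (.var 0)) (.lit 0) (.snd (.var 0))
    (.pair (.lit 0) (.call 20 (.pair (.sub (.fst (.var 0)) (.lit 1)) (.snd (.var 0)))))

/-- `((m, c), (k, z))`: prepend `k` idle slots to `z`, and double `c`, until `m ≤ c` -/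
def grow : Expr :=
  .ifLe (.fst (.fst (.var 0))) (.snd (.fst (.var 0))) (.snd (.snd (.var 0)))
    (.call 21 (.pair
      (.pair (.fst (.fst (.var 0))) (.add (.snd (.fst (.var 0))) (.snd (.fst (.var 0)))))
      (.pair (.fst (.snd (.var 0))) (.call 20 (.snd (.var 0))))))

/-- the dynamic program, on a weighted tree -/
def core : Expr :=
  .letIn (.pair (.var 0) (.lit 0))
    (.letIn
      (.call 21 (.pair
        (.pair (.add (.lit 1) (.add (.call 17 (.var 0)) (.call 18 (.var 0)))) (.lit 1))
        (.pair
          (.call 19 (.pair (.add (.lit 1) (.call 16 (.pair (.var 0) (.lit 0)))) (.lit 36)))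
          (.lit 0))))
      (.call 1 (.pair (.fst (.var 2))
        (.snd (.call 15 (.pair (.fst (.snd (.var 2)))
          (.call 14 (.pair (.var 0) (.snd (.snd (.var 2)))))))))))

/-- `(p, q) ↦ ⌈q / p⌉` -/
def ceilDiv : Expr :=
  .ifLe (.snd (.var 0)) (.lit 0) (.lit 0)
    (.add (.lit 1) (.call 23 (.pair (.fst (.var 0)) (.sub (.snd (.var 0)) (.fst (.var 0))))))

/-- `((a, d), k) ↦ min k ⌊a / d⌋` -/
def divCap : Expr :=
  .ifLe (.snd (.var 0)) (.lit 0) (.lit 0)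
    (.ifLe (.snd (.fst (.var 0))) (.fst (.fst (.var 0)))
      (.add (.lit 1) (.call 24 (.pair
        (.pair (.sub (.fst (.fst (.var 0))) (.snd (.fst (.var 0)))) (.snd (.fst (.var 0))))
        (.sub (.snd (.var 0)) (.lit 1)))))
      (.lit 0))

/-- `((m, d), cs)`: replace every weight `w` by `min m ⌊w * m / d⌋` -/
def rescale : Expr :=
  .ifPair (.snd (.var 0))
    (.letIn (.fst (.snd (.var 0)))
      (.pair
        (.pair (.fst (.var 0))
          (.pair
            (.call 24 (.pair
              (.pair (.call 19 (.pair (.fst (.snd (.var 0))) (.fst (.fst (.var 1)))))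
                (.snd (.fst (.var 1))))
              (.fst (.fst (.var 1)))))
            (.call 25 (.pair (.fst (.var 1)) (.snd (.snd (.var 0)))))))
        (.call 25 (.pair (.fst (.var 1)) (.snd (.snd (.var 1)))))))
    (.lit 0)

/-- the main function -/
def main : Expr :=
  .ifPair (.fst (.var 0))
    (.letIn (.pair (.snd (.var 0)) (.lit 0))
      (.letIn (.call 17 (.var 0))
        (.call 22 (.fst (.call 25 (.pair
          (.pair
            (.call 19 (.pair (.call 19 (.pair (.var 0) (.var 0)))
              (.call 23 (.fst (.var 2)))))
            (.call 18 (.var 1)))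
          (.var 1)))))))
    (.call 22 (.var 0))

end Code

def program : Program :=
  [Code.main, Code.build, Code.spanCost, Code.blank, Code.mapCons, Code.closings,
    Code.disjointSlots, Code.overlay, Code.sameBusy, Code.insertMin, Code.insertAll, Code.crossOne,
    Code.cross, Code.closeAll, Code.forestTable, Code.best, Code.maxChildren, Code.size,
    Code.weight, Code.mul, Code.pad, Code.grow, Code.core, Code.ceilDiv, Code.divCap, Code.rescale]

/-! ### Values -/

def encodeSeq {α : Type} (enc : α → Val) : List α → Val
  | [] => .nat 0
  | a :: l => .pair (enc a) (encodeSeq enc l)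

def encodeSlot : Option (ℕ × DTree) → Val
  | none => .nat 0
  | some (q, r) => .pair (.nat q) r.encode

abbrev encodeSlots : Slots → Val := encodeSeq encodeSlot

def encodeEntry (e : Entry) : Val :=
  .pair (.nat e.1) (encodeSlots e.2)

abbrev encodeTable : List Entry → Val := encodeSeq encodeEntry

def encodeBool (b : Bool) : Val :=
  .nat (if b then 1 else 0)

def encodeBest : Option Entry → Val
  | none => .nat 0
  | some e => encodeEntry e

/-! ### Running times -/

/-- In this and the following bounds, the numerical constants are generous allowances for the fixed
number of steps of a function body outside its calls; `omega` checks them. -/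
theorem call_build (v : ℕ) (z : Slots) :
    Call program 1 (.pair (.nat v) (encodeSlots z)) (build v z).encode (30 * (z.length + 1)) := by
  induction z with
  | nil => exact .intro rfl (by simp [wp, Code.build, encodeSeq, build, DTree.encode])
  | cons x z ih =>
    refine .intro rfl ?_
    rcases x with _ | x <;>
      simp only [wp, Code.build, encodeSeq, encodeSlot, build, DTree.encode,
        List.getElem?_cons_zero] <;>
      exact ⟨_, _, ih, rfl, by simp; omega⟩

theorem call_spanCost (w : ℕ) (z : Slots) :
    Call program 2 (.pair (.nat w) (encodeSlots z)) (.nat (spanCost w z))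
      (40 * (z.length + 1)) := by
  induction z with
  | nil => exact .intro rfl (by simp [wp, Code.spanCost, encodeSeq, spanCost])
  | cons x z ih =>
    refine .intro rfl ?_
    cases x with
    | none =>
      simp only [wp, Code.spanCost, encodeSeq, encodeSlot, spanCost, List.getElem?_cons_zero,
        List.getElem?_cons_succ]
      refine ⟨_, _, ih, fun h => ⟨?_, by simp; omega⟩, fun h => ⟨?_, by simp; omega⟩⟩
      · rw [if_pos h]
      · rw [if_neg h]
    | some x =>
      simp only [wp, Code.spanCost, encodeSeq, encodeSlot, spanCost, List.getElem?_cons_zero,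
        List.getElem?_cons_succ]
      exact ⟨_, _, ih, rfl, by simp; omega⟩

theorem call_blank (z : Slots) :
    Call program 3 (encodeSlots z) (encodeSlots (blank z)) (20 * (z.length + 1)) := by
  induction z with
  | nil => exact .intro rfl (by simp [wp, Code.blank, encodeSeq, blank])
  | cons x z ih =>
    refine .intro rfl ?_
    simp only [wp, Code.blank, encodeSeq, encodeSlot, blank, List.map_cons,
      List.getElem?_cons_zero]
    exact ⟨_, _, ih, rfl, by simp; omega⟩

theorem call_mapCons (x : Option (ℕ × DTree)) (w : ℕ) (L : List Entry) :
    Call program 4 (.pair (.pair (encodeSlot x) (.nat w)) (encodeTable L))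
      (encodeTable (L.map fun e => (e.1 + w, x :: e.2))) (40 * (L.length + 1)) := by
  induction L with
  | nil => exact .intro rfl (by simp [wp, Code.mapCons, encodeSeq])
  | cons e L ih =>
    refine .intro rfl ?_
    simp only [wp, Code.mapCons, encodeSeq, encodeEntry, List.map_cons, List.getElem?_cons_zero]
    exact ⟨_, _, ih, rfl, by simp; omega⟩

/-- For each slot, the work besides the recursive call is linear: shifting the rows found so far,
and one call each of `spanCost`, `build` and `blank`. The uniform `B` keeps this charge constant
along the induction. -/
theorem call_closings (v w c : ℕ) (z : Slots) {B : ℕ} (hB : z.length ≤ B) :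
    Call program 5 (.pair (.pair (.nat v) (.nat w)) (.pair (.nat c) (encodeSlots z)))
      (encodeTable (closings v w c z)) ((z.length + 1) * (250 * (B + 1))) := by
  induction z with
  | nil => exact .intro rfl (by simp [wp, Code.closings, encodeSeq, closings]; omega)
  | cons x z ih =>
    refine .intro rfl ?_
    simp only [List.length_cons] at hB
    have ih := ih (by omega)
    have h1 := call_mapCons x w (closings v w c z)
    have h2 := length_closings_le v w c z
    have h3 := call_spanCost w z
    have h4 := call_build v z
    have h5 := call_blank z
    have e : (z.length + 1 + 1) * (250 * (B + 1)) =
      (z.length + 1) * (250 * (B + 1)) + 250 * (B + 1) := by ring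
    cases x with
    | some x =>
      simp only [wp, Code.closings, encodeSeq, encodeSlot, closings, List.getElem?_cons_zero,
        List.getElem?_cons_succ, List.length_cons]
      exact ⟨_, _, ih, _, _, h1, rfl, by omega⟩
    | none =>
      simp only [wp, Code.closings, encodeSeq, encodeSlot, encodeEntry, closings,
        List.getElem?_cons_zero, List.getElem?_cons_succ, List.length_cons]
      exact ⟨_, _, ih, _, _, h1, _, _, h3, _, _, h4, _, _, h5, rfl, by omega⟩

theorem call_disjointSlots (z z' : Slots) :
    Call program 6 (.pair (encodeSlots z) (encodeSlots z')) (encodeBool (disjointSlots z z'))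
      (40 * (z.length + 1)) := by
  induction z generalizing z' with
  | nil => exact .intro rfl (by simp [wp, Code.disjointSlots, encodeSeq, disjointSlots, encodeBool])
  | cons x z ih =>
    refine .intro rfl ?_
    cases z' with
    | nil =>
      simp only [wp, Code.disjointSlots, encodeSeq, List.getElem?_cons_zero]
      exact ⟨rfl, by simp; omega⟩
    | cons y z' =>
      have ih := ih z'
      rcases x with _ | x <;> rcases y with _ | y <;>
        simp only [wp, Code.disjointSlots, encodeSeq, encodeSlot, List.getElem?_cons_zero] <;>
        first
        | exact ⟨_, _, ih, rfl, by simp; omega⟩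
        | exact ⟨rfl, by simp; omega⟩

theorem call_overlay (z z' : Slots) :
    Call program 7 (.pair (encodeSlots z) (encodeSlots z')) (encodeSlots (overlay z z'))
      (40 * (z.length + 1)) := by
  induction z generalizing z' with
  | nil => exact .intro rfl (by simp [wp, Code.overlay, encodeSeq, overlay])
  | cons x z ih =>
    refine .intro rfl ?_
    cases z' with
    | nil =>
      simp only [wp, Code.overlay, encodeSeq, overlay, List.getElem?_cons_zero]
      exact ⟨trivial, by simp; omega⟩
    | cons y z' =>
      have ih := ih z'
      rcases x with _ | x <;>
        simp only [wp, Code.overlay, encodeSeq, encodeSlot, List.getElem?_cons_zero] <;>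
        exact ⟨_, _, ih, rfl, by simp; omega⟩

theorem call_sameBusy (z z' : Slots) :
    Call program 8 (.pair (encodeSlots z) (encodeSlots z')) (encodeBool (sameBusy z z'))
      (40 * (z.length + 1)) := by
  induction z generalizing z' with
  | nil => exact .intro rfl (by simp [wp, Code.sameBusy, encodeSeq, sameBusy, encodeBool])
  | cons x z ih =>
    refine .intro rfl ?_
    cases z' with
    | nil =>
      simp only [wp, Code.sameBusy, encodeSeq, List.getElem?_cons_zero]
      exact ⟨rfl, by simp; omega⟩
    | cons y z' =>
      have ih := ih z'
      rcases x with _ | x <;> rcases y with _ | y <;>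
        simp only [wp, Code.sameBusy, encodeSeq, encodeSlot, List.getElem?_cons_zero] <;>
        first
        | exact ⟨_, _, ih, rfl, by simp; omega⟩
        | exact ⟨rfl, by simp; omega⟩

theorem call_insertMin (e : Entry) (L : List Entry) :
    Call program 9 (.pair (encodeEntry e) (encodeTable L)) (encodeTable (insertMin e L))
      ((L.length + 1) * (100 * (e.2.length + 1))) := by
  induction L with
  | nil =>
    refine .intro rfl ?_
    simp only [wp, Code.insertMin, encodeSeq, insertMin, List.getElem?_cons_zero]
    exact ⟨trivial, by simp; omega⟩
  | cons f L ih =>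
    refine .intro rfl ?_
    have h := call_sameBusy e.2 f.2
    have hl : (L.length + 1 + 1) * (100 * (e.2.length + 1)) =
      (L.length + 1) * (100 * (e.2.length + 1)) + 100 * (e.2.length + 1) := by ring
    simp only [wp, Code.insertMin, encodeSeq, encodeEntry, List.getElem?_cons_zero, insertMin,
      List.length_cons]
    refine ⟨_, _, h, ?_⟩
    simp only [encodeBool]
    cases hs : sameBusy e.2 f.2
    · simp only [Bool.false_eq_true, if_false, encodeSeq, encodeEntry]
      exact ⟨by omega, fun _ => ⟨_, _, ih, rfl, by omega⟩⟩
    · simp only [if_true]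
      refine ⟨fun _ => ⟨fun h => ?_, fun h => ?_⟩, by omega⟩
      · rw [if_pos h]; exact ⟨rfl, by omega⟩
      · rw [if_neg h]; exact ⟨rfl, by omega⟩

theorem succ_le_two_pow (B : ℕ) : B + 1 ≤ 2 ^ B :=
  Nat.lt_two_pow_self

/-- Each insertion scans a table of at most `2 ^ B` rows and compares sets of `B` slots. The crude
`B + 1 ≤ 2 ^ B` allows all bounds to be powers of `2 ^ B`. -/
theorem call_insertAll {B : ℕ} {L L' : List Entry} (h : ∀ e ∈ L, e.2.length = B)
    (hL : TableOK B L') :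
    Call program 10 (.pair (encodeTable L) (encodeTable L')) (encodeTable (insertAll L L'))
      ((L.length + 1) * (250 * (2 ^ B) ^ 2)) := by
  have hB := succ_le_two_pow B
  set N := 2 ^ B with hN
  have hN1 : 0 < N := by omega
  have hN2 : 0 < N ^ 2 := by positivity
  induction L with
  | nil =>
    refine .intro rfl ?_
    simp only [wp, Code.insertAll, encodeSeq, insertAll, List.getElem?_cons_zero, List.foldr_nil]
    exact ⟨trivial, by simp; omega⟩
  | cons e L ih =>
    refine .intro rfl ?_
    have h' : ∀ f ∈ L, f.2.length = B := fun f hf => h f (by simp [hf])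
    have h1 := (TableOK.insertAll h' hL).length_le
    have h2 := call_insertMin e (insertAll L L')
    rw [h e (by simp)] at h2
    have h3 : ((insertAll L L').length + 1) * (100 * (B + 1)) ≤ 200 * N ^ 2 :=
      calc _ ≤ (N + N) * (100 * N) := Nat.mul_le_mul (by omega) (by omega)
        _ = 200 * N ^ 2 := by ring
    have hl : (L.length + 1 + 1) * (250 * N ^ 2) = (L.length + 1) * (250 * N ^ 2) + 250 * N ^ 2 := by
      ring
    simp only [wp, Code.insertAll, encodeSeq, List.getElem?_cons_zero, List.length_cons]
    exact ⟨_, _, ih h', _, _, h2, rfl, by omega⟩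

theorem call_crossOne (e : Entry) (L : List Entry) :
    Call program 11 (.pair (encodeEntry e) (encodeTable L)) (encodeTable (crossOne e L))
      ((L.length + 1) * (150 * (e.2.length + 1))) := by
  induction L with
  | nil =>
    refine .intro rfl ?_
    simp only [wp, Code.crossOne, encodeSeq, crossOne, List.getElem?_cons_zero]
    exact ⟨trivial, by simp; omega⟩
  | cons f L ih =>
    refine .intro rfl ?_
    have h := call_disjointSlots e.2 f.2
    have h' := call_overlay e.2 f.2
    have hl : (L.length + 1 + 1) * (150 * (e.2.length + 1)) =
      (L.length + 1) * (150 * (e.2.length + 1)) + 150 * (e.2.length + 1) := by ring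
    simp only [wp, Code.crossOne, encodeSeq, encodeEntry, List.getElem?_cons_zero,
      List.getElem?_cons_succ, crossOne, List.length_cons]
    refine ⟨_, _, ih, _, _, h, ?_⟩
    simp only [encodeBool]
    cases hs : disjointSlots e.2 f.2
    · simp only [Bool.false_eq_true, if_false]
      exact ⟨by omega, fun _ => ⟨trivial, by omega⟩⟩
    · simp only [if_true, encodeSeq, encodeEntry]
      exact ⟨fun _ => ⟨_, _, h', rfl, by omega⟩, by omega⟩

/-- For each row of the left table, at most `2 ^ B` products are formed, and inserting them
dominates, with a cubic number of steps in `2 ^ B`. -/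
theorem call_cross {B : ℕ} {L L' : List Entry} (hL : TableOK B L) (hL' : TableOK B L') :
    Call program 12 (.pair (encodeTable L) (encodeTable L')) (encodeTable (cross L L'))
      ((L.length + 1) * (1000 * (2 ^ B) ^ 3)) := by
  have hB := succ_le_two_pow B
  have hl' := hL'.length_le
  set N := 2 ^ B with hN
  have hN3 : 0 < N ^ 3 := by positivity
  have hN2 : N ^ 2 ≤ N ^ 3 := Nat.pow_le_pow_right (by omega) (by omega)
  induction L with
  | nil =>
    refine .intro rfl ?_
    simp only [wp, Code.cross, encodeSeq, cross, List.getElem?_cons_zero]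
    exact ⟨trivial, by simp; omega⟩
  | cons e L ih =>
    refine .intro rfl ?_
    have he := hL.1 e (by simp)
    have h1 := call_crossOne e L'
    rw [he] at h1
    have h2 : (L'.length + 1) * (150 * (B + 1)) ≤ 300 * N ^ 2 :=
      calc _ ≤ (N + N) * (150 * N) := Nat.mul_le_mul (by omega) (by omega)
        _ = 300 * N ^ 2 := by ring
    have h3 := call_insertAll (fun x hx => length_of_mem_crossOne he hL' hx) (hL.tail.cross hL')
    rw [← hN] at h3
    have h4 := length_crossOne_le e L'
    have h5 : ((crossOne e L').length + 1) * (250 * N ^ 2) ≤ 500 * N ^ 3 :=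
      calc _ ≤ (N + N) * (250 * N ^ 2) := Nat.mul_le_mul (by omega) le_rfl
        _ = 500 * N ^ 3 := by ring
    have hl : (L.length + 1 + 1) * (1000 * N ^ 3) =
      (L.length + 1) * (1000 * N ^ 3) + 1000 * N ^ 3 := by ring
    simp only [wp, Code.cross, encodeSeq, List.getElem?_cons_zero, List.length_cons]
    exact ⟨_, _, h1, _, _, ih hL.tail, _, _, h3, rfl, by omega⟩

theorem call_closeAll (v w : ℕ) {B : ℕ} {L : List Entry} (hL : TableOK B L) :
    Call program 13 (.pair (.pair (.nat v) (.nat w)) (encodeTable L))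
      (encodeTable (closeAll v w L)) ((L.length + 1) * (1000 * (2 ^ B) ^ 3)) := by
  have hB := succ_le_two_pow B
  set N := 2 ^ B with hN
  have hN3 : 0 < N ^ 3 := by positivity
  have hN2 : N ^ 2 ≤ N ^ 3 := Nat.pow_le_pow_right (by omega) (by omega)
  induction L with
  | nil =>
    refine .intro rfl ?_
    simp only [wp, Code.closeAll, encodeSeq, closeAll, List.getElem?_cons_zero]
    exact ⟨trivial, by simp; omega⟩
  | cons e L ih =>
    refine .intro rfl ?_
    have he := hL.1 e (by simp)
    have h1 := call_closings v w e.1 e.2 he.le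
    rw [he] at h1
    have h2 : (B + 1) * (250 * (B + 1)) ≤ 250 * N ^ 2 :=
      calc _ ≤ N * (250 * N) := Nat.mul_le_mul (by omega) (by omega)
        _ = 250 * N ^ 2 := by ring
    have h3 := call_insertAll (L := closings v w e.1 e.2)
      (fun x hx => (length_of_mem_closings hx).trans he) (hL.tail.closeAll v w)
    rw [← hN] at h3
    have h4 := length_closings_le v w e.1 e.2
    have h5 : ((closings v w e.1 e.2).length + 1) * (250 * N ^ 2) ≤ 250 * N ^ 3 :=
      calc _ ≤ N * (250 * N ^ 2) := Nat.mul_le_mul (by omega) le_rfl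
        _ = 250 * N ^ 3 := by ring
    have hl : (L.length + 1 + 1) * (1000 * N ^ 3) =
      (L.length + 1) * (1000 * N ^ 3) + 1000 * N ^ 3 := by ring
    simp only [wp, Code.closeAll, encodeSeq, encodeEntry, List.getElem?_cons_zero,
      List.length_cons]
    exact ⟨_, _, h1, _, _, ih hL.tail, _, _, h3, rfl, by omega⟩

theorem RTree.encodeList_cons (w : ℕ → ℕ) (v : ℕ) (cs' cs : List RTree) :
    RTree.encodeList w (.node v cs' :: cs) =
      .pair (.pair (.nat v) (.pair (.nat (w v)) (RTree.encodeList w cs')))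
        (RTree.encodeList w cs) := by
  simp [RTree.encodeList, RTree.encode]

theorem call_forestTable (w : ℕ → ℕ) (b : Slots) (cs : List RTree) :
    Call program 14 (.pair (encodeSlots b) (RTree.encodeList w cs))
      (encodeTable (forestTable w b cs))
      ((2 * (RTree.nodesList cs).length + 1) * (5000 * (2 ^ b.length) ^ 4)) := by
  have hN4 : 0 < (2 ^ b.length) ^ 4 := by positivity
  induction cs using RTree.forest_induction with
  | nil =>
    refine .intro rfl ?_
    simp only [wp, Code.forestTable, encodeSeq, forestTable, RTree.encodeList,
      List.getElem?_cons_zero]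
    exact ⟨rfl, by simp; omega⟩
  | cons v cs' cs ih' ih =>
    refine .intro rfl ?_
    have t' := tableOK_forestTable w b cs'
    have t := tableOK_forestTable w b cs
    have h1 := call_closeAll v (w v) t'
    have h2 := call_cross (t'.closeAll v (w v)) t
    have key : ∀ L, TableOK b.length L →
        (L.length + 1) * (1000 * (2 ^ b.length) ^ 3) ≤ 2000 * (2 ^ b.length) ^ 4 := by
      intro L hL
      have := hL.length_le
      have := succ_le_two_pow b.length
      calc _ ≤ (2 ^ b.length + 2 ^ b.length) * (1000 * (2 ^ b.length) ^ 3) :=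
            Nat.mul_le_mul (by omega) le_rfl
        _ = _ := by ring
    have k1 := key _ t'
    have k2 := key _ (t'.closeAll v (w v))
    set N := 2 ^ b.length with hN
    -- A forest with `n` nodes causes `2 n + 1` calls, since each node opens two further forests.
    -- The induction adds one charge to those of the two parts.
    have hl : (2 * (RTree.nodesList (.node v cs' :: cs)).length + 1) * (5000 * N ^ 4) =
        (2 * (RTree.nodesList cs').length + 1) * (5000 * N ^ 4) +
        (2 * (RTree.nodesList cs).length + 1) * (5000 * N ^ 4) + 5000 * N ^ 4 := by
      rw [RTree.nodesList_cons]
      simp only [List.length_cons, List.length_append]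
      ring
    simp only [wp, Code.forestTable, RTree.encodeList_cons, List.getElem?_cons_zero,
      List.getElem?_cons_succ, forestTable_cons]
    exact ⟨_, _, ih', _, _, h1, _, _, ih, _, _, h2, rfl, by omega⟩

theorem call_best (w : ℕ) {B : ℕ} {L : List Entry} (hL : TableOK B L) :
    Call program 15 (.pair (.nat w) (encodeTable L)) (encodeBest (best w L))
      ((L.length + 1) * (100 * (B + 1))) := by
  induction L with
  | nil =>
    refine .intro rfl ?_
    simp only [wp, Code.best, encodeSeq, best, List.getElem?_cons_zero]
    exact ⟨rfl, by simp; omega⟩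
  | cons e L ih =>
    refine .intro rfl ?_
    have h := call_spanCost w e.2
    rw [hL.1 e (by simp)] at h
    have ih := ih hL.tail
    have hl : (L.length + 1 + 1) * (100 * (B + 1)) =
      (L.length + 1) * (100 * (B + 1)) + 100 * (B + 1) := by ring
    simp only [wp, Code.best, encodeSeq, encodeEntry, best, List.getElem?_cons_zero,
      List.getElem?_cons_succ, List.length_cons]
    refine ⟨_, _, ih, _, _, h, ?_⟩
    cases best w L with
    | none => exact ⟨rfl, by omega⟩
    | some r =>
      simp only [encodeBest, encodeEntry]
      refine ⟨fun h => ⟨?_, by omega⟩, fun h => ⟨?_, by omega⟩⟩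
      · rw [if_pos h]
      · rw [if_neg h]

-- Tree statistics, arithmetic and the core of the program

mutual
def maxChildrenTree : RTree → ℕ
  | .node _ cs => maxChildren cs 0
/-- The maximum number of children of a node of the forest, or of a further node that has the trees of the
forest, and `i` more, as children. -/
def maxChildren : List RTree → ℕ → ℕ
  | [], i => i
  | c :: cs, i => max (maxChildrenTree c) (maxChildren cs (i + 1))
end

theorem maxChildren_cons (v i : ℕ) (cs' cs : List RTree) :
    maxChildren (.node v cs' :: cs) i = max (maxChildren cs' 0) (maxChildren cs (i + 1)) := by
  simp [maxChildren, maxChildrenTree]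

theorem call_maxChildren (w : ℕ → ℕ) (cs : List RTree) (i : ℕ) :
    Call program 16 (.pair (RTree.encodeList w cs) (.nat i)) (.nat (maxChildren cs i))
      ((RTree.nodesList cs).length * 80 + 40) := by
  induction cs using RTree.forest_induction generalizing i with
  | nil =>
    refine .intro rfl ?_
    simp only [wp, Code.maxChildren, maxChildren, RTree.encodeList, List.getElem?_cons_zero]
    exact ⟨trivial, by simp⟩
  | cons v cs' cs ih' ih =>
    refine .intro rfl ?_
    simp only [wp, Code.maxChildren, RTree.encodeList_cons, List.getElem?_cons_zero,
      List.getElem?_cons_succ, maxChildren_cons, RTree.nodesList_cons, List.length_cons,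
      List.length_append]
    refine ⟨_, _, ih' 0, _, _, ih (i + 1), fun h => ⟨?_, by omega⟩, fun h => ⟨?_, by omega⟩⟩
    · rw [max_eq_left h]
    · rw [max_eq_right (by omega)]

theorem call_size (w : ℕ → ℕ) (cs : List RTree) :
    Call program 17 (RTree.encodeList w cs) (.nat (RTree.nodesList cs).length)
      ((RTree.nodesList cs).length * 80 + 40) := by
  induction cs using RTree.forest_induction with
  | nil =>
    refine .intro rfl ?_
    simp only [wp, Code.size, RTree.encodeList, List.getElem?_cons_zero]
    exact ⟨by simp, by simp⟩
  | cons v cs' cs ih' ih =>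
    refine .intro rfl ?_
    simp only [wp, Code.size, RTree.encodeList_cons, List.getElem?_cons_zero,
      RTree.nodesList_cons, List.length_cons, List.length_append]
    refine ⟨_, _, ih', _, _, ih, ?_, by omega⟩
    congr 1
    omega

theorem call_weight (w : ℕ → ℕ) (cs : List RTree) :
    Call program 18 (RTree.encodeList w cs) (.nat ((RTree.nodesList cs).map w).sum)
      ((RTree.nodesList cs).length * 80 + 40) := by
  induction cs using RTree.forest_induction with
  | nil =>
    refine .intro rfl ?_
    simp only [wp, Code.weight, RTree.encodeList, List.getElem?_cons_zero]
    exact ⟨by simp, by simp⟩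
  | cons v cs' cs ih' ih =>
    refine .intro rfl ?_
    simp only [wp, Code.weight, RTree.encodeList_cons, List.getElem?_cons_zero,
      RTree.nodesList_cons, List.length_cons, List.length_append, List.map_cons, List.map_append,
      List.sum_cons, List.sum_append]
    exact ⟨_, _, ih', _, _, ih, rfl, by omega⟩

theorem call_mul (a k : ℕ) :
    Call program 19 (.pair (.nat a) (.nat k)) (.nat (a * k)) (40 * (k + 1)) := by
  induction k with
  | zero => exact .intro rfl (by simp [wp, Code.mul])
  | succ k ih =>
    refine .intro rfl ?_
    simp only [wp, Code.mul, List.getElem?_cons_zero]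
    refine ⟨by omega, fun _ => ⟨_, _, ih, ?_, by omega⟩⟩
    congr 1
    ring

theorem call_pad (k : ℕ) (z : Slots) :
    Call program 20 (.pair (.nat k) (encodeSlots z)) (encodeSlots (List.replicate k none ++ z))
      (40 * (k + 1)) := by
  induction k with
  | zero => exact .intro rfl (by simp [wp, Code.pad])
  | succ k ih =>
    refine .intro rfl ?_
    simp only [wp, Code.pad, List.getElem?_cons_zero]
    exact ⟨by omega, fun _ => ⟨_, _, ih, rfl, by omega⟩⟩

/-- The logarithm is computed implicitly: starting from `2 ^ i`, exactly `j = clog m - i` doublings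
are needed to reach `m`, and each of them contributes `k` slots. -/
theorem call_grow (m k j : ℕ) :
    ∀ (i : ℕ) (z : Slots), Nat.clog 2 m = i + j →
      Call program 21 (.pair (.pair (.nat m) (.nat (2 ^ i))) (.pair (.nat k) (encodeSlots z)))
        (encodeSlots (List.replicate (k * j) none ++ z)) ((j + 1) * (40 * (k + 2))) := by
  induction j with
  | zero =>
    intro i z h
    have hm : m ≤ 2 ^ i := (Nat.clog_le_iff_le_pow (by norm_num)).1 (by omega)
    refine .intro rfl ?_
    simp only [wp, Code.grow, List.getElem?_cons_zero]
    exact ⟨fun _ => ⟨by simp, by omega⟩, fun h => absurd hm h⟩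
  | succ j ih =>
    intro i z h
    have hm : ¬ m ≤ 2 ^ i := fun h' => by
      have := (Nat.clog_le_iff_le_pow (b := 2) (by norm_num)).2 h'
      omega
    have ih := ih (i + 1) (List.replicate k none ++ z) (by omega)
    have e : (2 : ℕ) ^ (i + 1) = 2 ^ i + 2 ^ i := by ring
    rw [e, ← List.append_assoc, List.replicate_append_replicate] at ih
    have hl : (j + 1 + 1) * (40 * (k + 2)) = (j + 1) * (40 * (k + 2)) + 40 * (k + 2) := by ring
    refine .intro rfl ?_
    simp only [wp, Code.grow, List.getElem?_cons_zero]
    exact ⟨fun h => absurd h hm, fun _ => ⟨_, _, call_pad k z, _, _, ih, rfl, by omega⟩⟩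

/-- Division by repeated subtraction. The two inequalities characterize the ceiling of `q / p`: the
first gives the quality of the approximation, the second the running time. -/
theorem call_ceilDiv (p q : ℕ) (hp : 0 < p) :
    ∃ E, q ≤ E * p ∧ E * p < q + p ∧
      Call program 23 (.pair (.nat p) (.nat q)) (.nat E) (40 * (E + 1)) := by
  induction q using Nat.strong_induction_on with
  | _ q ih =>
    rcases Nat.eq_zero_or_pos q with rfl | hq
    · exact ⟨0, by simp, by simpa using hp, .intro rfl (by simp [wp, Code.ceilDiv])⟩
    · obtain ⟨E, h1, h2, h3⟩ := ih (q - p) (by omega)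
      by_cases hpq : p ≤ q
      · refine ⟨E + 1, by rw [add_mul]; omega, by rw [add_mul]; omega, .intro rfl ?_⟩
        simp only [wp, Code.ceilDiv, List.getElem?_cons_zero]
        refine ⟨by omega, fun _ => ⟨_, _, h3, ?_, by omega⟩⟩
        rw [add_comm]
      -- Here `0 < q < p`, so truncated subtraction gives `0` and the recursive call returns `0`.
      · have hE : E = 0 := by
          rw [Nat.sub_eq_zero_of_le (by omega), zero_add] at h2
          by_contra hE
          have := Nat.le_mul_of_pos_left p (Nat.pos_of_ne_zero hE)
          omega
        subst hE
        refine ⟨1, by omega, by omega, .intro rfl ?_⟩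
        simp only [wp, Code.ceilDiv, List.getElem?_cons_zero]
        exact ⟨by omega, fun _ => ⟨_, _, h3, rfl, by omega⟩⟩

/-- The quotient `a / d`, but at most `k`. -/
def capDiv (a d k : ℕ) : ℕ :=
  -- The value at `d = 0` is the one found by repeated subtraction, which then never fails and is
  -- stopped by the cap. The cap also makes the number of steps independent of `a`.
  if d = 0 then k else min k (a / d)

theorem capDiv_succ (a d k : ℕ) : capDiv a d (k + 1) = if d ≤ a then 1 + capDiv (a - d) d k else 0 := by
  unfold capDiv
  rcases Nat.eq_zero_or_pos d with rfl | hd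
  · simp [add_comm]
  · rw [if_neg hd.ne', if_neg hd.ne']
    split_ifs with h
    · rw [Nat.div_eq_sub_div hd h]
      omega
    · rw [Nat.div_eq_of_lt (by omega)]
      simp

theorem call_divCap (d k a : ℕ) :
    Call program 24 (.pair (.pair (.nat a) (.nat d)) (.nat k)) (.nat (capDiv a d k))
      (40 * (k + 1)) := by
  induction k generalizing a with
  | zero => exact .intro rfl (by simp [wp, Code.divCap, capDiv])
  | succ k ih =>
    refine .intro rfl ?_
    simp only [wp, Code.divCap, List.getElem?_cons_zero, capDiv_succ]
    refine ⟨by omega, fun _ => ⟨fun h => ⟨_, _, ih (a - d), ?_, by omega⟩, fun h => ⟨?_, by omega⟩⟩⟩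
    · rw [if_pos h]
    · rw [if_neg h]

theorem call_rescale (w : ℕ → ℕ) (m d : ℕ) (cs : List RTree) :
    Call program 25 (.pair (.pair (.nat m) (.nat d)) (RTree.encodeList w cs))
      (RTree.encodeList (fun v => capDiv (w v * m) d m) cs)
      ((2 * (RTree.nodesList cs).length + 1) * (200 * (m + 1))) := by
  induction cs using RTree.forest_induction with
  | nil =>
    refine .intro rfl ?_
    simp only [wp, Code.rescale, RTree.encodeList, List.getElem?_cons_zero]
    exact ⟨trivial, by simp; omega⟩
  | cons v cs' cs ih' ih =>
    refine .intro rfl ?_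
    have hl : (2 * (RTree.nodesList (.node v cs' :: cs)).length + 1) * (200 * (m + 1)) =
        (2 * (RTree.nodesList cs').length + 1) * (200 * (m + 1)) +
        (2 * (RTree.nodesList cs).length + 1) * (200 * (m + 1)) + 200 * (m + 1) := by
      rw [RTree.nodesList_cons]
      simp only [List.length_cons, List.length_append]
      ring
    simp only [wp, Code.rescale, RTree.encodeList_cons, List.getElem?_cons_zero,
      List.getElem?_cons_succ]
    exact ⟨_, _, call_mul (w v) m, _, _, call_divCap d m (w v * m), _, _, ih', _, _, ih, rfl,
      by omega⟩

/-- The number of slots used for the tree `T`. -/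
def slotCount (w : ℕ → ℕ) (T : RTree) : ℕ :=
  (1 + maxChildren [T] 0) * 36 * Nat.clog 2 (1 + (T.size + T.weight w))

theorem RTree.nodesList_singleton (T : RTree) : RTree.nodesList [T] = T.nodes := by
  obtain ⟨v, cs⟩ := T
  simp [RTree.nodesList_cons, RTree.nodes_node]

theorem call_core (w : ℕ → ℕ) (v : ℕ) (cs : List RTree) {e : Entry}
    (he : best (w v) (forestTable w
      (List.replicate (slotCount w (.node v cs)) none) cs) = some e) :
    Call program 22 ((RTree.node v cs).encode w) (build v e.2).encode
      ((RTree.node v cs).size * (20000 * (2 ^ slotCount w (.node v cs)) ^ 4)) := by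
  have hs := call_size w [.node v cs]
  have hw := call_weight w [.node v cs]
  have hc := call_maxChildren w [.node v cs] 0
  have hm := call_mul (1 + maxChildren [.node v cs] 0) 36
  have hg := call_grow (1 + ((RTree.node v cs).size + (RTree.node v cs).weight w))
    ((1 + maxChildren [.node v cs] 0) * 36)
    (Nat.clog 2 (1 + ((RTree.node v cs).size + (RTree.node v cs).weight w))) 0 [] (by simp)
  rw [RTree.nodesList_singleton] at hs hw hc
  change Call program 17 _ (.nat (RTree.node v cs).size) ((RTree.node v cs).size * 80 + 40) at hs
  change Call program 18 _ (.nat ((RTree.node v cs).weight w)) ((RTree.node v cs).size * 80 + 40)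
    at hw
  change Call program 16 _ _ ((RTree.node v cs).size * 80 + 40) at hc
  have hf := call_forestTable w (List.replicate (slotCount w (.node v cs)) none) cs
  have hok := tableOK_forestTable w (List.replicate (slotCount w (.node v cs)) none) cs
  have hlen := hok.length_le
  have hb := call_best (w v) hok
  rw [he] at hb
  have hbu := call_build v e.2
  -- The row selected by `best` is a row of the table, hence has the prescribed number of slots;
  -- this bounds the time of the final `build`.
  have hel : e.2.length = slotCount w (.node v cs) := by
    have hne : forestTable w (List.replicate (slotCount w (.node v cs)) none) cs ≠ [] := by
      intro h
      rw [h] at he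
      simp [best] at he
    obtain ⟨e', he', h1, -⟩ := best_spec (w v) hne
    rw [he, Option.some_inj] at h1
    rw [h1]
    simpa using hok.1 e' he'
  have hsize : (RTree.node v cs).size = (RTree.nodesList cs).length + 1 := by
    simp [RTree.size, RTree.nodes_node]
  rw [List.append_nil] at hg
  change Call program 21 _ (encodeSlots (List.replicate (slotCount w (.node v cs)) none)) _ at hg
  -- The logarithm is positive because `1 + (n + W)` is at least `2`, so the additional round of
  -- `grow` costs a factor of at most `2`.
  have hclog : (Nat.clog 2 (1 + ((RTree.node v cs).size + (RTree.node v cs).weight w)) + 1) *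
      (40 * ((1 + maxChildren [.node v cs] 0) * 36 + 2)) ≤ 160 * slotCount w (.node v cs) := by
    have h1 : 0 < Nat.clog 2 (1 + ((RTree.node v cs).size + (RTree.node v cs).weight w)) :=
      Nat.clog_pos (by norm_num) (by omega)
    unfold slotCount
    generalize Nat.clog 2 (1 + ((RTree.node v cs).size + (RTree.node v cs).weight w)) = l at *
    generalize maxChildren [.node v cs] 0 = k at *
    calc _ ≤ (2 * l) * (40 * (2 * ((1 + k) * 36))) := Nat.mul_le_mul (by omega) (by omega)
      _ = _ := by ring
  rw [List.length_replicate] at hf hlen hb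
  rw [hel] at hbu
  generalize hB : slotCount w (.node v cs) = B at *
  have hB1 := succ_le_two_pow B
  set N := 2 ^ B with hN
  refine .intro rfl ?_
  simp only [wp, Code.core, List.getElem?_cons_zero, List.getElem?_cons_succ, RTree.encode]
  simp only [RTree.encodeList_cons] at hs hw hc hg
  simp only [RTree.encodeList] at hs hw hc hg
  refine ⟨_, _, hs, _, _, hw, _, _, hc, _, _, hm, _, _, hg, _, _, hf, _, _, hb, ?_⟩
  simp only [encodeBest, encodeEntry]
  refine ⟨_, _, hbu, rfl, ?_⟩
  have hn : 1 ≤ (RTree.node v cs).size := by omega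
  have hN1 : 1 ≤ N := by omega
  have hNN : N ≤ N ^ 4 := Nat.le_self_pow (by norm_num) N
  have hN2 : N ^ 2 ≤ N ^ 4 := Nat.pow_le_pow_right hN1 (by norm_num)
  have h1 : ((forestTable w (List.replicate B none) cs).length + 1) * (100 * (B + 1)) ≤
      200 * N ^ 2 :=
    calc _ ≤ (N + N) * (100 * N) := Nat.mul_le_mul (by omega) (by omega)
      _ = _ := by ring
  -- This is the dominant term; the root is not in the forest, which leaves room for `2 n + 1 ≤ 2
  -- size`.
  have h2 : (2 * (RTree.nodesList cs).length + 1) * (5000 * N ^ 4) ≤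
      10000 * ((RTree.node v cs).size * N ^ 4) :=
    calc _ ≤ (2 * (RTree.node v cs).size) * (5000 * N ^ 4) := Nat.mul_le_mul (by omega) le_rfl
      _ = _ := by ring
  have h3 : (RTree.node v cs).size ≤ (RTree.node v cs).size * N ^ 4 :=
    Nat.le_mul_of_pos_right _ (by omega)
  have h4 : N ^ 4 ≤ (RTree.node v cs).size * N ^ 4 := Nat.le_mul_of_pos_left _ (by omega)
  have h5 : (RTree.node v cs).size * (20000 * N ^ 4) =
      20000 * ((RTree.node v cs).size * N ^ 4) := by ring
  omega

/-! ### Splitting trees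

The search property, for an arbitrary relation `R` in the place of `T.Below`, and on the leaves only. -/

namespace DTree

/-- Every query separates the leaves of its two subtrees. -/
def Splits (R : ℕ → ℕ → Prop) : DTree → Prop
  | leaf _ => True
  | query q l r =>
    (∀ a ∈ r.leaves, R q a) ∧ (∀ a ∈ l.leaves, ¬ R q a) ∧ Splits R l ∧ Splits R r

/-- The total weight of the leaves. -/
def leafWeight (w : ℕ → ℕ) (D : DTree) : ℕ :=
  (D.leaves.map w).sum

def height : DTree → ℕ
  | leaf _ => 0
  | query _ l r => max l.height r.height + 1

@[simp] theorem leafWeight_leaf (w : ℕ → ℕ) (v : ℕ) : (leaf v).leafWeight w = w v := by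
  simp [leafWeight, leaves]

@[simp] theorem leafWeight_query (w : ℕ → ℕ) (q : ℕ) (l r : DTree) :
    (query q l r).leafWeight w = l.leafWeight w + r.leafWeight w := by
  simp [leafWeight, leaves]

theorem costFrom_eq (w : ℕ → ℕ) (d : ℕ) (D : DTree) :
    D.costFrom w d = d * D.leafWeight w + D.cost w := by
  induction D generalizing d with
  | leaf v => simp [cost, costFrom]
  | query q l r ihl ihr =>
    simp only [cost, costFrom, leafWeight_query] at ihl ihr ⊢
    rw [ihl (d + 1), ihr (d + 1), ihl (0 + 1), ihr (0 + 1)]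
    ring

@[simp] theorem cost_leaf (w : ℕ → ℕ) (v : ℕ) : (leaf v).cost w = 0 := by
  simp [cost, costFrom]

@[simp] theorem cost_query (w : ℕ → ℕ) (q : ℕ) (l r : DTree) :
    (query q l r).cost w = l.cost w + r.cost w + l.leafWeight w + r.leafWeight w := by
  rw [cost, costFrom, costFrom_eq, costFrom_eq]
  ring

theorem leaves_ne_nil (D : DTree) : D.leaves ≠ [] := by
  induction D with
  | leaf v => simp [leaves]
  | query q l r ihl ihr => simp [leaves, ihl]

/-- `D` is of minimum cost among the splitting trees with the same leaves. -/
def OptSplits (R : ℕ → ℕ → Prop) (w : ℕ → ℕ) (D : DTree) : Prop :=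
  D.Splits R ∧ ∀ D' : DTree, D'.Splits R → D'.leaves.Perm D.leaves → D.cost w ≤ D'.cost w

theorem leafWeight_perm {w : ℕ → ℕ} {D D' : DTree} (h : D.leaves.Perm D'.leaves) :
    D.leafWeight w = D'.leafWeight w :=
  (h.map w).sum_eq

/-- Exchange argument: a better subtree with the same leaves could be substituted without affecting
the queries above it or the weight that they carry. -/
theorem OptSplits.left {R : ℕ → ℕ → Prop} {w : ℕ → ℕ} {q : ℕ} {l r : DTree}
    (h : (query q l r).OptSplits R w) : l.OptSplits R w := by
  refine ⟨h.1.2.2.1, fun l' hl' hp => ?_⟩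
  have := h.2 (query q l' r) ⟨h.1.1, fun a ha => h.1.2.1 a (hp.mem_iff.1 ha), hl', h.1.2.2.2⟩
    (hp.append_right _)
  simp only [cost_query, leafWeight_perm (w := w) hp] at this
  omega

theorem OptSplits.right {R : ℕ → ℕ → Prop} {w : ℕ → ℕ} {q : ℕ} {l r : DTree}
    (h : (query q l r).OptSplits R w) : r.OptSplits R w := by
  refine ⟨h.1.2.2.2, fun r' hr' hp => ?_⟩
  have := h.2 (query q l r') ⟨fun a ha => h.1.1 a (hp.mem_iff.1 ha), h.1.2.1, h.1.2.2.1, hr'⟩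
    (hp.append_left _)
  simp only [cost_query, leafWeight_perm (w := w) hp] at this
  omega

/-- `Y` hangs in `D` below the queries `qs`. -/
inductive Descends : DTree → List ℕ → DTree → Prop
  | refl (D : DTree) : Descends D [] D
  | left {q : ℕ} {l r Y : DTree} {qs : List ℕ} :
      Descends l qs Y → Descends (query q l r) (q :: qs) Y
  | right {q : ℕ} {l r Y : DTree} {qs : List ℕ} :
      Descends r qs Y → Descends (query q l r) (q :: qs) Y

theorem Descends.optSplits {R : ℕ → ℕ → Prop} {w : ℕ → ℕ} {D Y : DTree} {qs : List ℕ}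
    (h : D.Descends qs Y) (hD : D.OptSplits R w) : Y.OptSplits R w := by
  induction h with
  | refl => exact hD
  | left _ ih => exact ih hD.left
  | right _ ih => exact ih hD.right

theorem Descends.leafWeight_le {D Y : DTree} {qs : List ℕ} (h : D.Descends qs Y) (w : ℕ → ℕ) :
    Y.leafWeight w ≤ D.leafWeight w := by
  induction h with
  | refl => exact le_rfl
  | left _ ih => rw [leafWeight_query]; omega
  | right _ ih => rw [leafWeight_query]; omega

theorem Descends.mem_leaves {D Y : DTree} {qs : List ℕ} (h : D.Descends qs Y) {a : ℕ}
    (ha : a ∈ Y.leaves) : a ∈ D.leaves := by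
  induction h with
  | refl => exact ha
  | left _ ih => simp [leaves, ih ha]
  | right _ ih => simp [leaves, ih ha]

/-- Always continue in the taller subtree: each step loses exactly one unit of height. -/
theorem exists_descends (D : DTree) (k : ℕ) (hk : k ≤ D.height) :
    ∃ qs Y, D.Descends qs Y ∧ qs.length = k ∧ D.height ≤ k + Y.height := by
  induction k generalizing D with
  | zero => exact ⟨[], D, .refl D, rfl, by omega⟩
  | succ k ih =>
    cases D with
    | leaf v => simp [height] at hk
    | query q l r =>
      simp only [height] at hk ⊢
      rcases le_total l.height r.height with h | h
      · obtain ⟨qs, Y, h1, h2, h3⟩ := ih r (by omega)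
        exact ⟨q :: qs, Y, h1.right, by simp [h2], by omega⟩
      · obtain ⟨qs, Y, h1, h2, h3⟩ := ih l (by omega)
        exact ⟨q :: qs, Y, h1.left, by simp [h2], by omega⟩

end DTree

/-! ### Restrictions of splitting trees -/

/-- The leaves of a splitting tree that may be empty. -/
def optLeaves : Option DTree → List ℕ
  | none => []
  | some D => D.leaves

def optCost (w : ℕ → ℕ) : Option DTree → ℕ
  | none => 0
  | some D => D.cost w

def OptionSplits (R : ℕ → ℕ → Prop) : Option DTree → Prop
  | none => True
  | some D => D.Splits R

/-- Query `q`, unless one of the answers is impossible. -/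
def join (q : ℕ) : Option DTree → Option DTree → Option DTree
  | some l, some r => some (.query q l r)
  | some l, none => some l
  | none, r => r

theorem optLeaves_join (q : ℕ) (l r : Option DTree) :
    optLeaves (join q l r) = optLeaves l ++ optLeaves r := by
  rcases l with _ | l <;> rcases r with _ | r <;> simp [join, optLeaves, DTree.leaves]

theorem OptionSplits.join {R : ℕ → ℕ → Prop} {q : ℕ} {l r : Option DTree} (hl : OptionSplits R l)
    (hr : OptionSplits R r) (h : ∀ a ∈ optLeaves r, R q a) (h' : ∀ a ∈ optLeaves l, ¬ R q a) :
    OptionSplits R (join q l r) := by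
  rcases l with _ | l <;> rcases r with _ | r <;>
    simp_all [TreeSearch.join, OptionSplits, DTree.Splits, optLeaves]

theorem optCost_join_le (w : ℕ → ℕ) (q : ℕ) (l r : Option DTree) :
    optCost w (join q l r) ≤ optCost w l + optCost w r +
      ((optLeaves l).map w).sum + ((optLeaves r).map w).sum := by
  rcases l with _ | l <;> rcases r with _ | r <;>
    simp [join, optCost, optLeaves, DTree.leafWeight]

open Classical in
/-- The truth value of a proposition. -/
noncomputable def truth (p : Prop) : Bool :=
  decide p

@[simp] theorem truth_iff {p : Prop} : truth p = true ↔ p := by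
  simp [truth]

@[simp] theorem truth_true : truth True = true := by
  simp [truth]

@[simp] theorem truth_false : truth False = false := by
  simp [truth]

open Classical in
/-- The part of a tree that identifies the leaves in `U`. -/
noncomputable def restrict (U : ℕ → Prop) : DTree → Option DTree
  | .leaf v => if U v then some (.leaf v) else none
  | .query q l r => join q (restrict U l) (restrict U r)

open Classical in
/-- The weights, restricted to `U`. -/
noncomputable def weightOn (U : ℕ → Prop) (w : ℕ → ℕ) (v : ℕ) : ℕ :=
  if U v then w v else 0

theorem sum_map_filter (U : ℕ → Prop) (w : ℕ → ℕ) (l : List ℕ) :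
    ((l.filter fun a => truth (U a)).map w).sum = (l.map (weightOn U w)).sum := by
  induction l with
  | nil => simp
  | cons a l ih => by_cases h : U a <;> simp [h, ih, weightOn]

theorem optLeaves_restrict (U : ℕ → Prop) (D : DTree) :
    optLeaves (restrict U D) = D.leaves.filter fun a => truth (U a) := by
  induction D with
  | leaf v => by_cases h : U v <;> simp [restrict, h, optLeaves, DTree.leaves]
  | query q l r ihl ihr => simp [restrict, optLeaves_join, ihl, ihr, DTree.leaves]

theorem OptionSplits.restrict {R : ℕ → ℕ → Prop} (U : ℕ → Prop) {D : DTree} (hD : D.Splits R) :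
    OptionSplits R (restrict U D) := by
  induction D with
  | leaf v =>
    by_cases h : U v <;> simp [TreeSearch.restrict, h, OptionSplits, DTree.Splits]
  | query q l r ihl ihr =>
    refine (ihl hD.2.2.1).join (ihr hD.2.2.2) (fun a ha => ?_) (fun a ha => ?_)
    · rw [optLeaves_restrict, List.mem_filter] at ha
      exact hD.1 a ha.1
    · rw [optLeaves_restrict, List.mem_filter] at ha
      exact hD.2.1 a ha.1

theorem sum_optLeaves_restrict (U : ℕ → Prop) (w : ℕ → ℕ) (D : DTree) :
    ((optLeaves (restrict U D)).map w).sum = D.leafWeight (weightOn U w) := by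
  rw [optLeaves_restrict, sum_map_filter]
  rfl

theorem optCost_restrict_le (U : ℕ → Prop) (w : ℕ → ℕ) (D : DTree) :
    optCost w (restrict U D) ≤ D.cost (weightOn U w) := by
  induction D with
  | leaf v => by_cases h : U v <;> simp [restrict, h, optCost]
  | query q l r ihl ihr =>
    refine (optCost_join_le w q _ _).trans ?_
    rw [sum_optLeaves_restrict, sum_optLeaves_restrict, DTree.cost_query]
    omega

-- A query that does not separate two elements of `U` has an empty side in the restriction, and
-- `join` drops it. The predicate `K` may be any superset of the separating queries.
open Classical in
theorem optCost_restrict_query (U K : ℕ → Prop) (w : ℕ → ℕ) (R : ℕ → ℕ → Prop) {q : ℕ} {l r : DTree}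
    (hs : (DTree.query q l r).Splits R)
    (hK : ∀ a b, U a → U b → ¬ R q a → R q b → K q) :
    optCost w (restrict U (.query q l r)) ≤ optCost w (restrict U l) + optCost w (restrict U r) +
      if K q then l.leafWeight (weightOn U w) + r.leafWeight (weightOn U w) else 0 := by
  have h := optCost_join_le w q (restrict U l) (restrict U r)
  rw [sum_optLeaves_restrict, sum_optLeaves_restrict] at h
  split_ifs with hq
  · exact h.trans (by omega)
  · have hl := optLeaves_restrict U l
    have hr := optLeaves_restrict U r
    rw [restrict]
    cases hl' : restrict U l with
    | none => simp [join, optCost]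
    | some l' =>
      cases hr' : restrict U r with
      | none => simp [join, optCost]
      | some r' =>
        exfalso
        rw [hl'] at hl
        rw [hr'] at hr
        obtain ⟨a, ha⟩ := List.exists_mem_of_ne_nil _ l'.leaves_ne_nil
        obtain ⟨b, hb⟩ := List.exists_mem_of_ne_nil _ r'.leaves_ne_nil
        change a ∈ optLeaves (some l') at ha
        change b ∈ optLeaves (some r') at hb
        rw [hl, List.mem_filter] at ha
        rw [hr, List.mem_filter] at hb
        exact hq (hK a b (truth_iff.1 ha.2) (truth_iff.1 hb.2) (hs.2.1 a ha.1)
          (hs.1 b hb.1))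

/-- Every query above `Y` that is dropped in the restriction lies above all leaves of `Y` in `U`, so
it saves at least their weight. Only the queries in `K` may survive. -/
theorem optCost_restrict_descends (U K : ℕ → Prop) (w : ℕ → ℕ) (R : ℕ → ℕ → Prop) {D Y : DTree}
    {qs : List ℕ} (h : D.Descends qs Y) (hs : D.Splits R)
    (hK : ∀ q a b, U a → U b → ¬ R q a → R q b → K q) :
    optCost w (restrict U D) + qs.length * Y.leafWeight (weightOn U w) ≤
      D.cost (weightOn U w) +
        (qs.countP fun q => truth (K q)) * Y.leafWeight (weightOn U w) := by
  induction h with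
  | refl D => simpa using optCost_restrict_le U w D
  | @left q l r Y qs hd ih =>
    have ih := ih hs.2.2.1
    have h1 := optCost_restrict_query U K w R hs (hK q)
    have h2 := optCost_restrict_le U w r
    have h3 := hd.leafWeight_le (weightOn U w)
    rw [DTree.cost_query, List.length_cons, List.countP_cons]
    by_cases hq : K q <;> simp only [hq, if_true, if_false, truth_true, truth_false, add_mul,
      Bool.false_eq_true] at h1 ⊢ <;> omega
  | @right q l r Y qs hd ih =>
    have ih := ih hs.2.2.2
    have h1 := optCost_restrict_query U K w R hs (hK q)
    have h2 := optCost_restrict_le U w l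
    have h3 := hd.leafWeight_le (weightOn U w)
    rw [DTree.cost_query, List.length_cons, List.countP_cons]
    by_cases hq : K q <;> simp only [hq, if_true, if_false, truth_true, truth_false, add_mul,
      Bool.false_eq_true] at h1 ⊢ <;> omega

/-! ### Balanced rearrangements -/

/-- `E` identifies the leaves of `D` in `U`. Its cost accounts for the `k` queries above `Y` in `D`, save at most
`c` of them, at the price of at most `a` additional queries for every leaf. -/
structure Rearranges (R : ℕ → ℕ → Prop) (w : ℕ → ℕ) (D Y : DTree) (k a c M : ℕ) (U : ℕ → Prop)
    (E : Option DTree) : Prop where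
  leaves : (optLeaves E).Perm (D.leaves.filter fun v => truth (U v))
  splits : OptionSplits R E
  cost : optCost w E + k * Y.leafWeight (weightOn U w) ≤
    D.cost (weightOn U w) + a * D.leafWeight w + c * M

theorem leafWeight_add (w w' : ℕ → ℕ) (D : DTree) :
    D.leafWeight (fun v => w v + w' v) = D.leafWeight w + D.leafWeight w' := by
  induction D with
  | leaf v => simp
  | query q l r ihl ihr => simp only [DTree.leafWeight_query, ihl, ihr]; ring

theorem cost_add (w w' : ℕ → ℕ) (D : DTree) :
    D.cost (fun v => w v + w' v) = D.cost w + D.cost w' := by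
  induction D with
  | leaf v => simp
  | query q l r ihl ihr => simp only [DTree.cost_query, ihl, ihr, leafWeight_add]; ring

theorem leafWeight_mono {w w' : ℕ → ℕ} (h : ∀ v, w v ≤ w' v) (D : DTree) :
    D.leafWeight w ≤ D.leafWeight w' :=
  List.sum_le_sum fun v _ => h v

theorem weightOn_or {U U' : ℕ → Prop} (h : ∀ v, U v → ¬ U' v) (w : ℕ → ℕ) :
    weightOn (fun v => U v ∨ U' v) w = fun v => weightOn U w v + weightOn U' w v := by
  funext v
  have := h v
  by_cases h1 : U v <;> by_cases h2 : U' v <;> simp_all [weightOn]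

theorem weightOn_le (U : ℕ → Prop) (w : ℕ → ℕ) (v : ℕ) : weightOn U w v ≤ w v := by
  unfold weightOn
  split_ifs <;> simp

theorem filter_or_perm {U U' : ℕ → Prop} (h : ∀ v, U v → ¬ U' v) (l : List ℕ) :
    (l.filter fun v => truth (U v ∨ U' v)).Perm
      ((l.filter fun v => truth (U v)) ++ l.filter fun v => truth (U' v)) := by
  induction l with
  | nil => simp
  | cons a l ih =>
    have := h a
    by_cases h1 : U a
    · simp only [List.filter_cons, h1, this h1, true_or, truth_true, truth_false, if_true,
        List.cons_append, Bool.false_eq_true, if_false]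
      exact ih.cons a
    · by_cases h2 : U' a
      · simp only [List.filter_cons, h1, h2, or_true, truth_true, truth_false, if_true,
          Bool.false_eq_true, if_false]
        exact (ih.cons a).trans List.perm_middle.symm
      · simpa [List.filter_cons, h1, h2] using ih

theorem Rearranges.join {R : ℕ → ℕ → Prop} {w : ℕ → ℕ} {D Y : DTree} {k a a' c c' M : ℕ}
    {U U' : ℕ → Prop} {E E' : Option DTree} {q : ℕ} (h : Rearranges R w D Y k a c M U E)
    (h' : Rearranges R w D Y k a' c' M U' E') (hU : ∀ v, U v → ¬ R q v) (hU' : ∀ v, U' v → R q v) :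
    Rearranges R w D Y k (a + a' + 1) (c + c') M (fun v => U v ∨ U' v) (join q E E') := by
  have hd : ∀ v, U v → ¬ U' v := fun v h1 h2 => hU v h1 (hU' v h2)
  have hp : (optLeaves E ++ optLeaves E').Perm _ :=
    (h.leaves.append h'.leaves).trans (filter_or_perm hd D.leaves).symm
  refine ⟨by rwa [optLeaves_join], ?_, ?_⟩
  · refine h.splits.join h'.splits (fun v hv => ?_) (fun v hv => ?_)
    · rw [h'.leaves.mem_iff, List.mem_filter] at hv
      exact hU' v (truth_iff.1 hv.2)
    · rw [h.leaves.mem_iff, List.mem_filter] at hv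
      exact hU v (truth_iff.1 hv.2)
  · have h1 := optCost_join_le w q E E'
    have h2 := (hp.map w).sum_eq
    rw [sum_map_filter, List.map_append, List.sum_append] at h2
    have h3 : D.leafWeight (weightOn (fun v => U v ∨ U' v) w) ≤ D.leafWeight w :=
      leafWeight_mono (weightOn_le _ w) D
    unfold DTree.leafWeight at h3
    have h4 := h.cost
    have h5 := h'.cost
    rw [weightOn_or hd, leafWeight_add, cost_add, mul_add, add_mul, add_mul, add_mul]
    unfold DTree.leafWeight at *
    omega

/-- The alternative `hM` covers the singleton component `{c}`, which may be arbitrarily heavy but is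
separated by no query at all. -/
theorem Rearranges.restrict {R : ℕ → ℕ → Prop} {w : ℕ → ℕ} {D Y : DTree} {qs : List ℕ}
    (U K : ℕ → Prop) {M : ℕ} (hd : D.Descends qs Y) (hs : D.Splits R)
    (hK : ∀ q a b, U a → U b → ¬ R q a → R q b → K q)
    (hM : (∀ q, ¬ K q) ∨ Y.leafWeight (weightOn U w) ≤ M) :
    Rearranges R w D Y qs.length 0 (qs.countP fun q => truth (K q)) M U (restrict U D) := by
  refine ⟨by rw [optLeaves_restrict], OptionSplits.restrict U hs, ?_⟩
  have h := optCost_restrict_descends U K w R hd hs hK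
  rcases hM with hM | hM
  · simp only [hM, truth_false, List.countP_false, Function.const_apply, zero_mul] at h ⊢
    omega
  · have := Nat.mul_le_mul_left (qs.countP fun q => truth (K q)) hM
    omega

/-- A relation with the properties of "`v` is in the subtree rooted at `u`". -/
structure Laminar (R : ℕ → ℕ → Prop) : Prop where
  trans : ∀ {u v x}, R u v → R v x → R u x
  total : ∀ {u v x}, R u x → R v x → R u v ∨ R v u
  antisymm : ∀ {u v}, R u v → R v u → u = v

/-- `cs` are the children of `c`. -/
structure ChildrenOf (R : ℕ → ℕ → Prop) (c : ℕ) (cs : List ℕ) : Prop where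
  iff : ∀ a, R c a ↔ a = c ∨ ∃ c' ∈ cs, R c' a
  pairwise : cs.Pairwise fun u v => ∀ a, R u a → ¬ R v a
  not_above : ∀ c' ∈ cs, ¬ R c' c

theorem countP_or {P Q : ℕ → Prop} (h : ∀ q, P q → ¬ Q q) (qs : List ℕ) :
    (qs.countP fun q => truth (P q ∨ Q q)) =
      (qs.countP fun q => truth (P q)) + qs.countP fun q => truth (Q q) := by
  induction qs with
  | nil => simp
  | cons q qs ih =>
    have := h q
    by_cases h1 : P q <;> by_cases h2 : Q q <;> simp_all <;> omega

/-- The subtrees of the children are split off one by one, each at the price of one query, until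
only `c` is left. As these subtrees are disjoint, so are the sets of queries that they retain, and
the counts add up to the count for the union. -/
theorem exists_rearranges_star {R : ℕ → ℕ → Prop} (hR : Laminar R) {w : ℕ → ℕ} {D Y : DTree}
    {qs : List ℕ} (hd : D.Descends qs Y) (hs : D.Splits R) {M : ℕ} (c : ℕ) (cs : List ℕ)
    (hp : cs.Pairwise fun u v => ∀ a, R u a → ¬ R v a) (hc : ∀ c' ∈ cs, ¬ R c' c)
    (hM : ∀ c' ∈ cs, Y.leafWeight (weightOn (R c') w) ≤ M) :
    ∃ E, Rearranges R w D Y qs.length cs.length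
      (qs.countP fun q => truth (∃ c' ∈ cs, R c' q)) M (fun v => v = c ∨ ∃ c' ∈ cs, R c' v) E := by
  induction cs with
  | nil =>
    have h := Rearranges.restrict (M := M) (w := w) (fun v => v = c) (fun _ => False) hd hs
      (by rintro q a b rfl rfl h1 h2; exact h1 h2) (Or.inl (by simp))
    exact ⟨_, by simpa using h⟩
  | cons c' cs ih =>
    rw [List.pairwise_cons] at hp
    obtain ⟨E, hE⟩ := ih hp.2 (fun x hx => hc x (by simp [hx])) (fun x hx => hM x (by simp [hx]))
    have h := Rearranges.restrict (M := M) (w := w) (R c') (R c') hd hs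
      -- A query with an element of the subtree of `c'` below it is comparable to `c'`. If it were
      -- above `c'`, it would be above the whole subtree and separate nothing in it.
      (fun q a b h1 h2 h3 h4 => (hR.total h4 h2).resolve_left fun h5 => h3 (hR.trans h5 h1))
      (Or.inr (hM c' (by simp)))
    have h := hE.join (q := c') h (fun v hv hv' => ?_) (fun v hv => hv)
    · refine ⟨TreeSearch.join c' E (restrict (R c') D), ?_⟩
      · convert h using 1
        · simp
        · rw [← countP_or]
          · congr 1
            funext q
            simp only [List.mem_cons, exists_eq_or_imp]
            congr 1
            exact propext or_comm
          · rintro q ⟨x, hx, h1⟩ h2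
            exact hp.1 x hx q h2 h1
        · funext v
          simp only [List.mem_cons, exists_eq_or_imp, eq_iff_iff]
          exact (or_congr Iff.rfl or_comm).trans or_assoc.symm
    · rcases hv with rfl | ⟨x, hx, h1⟩
      · exact hc c' (by simp) hv'
      · exact hp.1 x hx v hv' h1

theorem weightOn_univ {U : ℕ → Prop} (h : ∀ v, U v) (w : ℕ → ℕ) : weightOn U w = w := by
  funext v
  simp [weightOn, h v]

/-- Along a sufficiently long path in an optimal tree, the weight drops by a factor of `3 / 4`. -/
theorem four_mul_leafWeight_le {R : ℕ → ℕ → Prop} (hR : Laminar R) {w : ℕ → ℕ} {D Y : DTree}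
    {qs : List ℕ} (hd : D.Descends qs Y) (hD : D.OptSplits R w) {c K : ℕ} {cs : List ℕ}
    (hcs : ChildrenOf R c cs) (hK : cs.length ≤ K) (hqs : qs.length = 4 * (K + 1))
    (hout : 2 * D.leafWeight (weightOn (fun v => ¬ R c v) w) ≤ D.leafWeight w)
    (hin : ∀ c' ∈ cs, 2 * D.leafWeight (weightOn (R c') w) ≤ D.leafWeight w) :
    4 * Y.leafWeight w ≤ 3 * D.leafWeight w := by
  set M := D.leafWeight w / 2 with hM
  obtain ⟨E, hE⟩ := exists_rearranges_star hR hd hD.1 (M := M) (w := w) c cs hcs.pairwise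
    hcs.not_above fun c' hc' => by
      have := hd.leafWeight_le (weightOn (R c') w)
      have := hin c' hc'
      omega
  -- A query inside the subtree of `c` has no outside node below it, so only outside queries can
  -- separate outside nodes.
  have ho := Rearranges.restrict (M := M) (w := w) (fun v => ¬ R c v) (fun q => ¬ R c q) hd hD.1
    (fun q a b h1 h2 h3 h4 h5 => h2 (hR.trans h5 h4))
    (Or.inr (by
      have := hd.leafWeight_le (weightOn (fun v => ¬ R c v) w)
      omega))
  have h := ho.join (q := c) hE (fun v hv => hv) (fun v hv => (hcs.iff v).2 hv)
  have hU : ∀ v, ¬ R c v ∨ (v = c ∨ ∃ c' ∈ cs, R c' v) := fun v => by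
    rw [← hcs.iff]
    tauto
  -- Each query above `Y` is retained by at most one component; a query to `c` itself is retained by
  -- none.
  have hcount : (qs.countP fun q => truth (¬ R c q)) +
      (qs.countP fun q => truth (∃ c' ∈ cs, R c' q)) ≤ qs.length := by
    rw [← countP_or]
    · exact List.countP_le_length
    · rintro q h1 ⟨c', hc', h2⟩
      exact h1 ((hcs.iff q).2 (Or.inr ⟨c', hc', h2⟩))
  have hcost := h.cost
  have hleaves := h.leaves
  have hsplits := h.splits
  rw [weightOn_univ hU] at hcost
  have hfil : (D.leaves.filter fun v => truth (¬ R c v ∨ (v = c ∨ ∃ c' ∈ cs, R c' v))) =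
      D.leaves := List.filter_eq_self.2 fun v _ => truth_iff.2 (hU v)
  rw [hfil] at hleaves
  cases hj : join c (restrict (fun v => ¬ R c v) D) E with
  | none =>
    rw [hj] at hleaves
    exact absurd hleaves.symm.eq_nil D.leaves_ne_nil
  | some D' =>
    rw [hj] at hleaves hsplits hcost
    have h1 := hD.2 D' hsplits hleaves
    change D'.cost w + _ ≤ _ at hcost
    have h2 := Nat.mul_le_mul_right M hcount
    have h3 : (0 + cs.length + 1) * D.leafWeight w ≤ (K + 1) * D.leafWeight w :=
      Nat.mul_le_mul_right _ (by omega)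
    -- `D` costs no more than the competitor `D'`, so the saving is at most the price of the new
    -- queries plus `M` for each retained query.
    have h4 : qs.length * Y.leafWeight w ≤ (K + 1) * D.leafWeight w + qs.length * M := by omega
    have h5 : 2 * M ≤ D.leafWeight w := by omega
    rw [hqs] at h4
    -- With `qs.length = 4 (K + 1)` and `2 M ≤ W`, the right side of `h4` is at most `3 (K + 1) W`.
    have h6 : (K + 1) * (4 * Y.leafWeight w) ≤ (K + 1) * (3 * D.leafWeight w) := by
      have := Nat.mul_le_mul_left (2 * (K + 1)) h5
      nlinarith
    exact Nat.le_of_mul_le_mul_left h6 (by omega)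

/-- The trees with leaves in `S` have a balanced node with at most `K` children. -/
def HasCentroids (R : ℕ → ℕ → Prop) (K : ℕ) (S : Set ℕ) : Prop :=
  ∀ (w : ℕ → ℕ) (D : DTree), (∀ a ∈ D.leaves, a ∈ S) → ∃ c cs, ChildrenOf R c cs ∧ cs.length ≤ K ∧
    2 * D.leafWeight (weightOn (fun v => ¬ R c v) w) ≤ D.leafWeight w ∧
    ∀ c' ∈ cs, 2 * D.leafWeight (weightOn (R c') w) ≤ D.leafWeight w

/-- Every `4 (K + 1)` levels the weight drops by the factor `3 / 4`, while subtrees of optimal trees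
stay optimal. Positive integer weights cannot fall below `1`, which is the contradiction at `i = 0`.
-/
theorem height_le_of_optSplits {R : ℕ → ℕ → Prop} (hR : Laminar R) {K : ℕ} {S : Set ℕ}
    (hC : HasCentroids R K S) {w : ℕ → ℕ} (hw : ∀ v, 0 < w v) (i : ℕ) (D : DTree)
    (hD : D.OptSplits R w) (hS : ∀ a ∈ D.leaves, a ∈ S) (hi : D.leafWeight w * 3 ^ i < 4 ^ i) :
    D.height ≤ 4 * (K + 1) * i := by
  induction i generalizing D with
  | zero =>
    exfalso
    obtain ⟨a, ha⟩ := List.exists_mem_of_ne_nil _ D.leaves_ne_nil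
    have h1 : w a ≤ D.leafWeight w := List.le_sum_of_mem (List.mem_map_of_mem ha)
    have h2 := hw a
    simp at hi
    omega
  | succ i ih =>
    by_contra hh
    have e : 4 * (K + 1) * (i + 1) = 4 * (K + 1) * i + 4 * (K + 1) := by ring
    obtain ⟨qs, Y, hd, hl, hY⟩ := D.exists_descends (4 * (K + 1)) (by
      have := Nat.zero_le (4 * (K + 1) * i)
      omega)
    obtain ⟨c, cs, hcs, hK, hout, hin⟩ := hC w D hS
    have h := four_mul_leafWeight_le hR hd hD hcs hK hl hout hin
    have := ih Y (hd.optSplits hD) (fun a ha => hS a (hd.mem_leaves ha)) (by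
      have h1 := Nat.mul_le_mul_right (3 ^ i) h
      rw [pow_succ, pow_succ] at hi
      nlinarith)
    omega

/-! ### Subtrees -/

namespace RTree

theorem subtreesList_cons (v : ℕ) (cs' cs : List RTree) :
    subtreesList (node v cs' :: cs) = node v cs' :: (subtreesList cs' ++ subtreesList cs) := by
  simp [subtreesList, subtrees]

theorem subtrees_node (v : ℕ) (cs : List RTree) :
    (node v cs).subtrees = node v cs :: subtreesList cs := by
  simp [subtrees]

/-- Sublists, rather than subsets, pass on the absence of repeated names, give bounds on lengths,
and are antisymmetric. -/
theorem sublist_subtreesList {S : RTree} {cs : List RTree} (h : S ∈ subtreesList cs) :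
    S.subtrees.Sublist (subtreesList cs) := by
  induction cs using forest_induction with
  | nil => simp [subtreesList] at h
  | cons v cs' cs ih' ih =>
    rw [subtreesList_cons] at h ⊢
    rcases List.mem_cons.1 h with rfl | h
    · rw [subtrees_node]
      exact (List.sublist_append_left _ _).cons_cons _
    · rcases List.mem_append.1 h with h | h
      · exact ((ih' h).trans (List.sublist_append_left _ _)).cons _
      · exact ((ih h).trans (List.sublist_append_right _ _)).cons _

theorem subtreesList_singleton (T : RTree) : subtreesList [T] = T.subtrees := by
  simp [subtreesList]

theorem sublist_subtrees {S T : RTree} (h : S ∈ T.subtrees) : S.subtrees.Sublist T.subtrees := by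
  rw [← subtreesList_singleton T] at h ⊢
  exact sublist_subtreesList h

theorem mem_subtrees_self (T : RTree) : T ∈ T.subtrees := by
  obtain ⟨v, cs⟩ := T
  simp [subtrees_node]

theorem mem_subtreesList_of_mem {C : RTree} {cs : List RTree} (h : C ∈ cs) :
    C ∈ subtreesList cs := by
  induction cs with
  | nil => simp at h
  | cons c cs ih =>
    rw [subtreesList, List.mem_append]
    rcases List.mem_cons.1 h with rfl | h
    · exact Or.inl (mem_subtrees_self _)
    · exact Or.inr (ih h)

theorem mem_subtrees_of_mem_children {v : ℕ} {C : RTree} {cs : List RTree} (h : C ∈ cs) :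
    C ∈ (node v cs).subtrees := by
  rw [subtrees_node]
  exact List.mem_cons_of_mem _ (mem_subtreesList_of_mem h)

theorem length_subtrees_lt {v : ℕ} {C : RTree} {cs : List RTree} (h : C ∈ cs) :
    C.subtrees.length < (node v cs).subtrees.length := by
  have := (sublist_subtreesList (mem_subtreesList_of_mem h)).length_le
  rw [subtrees_node, List.length_cons]
  omega

/-- Two subtrees with a common node lie in the same tree of the forest, for otherwise its name would
occur twice. There either one of them is the whole tree, or the induction applies to the children.
-/
theorem subtrees_laminar {cs : List RTree} (hn : (nodesList cs).Nodup) {S S' : RTree}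
    (h : S ∈ subtreesList cs) (h' : S' ∈ subtreesList cs) {x : ℕ} (hx : x ∈ S.nodes)
    (hx' : x ∈ S'.nodes) : S ∈ S'.subtrees ∨ S' ∈ S.subtrees := by
  have sub : ∀ {S : RTree} {cs : List RTree} {x : ℕ}, S ∈ subtreesList cs → x ∈ S.nodes →
      x ∈ nodesList cs := fun h hx => ((sublist_subtreesList h).map root).subset hx
  induction cs using forest_induction with
  | nil => simp [subtreesList] at h
  | cons v cs' cs ih' ih =>
    rw [nodesList_cons, List.nodup_cons, List.nodup_append] at hn
    obtain ⟨hv, hn', hn, hd⟩ := hn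
    simp only [List.mem_append, not_or] at hv
    rw [subtreesList_cons, List.mem_cons, List.mem_append] at h h'
    have top : ∀ {S : RTree} {x : ℕ}, S ∈ subtreesList cs → x ∈ S.nodes →
        x ∈ (node v cs').nodes → False := by
      intro S x hS hx hx'
      rw [nodes_node, List.mem_cons] at hx'
      rcases hx' with rfl | hx'
      · exact hv.2 (sub hS hx)
      · exact hd x hx' x (sub hS hx) rfl
    rcases h with rfl | h | h
    · rcases h' with rfl | h' | h'
      · exact Or.inl (mem_subtrees_self _)
      · exact Or.inr (by rw [subtrees_node]; exact List.mem_cons_of_mem _ h')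
      · exact (top h' hx' hx).elim
    · rcases h' with rfl | h' | h'
      · exact Or.inl (by rw [subtrees_node]; exact List.mem_cons_of_mem _ h)
      · exact ih' hn' h h'
      · exact (hd x (sub h hx) x (sub h' hx') rfl).elim
    · rcases h' with rfl | h' | h'
      · exact (top h hx hx').elim
      · exact (hd x (sub h' hx') x (sub h hx) rfl).elim
      · exact ih hn h h'

theorem nodesList_eq_flatMap (cs : List RTree) : nodesList cs = cs.flatMap nodes := by
  induction cs with
  | nil => simp
  | cons c cs ih =>
    obtain ⟨v, cs'⟩ := c
    simp [nodesList_cons, ih, nodes_node]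

theorem root_mem_nodes (T : RTree) : T.root ∈ T.nodes :=
  List.mem_map_of_mem (mem_subtrees_self T)

theorem below_iff {T S : RTree} (hT : T.Valid) (hS : S ∈ T.subtrees) (a : ℕ) :
    T.Below S.root a ↔ a ∈ S.nodes := by
  constructor
  · rintro ⟨S', hS', hr, ha⟩
    rwa [← List.inj_on_of_nodup_map hT hS' hS hr]
  · exact fun ha => ⟨S, hS, rfl, ha⟩

theorem laminar_below {T : RTree} (hT : T.Valid) : Laminar T.Below := by
  have key : ∀ {u v}, T.Below u v → ∃ S ∈ T.subtrees, S.root = u ∧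
      ∃ S' ∈ S.subtrees, S'.root = v ∧ S' ∈ T.subtrees := by
    rintro u v ⟨S, hS, rfl, hv⟩
    obtain ⟨S', hS', rfl⟩ := List.mem_map.1 hv
    exact ⟨S, hS, rfl, S', hS', rfl, (sublist_subtrees hS).subset hS'⟩
  refine ⟨fun {u v x} huv hvx => ?_, fun {u v x} hux hvx => ?_, fun {u v} huv hvu => ?_⟩
  · obtain ⟨S, hS, rfl, S', hS', rfl, hST⟩ := key huv
    rw [below_iff hT hST] at hvx
    rw [below_iff hT hS]
    exact ((sublist_subtrees hS').map root).subset hvx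
  · obtain ⟨S, hS, rfl, hx⟩ := hux
    obtain ⟨S', hS', rfl, hx'⟩ := hvx
    rw [below_iff hT hS, below_iff hT hS']
    rw [← subtreesList_singleton] at hS hS'
    rcases subtrees_laminar (by rwa [nodesList_singleton]) hS hS' hx hx' with h | h
    · exact Or.inr (List.mem_map_of_mem h)
    · exact Or.inl (List.mem_map_of_mem h)
  · obtain ⟨S, hS, rfl, S', hS', rfl, hST⟩ := key huv
    rw [below_iff hT hST] at hvu
    obtain ⟨S2, hS2, hr⟩ := List.mem_map.1 hvu
    obtain rfl := List.inj_on_of_nodup_map hT ((sublist_subtrees hST).subset hS2) hS hr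
    -- Each of the two subtrees occurs in the other, so their lists of subtrees are sublists of each
    -- other, hence equal; the heads of the lists are the trees themselves.
    have h := (sublist_subtrees hS').antisymm (sublist_subtrees hS2)
    obtain ⟨v, cs⟩ := S2
    obtain ⟨v', cs'⟩ := S'
    rw [subtrees_node, subtrees_node] at h
    simp only [List.cons.injEq] at h
    rw [h.1]

theorem valid_of_mem_subtrees {T S : RTree} (hT : T.Valid) (hS : S ∈ T.subtrees) : S.Valid :=
  ((sublist_subtrees hS).map root).nodup hT

theorem childrenOf_below {T : RTree} (hT : T.Valid) {c : ℕ} {cs : List RTree}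
    (hS : node c cs ∈ T.subtrees) : ChildrenOf T.Below c (cs.map root) := by
  have hn := valid_of_mem_subtrees hT hS
  unfold Valid at hn
  rw [nodes_node, List.nodup_cons, nodesList_eq_flatMap] at hn
  have hC : ∀ C ∈ cs, C ∈ T.subtrees := fun C hC =>
    (sublist_subtrees hS).subset (mem_subtrees_of_mem_children hC)
  refine ⟨fun a => ?_, ?_, ?_⟩
  · have := below_iff hT hS a
    change T.Below c a ↔ _ at this
    rw [this, nodes_node, List.mem_cons, nodesList_eq_flatMap, List.mem_flatMap]
    refine or_congr Iff.rfl ⟨?_, ?_⟩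
    · rintro ⟨C, hCc, ha⟩
      exact ⟨C.root, List.mem_map_of_mem hCc, (below_iff hT (hC C hCc) a).2 ha⟩
    · rintro ⟨u, hu, ha⟩
      obtain ⟨C, hCc, rfl⟩ := List.mem_map.1 hu
      exact ⟨C, hCc, (below_iff hT (hC C hCc) a).1 ha⟩
  · rw [List.pairwise_map]
    refine (List.nodup_flatMap.1 hn.2).2.imp_of_mem fun {C C'} h h' hd a ha ha' => ?_
    rw [below_iff hT (hC _ h)] at ha
    rw [below_iff hT (hC _ h')] at ha'
    exact hd ha ha'
  · intro u hu h
    obtain ⟨C, hCc, rfl⟩ := List.mem_map.1 hu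
    rw [below_iff hT (hC C hCc)] at h
    exact hn.1 (List.mem_flatMap.2 ⟨C, hCc, h⟩)

-- Degrees and centroids

theorem length_children_le_maxChildren {fs : List RTree} {S : RTree} (hS : S ∈ subtreesList fs)
    (i : ℕ) : S.children.length ≤ maxChildren fs i := by
  have key : ∀ fs i, fs.length + i ≤ maxChildren fs i := by
    intro fs
    induction fs with
    | nil => simp [maxChildren]
    | cons c fs ih =>
      intro i
      have := ih (i + 1)
      simp only [maxChildren, List.length_cons]
      omega
  induction fs using forest_induction generalizing i with
  | nil => simp [subtreesList] at hS
  | cons v cs' cs ih' ih =>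
    rw [subtreesList_cons, List.mem_cons, List.mem_append] at hS
    rw [maxChildren_cons]
    rcases hS with rfl | hS | hS
    · exact (key cs' 0).trans (le_max_left _ _)
    · exact (ih' hS 0).trans (le_max_left _ _)
    · exact (ih hS (i + 1)).trans (le_max_right _ _)

theorem maxChildren_le {fs : List RTree} {m : ℕ} (h : ∀ S ∈ subtreesList fs, S.children.length ≤ m)
    (i : ℕ) (hi : fs.length + i ≤ m) : maxChildren fs i ≤ m := by
  induction fs using forest_induction generalizing i with
  | nil => simpa [maxChildren] using hi
  | cons v cs' cs ih' ih =>
    rw [maxChildren_cons]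
    simp only [subtreesList_cons, List.mem_cons, List.mem_append] at h
    rw [List.length_cons] at hi
    refine max_le (ih' (fun S hS => h S (by tauto)) 0 ?_) (ih (fun S hS => h S (by tauto)) _ ?_)
    · exact h _ (Or.inl rfl)
    · omega

/-- The count includes a virtual node whose only child is `T`; the summand `1` is needed for it if
`T` is a single node, of degree `0`. -/
theorem maxChildren_le_maxDegree (T : RTree) : maxChildren [T] 0 ≤ T.maxDegree + 1 := by
  have hd : ∀ d ∈ T.degrees, d ≤ T.maxDegree := by
    intro d hd
    unfold maxDegree
    generalize T.degrees = l at hd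
    induction l with
    | nil => simp at hd
    | cons x l ih =>
      rw [List.foldr_cons]
      rcases List.mem_cons.1 hd with rfl | hd
      · exact le_max_left _ _
      · exact (ih hd).trans (le_max_right _ _)
  obtain ⟨v, cs⟩ := T
  refine maxChildren_le (fun S hS => ?_) 0 (by simp)
  rw [subtreesList_singleton, subtrees_node, List.mem_cons] at hS
  rcases hS with rfl | hS
  · have := hd cs.length (by simp [degrees, children])
    exact this.trans (by omega)
  · have := hd (S.children.length + 1) (by
      rw [degrees]
      exact List.mem_cons_of_mem _ (List.mem_map.2 ⟨S, hS, rfl⟩))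
    omega

/-- Starting from the root, move to a child whose subtree carries at least half of the weight, as
long as there is one. Where this stops, all children are light, and the outside is light because the
subtree itself is heavy. Only the leaves of `D` are weighed, so the same tree `T` serves all
subtrees of a search tree. -/
theorem hasCentroids_below {T : RTree} (hT : T.Valid) :
    HasCentroids T.Below (maxChildren [T] 0) {a | a ∈ T.nodes} := by
  intro w D hD
  have key : ∀ (n : ℕ) (S : RTree), S.subtrees.length = n → S ∈ T.subtrees →
      D.leafWeight w ≤ 2 * D.leafWeight (weightOn (T.Below S.root) w) →
      ∃ c cs, ChildrenOf T.Below c cs ∧ cs.length ≤ maxChildren [T] 0 ∧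
        2 * D.leafWeight (weightOn (fun v => ¬ T.Below c v) w) ≤ D.leafWeight w ∧
        ∀ c' ∈ cs, 2 * D.leafWeight (weightOn (T.Below c') w) ≤ D.leafWeight w := by
    intro n
    induction n using Nat.strong_induction_on with
    | _ n ih =>
      rintro ⟨c, cs⟩ rfl hS hw
      by_cases h : ∃ C ∈ cs, D.leafWeight w ≤ 2 * D.leafWeight (weightOn (T.Below C.root) w)
      · obtain ⟨C, hC, hCw⟩ := h
        exact ih _ (length_subtrees_lt hC) C rfl
          ((sublist_subtrees hS).subset (mem_subtrees_of_mem_children hC)) hCw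
      · push Not at h
        refine ⟨c, cs.map root, childrenOf_below hT hS, ?_, ?_, ?_⟩
        · rw [← subtreesList_singleton] at hS
          simpa [children] using length_children_le_maxChildren hS 0
        · change _ ≤ 2 * D.leafWeight (weightOn (T.Below c) w) at hw
          have h1 := weightOn_or (U := T.Below c) (U' := fun v => ¬ T.Below c v)
            (fun v hv => not_not_intro hv) w
          rw [weightOn_univ (fun v => em _)] at h1
          have h2 := leafWeight_add (weightOn (T.Below c) w)
            (weightOn (fun v => ¬ T.Below c v) w) D
          rw [← h1] at h2
          omega
        · intro c' hc'
          obtain ⟨C, hC, rfl⟩ := List.mem_map.1 hc'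
          exact (h C hC).le
  refine key _ T rfl (mem_subtrees_self T) ?_
  have : D.leafWeight (weightOn (T.Below T.root) w) = D.leafWeight w := by
    unfold DTree.leafWeight
    congr 1
    refine List.map_congr_left fun a ha => ?_
    simp [weightOn, (below_iff hT (mem_subtrees_self T) a).2 (hD a ha)]
  omega

/-- The trees in `cs` are the last ones that hang from the node `p` of `T`. -/
def Hangs (T : RTree) (p : ℕ) (cs : List RTree) : Prop :=
  ∃ pre, node p (pre ++ cs) ∈ T.subtrees

theorem hangs_children {T : RTree} {v : ℕ} {cs : List RTree} (h : node v cs ∈ T.subtrees) :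
    T.Hangs v cs :=
  ⟨[], h⟩

section Hangs

variable {T : RTree} {p v : ℕ} {cs' cs : List RTree}

theorem Hangs.tail {c : RTree} (h : T.Hangs p (c :: cs)) : T.Hangs p cs := by
  obtain ⟨pre, h⟩ := h
  exact ⟨pre ++ [c], by simpa using h⟩

theorem Hangs.head_mem {c : RTree} (h : T.Hangs p (c :: cs)) : c ∈ T.subtrees := by
  obtain ⟨pre, h⟩ := h
  exact (sublist_subtrees h).subset (mem_subtrees_of_mem_children (by simp))

theorem Hangs.nodup (hT : T.Valid) (h : T.Hangs p cs) : (nodesList cs).Nodup := by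
  obtain ⟨pre, h⟩ := h
  have := valid_of_mem_subtrees hT h
  unfold Valid at this
  rw [nodes_node, nodesList_eq_flatMap, List.flatMap_append, ← nodesList_eq_flatMap,
    ← nodesList_eq_flatMap] at this
  exact (List.nodup_append.1 (List.nodup_cons.1 this).2).2.1

theorem below_refl {a : ℕ} (ha : a ∈ T.nodes) : T.Below a a := by
  obtain ⟨S, hS, rfl⟩ := List.mem_map.1 ha
  exact ⟨S, hS, rfl, root_mem_nodes S⟩

theorem Hangs.below_head_iff (hT : T.Valid) (h : T.Hangs p (node v cs' :: cs)) (a : ℕ) :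
    T.Below v a ↔ a = v ∨ a ∈ nodesList cs' := by
  have := below_iff hT h.head_mem a
  rwa [nodes_node, List.mem_cons] at this

theorem Hangs.not_below_head (hT : T.Valid) (h : T.Hangs p (node v cs' :: cs)) {q : ℕ}
    (hq : q ∈ nodesList cs') : ¬ T.Below q v := by
  intro hqv
  have := h.nodup hT
  rw [nodesList_cons, List.nodup_cons] at this
  have e := (laminar_below hT).antisymm hqv ((h.below_head_iff hT q).2 (Or.inr hq))
  subst e
  exact this.1 (by simp [hq])

theorem Hangs.not_below_tail (hT : T.Valid) (h : T.Hangs p (node v cs' :: cs)) {q a : ℕ}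
    (hq : q = v ∨ q ∈ nodesList cs') (ha : a ∈ nodesList cs) :
    ¬ T.Below q a ∧ ¬ T.Below a q := by
  have hn := h.nodup hT
  rw [nodesList_cons, List.nodup_cons, List.nodup_append] at hn
  have hdisj : ∀ x, x ∈ nodesList cs → ¬ (x = v ∨ x ∈ nodesList cs') := by
    rintro x hx (rfl | hx')
    · exact hn.1 (by simp [hx])
    · exact hn.2.2.2 x hx' x hx rfl
  have hvq := (h.below_head_iff hT q).2 hq
  constructor
  · exact fun hqa => hdisj a ha ((h.below_head_iff hT a).1 ((laminar_below hT).trans hvq hqa))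
  · intro haq
    obtain ⟨C, hC, haC⟩ := List.mem_flatMap.1 (nodesList_eq_flatMap cs ▸ ha)
    have hCT : C ∈ T.subtrees := by
      obtain ⟨pre, h⟩ := h
      exact (sublist_subtrees h).subset (mem_subtrees_of_mem_children (by simp [hC]))
    have h1 := (laminar_below hT).trans ((below_iff hT hCT a).2 haC) haq
    rw [below_iff hT hCT] at h1
    exact hdisj q (by rw [nodesList_eq_flatMap]; exact List.mem_flatMap.2 ⟨C, hC, h1⟩) hq

theorem Hangs.childrenOf (hT : T.Valid) (h : T.Hangs p (node v cs' :: cs)) :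
    ∃ us, ChildrenOf T.Below p us ∧ v ∈ us := by
  obtain ⟨pre, h⟩ := h
  exact ⟨_, childrenOf_below hT h, by simp [root]⟩

theorem Hangs.not_below_parent (hT : T.Valid) (h : T.Hangs p (node v cs' :: cs)) :
    ¬ T.Below v p := by
  obtain ⟨us, hus, hv⟩ := h.childrenOf hT
  exact hus.not_above v hv

/-- Only the query `v` distinguishes `v` from its parent. A node `q` above `v` is comparable to `p`;
if it were strictly below `p`, it would lie in the subtree of a child `u` of `p`, which contains
`v`. Then `u = v`, and `q = v` by antisymmetry. -/
theorem Hangs.below_head_iff_parent (hT : T.Valid) (h : T.Hangs p (node v cs' :: cs)) {q : ℕ}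
    (hq : q ≠ v) : T.Below q v ↔ T.Below q p := by
  have hR := laminar_below hT
  obtain ⟨us, hus, hv⟩ := h.childrenOf hT
  have hvv := (h.below_head_iff hT v).2 (Or.inl rfl)
  have hpv : T.Below p v := (hus.iff v).2 (Or.inr ⟨v, hv, hvv⟩)
  refine ⟨fun hqv => ?_, fun hqp => hR.trans hqp hpv⟩
  refine (hR.total hqv hpv).elim id fun hpq => ?_
  rcases (hus.iff q).1 hpq with rfl | ⟨u, hu, huq⟩
  · exact hpq
  · exfalso
    have huv := hR.trans huq hqv
    by_cases e : u = v
    · subst e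
      exact hq (hR.antisymm hqv huq)
    · have : Std.Symm fun x y => ∀ a, T.Below x a → ¬ T.Below y a :=
        ⟨fun x y hxy a ha ha' => hxy a ha' ha⟩
      exact hus.pairwise.forall hu hv e v huv hvv

end Hangs

end RTree

/-! ### Search trees and splitting trees -/

namespace DTree

theorem leaves_subset_labels (D : DTree) {a : ℕ} (ha : a ∈ D.leaves) : a ∈ D.labels := by
  induction D with
  | leaf v => simpa [leaves, labels] using ha
  | query q l r ihl ihr =>
    simp only [leaves, labels, List.mem_append, List.mem_cons] at ha ⊢
    tauto

theorem SearchProperty.splits {T : RTree} {D : DTree} (h : D.SearchProperty T) :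
    D.Splits T.Below := by
  induction D with
  | leaf v => trivial
  | query q l r ihl ihr =>
    exact ⟨fun a ha => h.1 a (leaves_subset_labels r ha),
      fun a ha => h.2.1 a (leaves_subset_labels l ha), ihl h.2.2.1, ihr h.2.2.2⟩

/-- Both subtrees of a query have leaves, so a query always separates two leaves. This is how a
condition on leaves only controls all labels. -/
theorem Splits.label {R : ℕ → ℕ → Prop} {D : DTree} (h : D.Splits R) {a : ℕ} (ha : a ∈ D.labels) :
    a ∈ D.leaves ∨ ((∃ x ∈ D.leaves, R a x) ∧ ∃ y ∈ D.leaves, ¬ R a y) := by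
  induction D with
  | leaf v => exact Or.inl (by simpa [leaves, labels] using ha)
  | query q l r ihl ihr =>
    simp only [labels, List.mem_append, List.mem_cons] at ha
    simp only [leaves, List.mem_append]
    rcases ha with rfl | ha | ha
    · obtain ⟨y, hy⟩ := List.exists_mem_of_ne_nil _ l.leaves_ne_nil
      obtain ⟨x, hx⟩ := List.exists_mem_of_ne_nil _ r.leaves_ne_nil
      exact Or.inr ⟨⟨x, Or.inr hx, h.1 x hx⟩, ⟨y, Or.inl hy, h.2.1 y hy⟩⟩
    · rcases ihl h.2.2.1 ha with h | ⟨⟨x, hx, h1⟩, ⟨y, hy, h2⟩⟩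
      · exact Or.inl (Or.inl h)
      · exact Or.inr ⟨⟨x, Or.inl hx, h1⟩, ⟨y, Or.inl hy, h2⟩⟩
    · rcases ihr h.2.2.2 ha with h | ⟨⟨x, hx, h1⟩, ⟨y, hy, h2⟩⟩
      · exact Or.inl (Or.inr h)
      · exact Or.inr ⟨⟨x, Or.inr hx, h1⟩, ⟨y, Or.inr hy, h2⟩⟩

/-- A query `a` on the "yes"-side of `q` has a leaf below it that is also below `q`, so it is
comparable to `q`. If it were above `q`, it would be above all leaves there and separate none. A
query below `q` on the "no"-side would have a leaf below it there, which would be below `q`. -/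
theorem Splits.searchProperty {T : RTree} (hT : T.Valid) {D : DTree} (h : D.Splits T.Below) :
    D.SearchProperty T := by
  have hR := RTree.laminar_below hT
  induction D with
  | leaf v => trivial
  | query q l r ihl ihr =>
    refine ⟨fun a ha => ?_, fun a ha hqa => ?_, ihl h.2.2.1, ihr h.2.2.2⟩
    · rcases h.2.2.2.label ha with ha | ⟨⟨x, hx, h1⟩, ⟨y, hy, h2⟩⟩
      · exact h.1 a ha
      · exact (hR.total (h.1 x hx) h1).resolve_right fun h3 => h2 (hR.trans h3 (h.1 y hy))
    · rcases h.2.2.1.label ha with ha | ⟨⟨x, hx, h1⟩, -⟩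
      · exact h.2.1 a ha hqa
      · exact h.2.1 x hx (hR.trans hqa h1)

theorem isSearchTree_iff {T : RTree} (hT : T.Valid) (D : DTree) :
    D.IsSearchTree T ↔ D.Splits T.Below ∧ D.leaves.Perm T.nodes := by
  constructor
  · rintro ⟨h1, h2, h3⟩
    refine ⟨h3.splits, ?_⟩
    have h4 : ∀ a ∈ D.leaves, a ∈ T.nodes := fun a ha => h1 a (leaves_subset_labels D ha)
    refine (List.perm_ext_iff_of_nodup (List.nodup_iff_count_le_one.2 fun a => ?_) hT).2
      fun a => ⟨h4 a, fun ha => List.count_pos_iff.1 (by rw [h2 a ha]; norm_num)⟩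
    by_cases ha : a ∈ T.nodes
    · exact (h2 a ha).le
    · rw [List.count_eq_zero_of_not_mem fun h => ha (h4 a h)]
      norm_num
  · rintro ⟨h1, h2⟩
    refine ⟨fun a ha => ?_, fun v hv => ?_, h1.searchProperty hT⟩
    · rcases h1.label ha with ha | ⟨⟨x, hx, ⟨S, hS, rfl, -⟩⟩, -⟩
      · exact h2.mem_iff.1 ha
      · exact List.mem_map_of_mem hS
    · rw [h2.count_eq]
      exact List.count_eq_one_of_mem hT hv

-- Existence of optimal search trees

/-- The new node `v` follows the existing queries to a leaf `u`, where one more query tells the two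
apart: by antisymmetry, `u` is not above `v` if `v` is above `u`, so `u` is queried in that case and
`v` otherwise. -/
theorem exists_insert {R : ℕ → ℕ → Prop} (hR : Laminar R) {v : ℕ} (hv : R v v) (D : DTree)
    (hD : D.Splits R) (hr : ∀ a ∈ D.leaves, R a a) (hn : v ∉ D.leaves) :
    ∃ D' : DTree, D'.Splits R ∧ D'.leaves.Perm (v :: D.leaves) := by
  induction D with
  | leaf u =>
    simp only [leaves, List.mem_singleton] at hn hr
    have hu := hr u rfl
    by_cases h : R v u
    · refine ⟨query u (leaf v) (leaf u), ?_, by simp [leaves]⟩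
      simpa [Splits, leaves, hu] using fun h' => hn (hR.antisymm h h')
    · refine ⟨query v (leaf u) (leaf v), ?_, by simpa [leaves] using List.Perm.swap _ _ _⟩
      simpa [Splits, leaves, hv] using h
  | query q l r ihl ihr =>
    simp only [leaves, List.mem_append, not_or] at hn hr
    by_cases h : R q v
    · obtain ⟨r', h1, h2⟩ := ihr hD.2.2.2 (fun a ha => hr a (Or.inr ha)) hn.2
      refine ⟨query q l r', ⟨fun a ha => ?_, hD.2.1, hD.2.2.1, h1⟩, ?_⟩
      · rcases List.mem_cons.1 (h2.mem_iff.1 ha) with rfl | ha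
        exacts [h, hD.1 a ha]
      · exact (h2.append_left _).trans List.perm_middle
    · obtain ⟨l', h1, h2⟩ := ihl hD.2.2.1 (fun a ha => hr a (Or.inl ha)) hn.1
      refine ⟨query q l' r, ⟨hD.1, fun a ha => ?_, h1, hD.2.2.2⟩, h2.append_right _⟩
      rcases List.mem_cons.1 (h2.mem_iff.1 ha) with rfl | ha
      exacts [h, hD.2.1 a ha]

theorem exists_splits {R : ℕ → ℕ → Prop} (hR : Laminar R) (l : List ℕ) (hl : l ≠ [])
    (hn : l.Nodup) (hr : ∀ a ∈ l, R a a) : ∃ D : DTree, D.Splits R ∧ D.leaves.Perm l := by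
  induction l with
  | nil => exact absurd rfl hl
  | cons v l ih =>
    rw [List.nodup_cons] at hn
    by_cases h : l = []
    · subst h
      exact ⟨leaf v, trivial, by simp [leaves]⟩
    · obtain ⟨D, h1, h2⟩ := ih h hn.2 fun a ha => hr a (by simp [ha])
      obtain ⟨D', h3, h4⟩ := exists_insert hR (hr v (by simp)) D h1
        (fun a ha => hr a (by simp [h2.mem_iff.1 ha])) (fun hv => hn.1 (h2.mem_iff.1 hv))
      exact ⟨D', h3, h4.trans (h2.cons v)⟩

theorem exists_optSplits {T : RTree} (hT : T.Valid) (w : ℕ → ℕ) :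
    ∃ D : DTree, D.OptSplits T.Below w ∧ D.leaves.Perm T.nodes := by
  classical
  obtain ⟨D, h1, h2⟩ := exists_splits (RTree.laminar_below hT) T.nodes
    (List.ne_nil_of_mem T.root_mem_nodes) hT fun a ha => RTree.below_refl ha
  have h : ∃ n, ∃ D : DTree, D.Splits T.Below ∧ D.leaves.Perm T.nodes ∧ D.cost w = n :=
    ⟨_, D, h1, h2, rfl⟩
  obtain ⟨D, h1, h2, h3⟩ := Nat.find_spec h
  refine ⟨D, ⟨h1, fun D' h1' h2' => ?_⟩, h2⟩
  rw [h3]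
  exact Nat.find_min' h ⟨D', h1', h2'.trans h2, rfl⟩

theorem cost_mul (n : ℕ) (w : ℕ → ℕ) (D : DTree) : D.cost (fun v => n * w v) = n * D.cost w := by
  have hw : ∀ D : DTree, D.leafWeight (fun v => n * w v) = n * D.leafWeight w := fun D => by
    simp [leafWeight, List.sum_map_mul_left]
  induction D with
  | leaf v => simp
  | query q l r ihl ihr => simp only [cost_query, ihl, ihr, hw]; ring

theorem leafWeight_one (D : DTree) : D.leafWeight (fun _ => 1) = D.leaves.length := by
  simp [leafWeight]

theorem cost_one_le (D : DTree) : D.cost (fun _ => 1) ≤ D.leaves.length ^ 2 := by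
  induction D with
  | leaf v => simp
  | query q l r ihl ihr =>
    have hl := List.length_pos_of_ne_nil l.leaves_ne_nil
    have hr := List.length_pos_of_ne_nil r.leaves_ne_nil
    simp only [cost_query, leafWeight_one, leaves, List.length_append]
    nlinarith

/-- Some optimal search tree has logarithmic height. -/
theorem exists_isOptimal_height_le {T : RTree} (hT : T.Valid) (w : ℕ → ℕ) :
    ∃ D : DTree, D.IsOptimal T w ∧ D.height ≤ slotCount w T := by
  set n := T.size with hn
  -- The perturbed weights are positive, and the factor `n ^ 2 + 1` exceeds every possible cost
  -- under unit weights, so the perturbation only breaks ties among optimal trees for `w`.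
  obtain ⟨D, hD, hp⟩ := exists_optSplits hT fun v => (n ^ 2 + 1) * w v + 1
  have hcost : ∀ D : DTree, D.cost (fun v => (n ^ 2 + 1) * w v + 1) =
      (n ^ 2 + 1) * D.cost w + D.cost fun _ => 1 := fun D => by
    rw [cost_add (fun v => (n ^ 2 + 1) * w v) (fun _ => 1), cost_mul]
  refine ⟨D, ⟨(isSearchTree_iff hT D).2 ⟨hD.1, hp⟩, fun D' hD' => ?_⟩, ?_⟩
  · rw [isSearchTree_iff hT] at hD'
    have h1 := hD.2 D' hD'.1 (hD'.2.trans hp.symm)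
    have h2 := cost_one_le D'
    rw [hD'.2.length_eq] at h2
    change _ ≤ n ^ 2 at h2
    rw [hcost, hcost] at h1
    by_contra h3
    -- Costs are integers: if `D'` were better for `w`, then by at least one unit, which the
    -- unit-weight term cannot compensate.
    have h4 : (n ^ 2 + 1) * (D'.cost w + 1) ≤ (n ^ 2 + 1) * D.cost w :=
      Nat.mul_le_mul_left _ (by omega)
    rw [mul_add] at h4
    omega
  · have hw : D.leafWeight (fun v => (n ^ 2 + 1) * w v + 1) = (n ^ 2 + 1) * T.weight w + n := by
      have h1 := leafWeight_add (fun v => (n ^ 2 + 1) * w v) (fun _ => 1) D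
      rw [h1, leafWeight_one, hp.length_eq]
      congr 1
      unfold leafWeight RTree.weight
      rw [(hp.map _).sum_eq, List.sum_map_mul_left]
    set W := T.weight w
    set i := Nat.clog 2 (1 + (n + W)) with hi
    have h1 : 1 + (n + W) ≤ 2 ^ i := Nat.le_pow_clog (by norm_num) _
    have h2 : (n ^ 2 + 1) * W + n < (2 ^ i) ^ 3 :=
      calc (n ^ 2 + 1) * W + n < (1 + (n + W)) ^ 3 := by
            nlinarith [Nat.zero_le (n * W), Nat.zero_le (n ^ 2 * W), Nat.zero_le (n * W ^ 2),
              Nat.zero_le (n ^ 3), Nat.zero_le (W ^ 3)]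
        _ ≤ _ := Nat.pow_le_pow_left h1 3
    -- Since `8 * 3 ^ 9 ≤ 4 ^ 9`, a total weight below `8 ^ i` is exhausted after `9 i` drops by the
    -- factor `3 / 4`. The resulting height `4 (K + 1) * 9 i` is the number of slots.
    have h3 := height_le_of_optSplits (RTree.laminar_below hT) (RTree.hasCentroids_below hT)
      (fun v => Nat.succ_pos _) (9 * i) D hD (fun a ha => hp.mem_iff.1 ha) (by
        rw [hw]
        have e1 : (3 : ℕ) ^ (9 * i) = 19683 ^ i := by rw [pow_mul]; norm_num
        have e2 : (4 : ℕ) ^ (9 * i) = 262144 ^ i := by rw [pow_mul]; norm_num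
        have e3 : (2 ^ i) ^ 3 = 8 ^ i := by rw [← pow_mul, mul_comm, pow_mul]; norm_num
        rw [e1, e2]
        rw [e3] at h2
        calc _ < 8 ^ i * 19683 ^ i := Nat.mul_lt_mul_of_pos_right h2 (by positivity)
          _ = 157464 ^ i := by rw [← mul_pow]; norm_num
          _ ≤ _ := Nat.pow_le_pow_left (by norm_num) i)
    refine h3.trans (le_of_eq ?_)
    unfold slotCount
    ring

end DTree

/-! ### Soundness of the dynamic program -/

/-- The leaves of the subtrees in the busy slots. -/
def slotLeaves : Slots → List ℕ
  | [] => []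
  | none :: z => slotLeaves z
  | some (_, r) :: z => r.leaves ++ slotLeaves z

/-- The queries in the busy slots. -/
def slotQueries : Slots → List ℕ
  | [] => []
  | none :: z => slotQueries z
  | some (q, _) :: z => q :: slotQueries z

/-- The cost of the subtrees in the busy slots, if the first slot is at depth `d`. -/
def slotCost (w : ℕ → ℕ) : ℕ → Slots → ℕ
  | _, [] => 0
  | d, none :: z => slotCost w (d + 1) z
  | d, some (_, r) :: z => r.costFrom w (d + 1) + slotCost w (d + 1) z

/-- The queries in the busy slots separate leaves as they should. -/
def SlotsSplit (R : ℕ → ℕ → Prop) : Slots → Prop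
  | [] => True
  | none :: z => SlotsSplit R z
  | some (q, r) :: z =>
    r.Splits R ∧ (∀ a ∈ r.leaves, R q a) ∧ (∀ a ∈ slotLeaves z, ¬ R q a) ∧ SlotsSplit R z

theorem slotCost_le_succ (w : ℕ → ℕ) (d : ℕ) (z : Slots) : slotCost w d z ≤ slotCost w (d + 1) z := by
  induction z generalizing d with
  | nil => simp [slotCost]
  | cons x z ih =>
    rcases x with _ | ⟨q, r⟩
    · exact ih (d + 1)
    · have := ih (d + 1)
      simp only [slotCost, DTree.costFrom_eq, add_mul] at this ⊢
      omega

theorem leaves_build_perm (v : ℕ) (z : Slots) : (build v z).leaves.Perm (v :: slotLeaves z) := by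
  induction z with
  | nil => simp [build, slotLeaves, DTree.leaves]
  | cons x z ih =>
    rcases x with _ | ⟨q, r⟩
    · exact ih
    · simp only [build, DTree.leaves, slotLeaves]
      exact (ih.append_right _).trans (List.perm_append_comm.cons v)

theorem splits_build {R : ℕ → ℕ → Prop} {v : ℕ} {z : Slots} (h : SlotsSplit R z)
    (hv : ∀ q ∈ slotQueries z, ¬ R q v) : (build v z).Splits R := by
  induction z with
  | nil => trivial
  | cons x z ih =>
    rcases x with _ | ⟨q, r⟩
    · exact ih h hv
    · refine ⟨h.2.1, fun a ha => ?_, ih h.2.2.2 fun q' hq' => hv q' (by simp [slotQueries, hq']),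
        h.1⟩
      rcases List.mem_cons.1 ((leaves_build_perm v z).mem_iff.1 ha) with rfl | ha
      exacts [hv q (by simp [slotQueries]), h.2.2.1 a ha]

/-- Dropping idle slots can only lift leaves, so slot positions overestimate depths. The inequality
is strict in general, and only this direction is needed for soundness. -/
theorem costFrom_build_le (w : ℕ → ℕ) (d v : ℕ) (z : Slots) :
    (build v z).costFrom w d ≤ slotCost w d z + d * w v + spanCost (w v) z := by
  induction z generalizing d with
  | nil => simp [build, DTree.costFrom, slotCost, spanCost]
  | cons x z ih =>
    rcases x with _ | ⟨q, r⟩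
    · have h1 := ih d
      have h2 := slotCost_le_succ w d z
      have h3 : spanCost (w v) z ≤ spanCost (w v) (none :: z) := by
        simp only [spanCost]
        split_ifs <;> omega
      simp only [build, slotCost]
      omega
    · have h1 := ih (d + 1)
      simp only [build, slotCost, DTree.costFrom, spanCost, add_mul] at h1 ⊢
      omega

section Append

variable (z z' : Slots)

theorem slotLeaves_append : slotLeaves (z ++ z') = slotLeaves z ++ slotLeaves z' := by
  induction z with
  | nil => simp [slotLeaves]
  | cons x z ih => rcases x with _ | ⟨q, r⟩ <;> simp [slotLeaves, ih]

theorem slotQueries_append : slotQueries (z ++ z') = slotQueries z ++ slotQueries z' := by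
  induction z with
  | nil => simp [slotQueries]
  | cons x z ih => rcases x with _ | ⟨q, r⟩ <;> simp [slotQueries, ih]

theorem slotCost_append (w : ℕ → ℕ) (d : ℕ) :
    slotCost w d (z ++ z') = slotCost w d z + slotCost w (d + z.length) z' := by
  induction z generalizing d with
  | nil => simp [slotCost]
  | cons x z ih =>
    have e : d + 1 + z.length = d + (z.length + 1) := by omega
    rcases x with _ | ⟨q, r⟩ <;> simp [slotCost, ih, e, add_assoc]

theorem slotsSplit_append (R : ℕ → ℕ → Prop) :
    SlotsSplit R (z ++ z') ↔ SlotsSplit R z ∧ SlotsSplit R z' ∧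
      ∀ q ∈ slotQueries z, ∀ a ∈ slotLeaves z', ¬ R q a := by
  induction z with
  | nil => simp [SlotsSplit, slotQueries]
  | cons x z ih =>
    rcases x with _ | ⟨q, r⟩
    · exact ih
    · simp only [List.cons_append, SlotsSplit, ih, slotLeaves_append, slotQueries, List.mem_append,
        List.mem_cons, forall_eq_or_imp]
      grind

end Append

theorem slotLeaves_blank (z : Slots) : slotLeaves (blank z) = [] := by
  unfold blank
  induction z with
  | nil => rfl
  | cons x z ih => exact ih

theorem slotQueries_blank (z : Slots) : slotQueries (blank z) = [] := by
  unfold blank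
  induction z with
  | nil => rfl
  | cons x z ih => exact ih

theorem slotCost_blank (w : ℕ → ℕ) (d : ℕ) (z : Slots) : slotCost w d (blank z) = 0 := by
  unfold blank
  induction z generalizing d with
  | nil => rfl
  | cons x z ih => exact ih (d + 1)

theorem slotsSplit_blank (R : ℕ → ℕ → Prop) (z : Slots) : SlotsSplit R (blank z) := by
  unfold blank
  induction z with
  | nil => trivial
  | cons x z ih => exact ih

theorem slotLeaves_overlay {z z' : Slots} (hl : z.length = z'.length)
    (hd : disjointSlots z z' = true) :
    (slotLeaves (overlay z z')).Perm (slotLeaves z ++ slotLeaves z') := by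
  induction z generalizing z' with
  | nil =>
    obtain rfl := List.length_eq_zero_iff.1 hl.symm
    simp [overlay, slotLeaves]
  | cons x z ih =>
    cases z' with
    | nil => simp at hl
    | cons y z' =>
      simp only [disjointSlots, Bool.and_eq_true] at hd
      have ih := ih (by simpa using hl) hd.2
      rcases x with _ | ⟨q, r⟩ <;> rcases y with _ | ⟨q', r'⟩
      · exact ih
      · exact (ih.append_left _).trans (by
          simp only [slotLeaves, ← List.append_assoc]
          exact List.perm_append_comm.append_right _)
      · simp only [overlay, Option.or, slotLeaves, List.append_assoc]
        exact ih.append_left _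
      · simp at hd

theorem mem_slotQueries_overlay {z z' : Slots} {q : ℕ} (h : q ∈ slotQueries (overlay z z')) :
    q ∈ slotQueries z ∨ q ∈ slotQueries z' := by
  induction z generalizing z' with
  | nil => simp [overlay, slotQueries] at h
  | cons x z ih =>
    cases z' with
    | nil => simp [overlay, slotQueries] at h
    | cons y z' =>
      rcases x with _ | ⟨q, r⟩ <;> rcases y with _ | ⟨q', r'⟩ <;>
        simp only [overlay, Option.or, slotQueries, List.mem_cons] at h ⊢ <;>
        have := @ih z' <;> tauto

theorem slotCost_overlay_le (w : ℕ → ℕ) (d : ℕ) (z z' : Slots) :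
    slotCost w d (overlay z z') ≤ slotCost w d z + slotCost w d z' := by
  induction z generalizing z' d with
  | nil => simp [overlay, slotCost]
  | cons x z ih =>
    cases z' with
    | nil => simp [overlay, slotCost]
    | cons y z' =>
      have := ih (d + 1) z'
      rcases x with _ | ⟨q, r⟩ <;> rcases y with _ | ⟨q', r'⟩ <;>
        simp only [overlay, Option.or, slotCost] <;> omega

/-- Two schedules can be interleaved in any manner as long as no query of one has a leaf of the
other below it. -/
theorem SlotsSplit.overlay {R : ℕ → ℕ → Prop} {z z' : Slots} (hl : z.length = z'.length)
    (hd : disjointSlots z z' = true) (h : SlotsSplit R z) (h' : SlotsSplit R z')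
    (hR : ∀ q ∈ slotQueries z, ∀ a ∈ slotLeaves z', ¬ R q a)
    (hR' : ∀ q ∈ slotQueries z', ∀ a ∈ slotLeaves z, ¬ R q a) : SlotsSplit R (overlay z z') := by
  induction z generalizing z' with
  | nil => simp [TreeSearch.overlay, SlotsSplit]
  | cons x z ih =>
    cases z' with
    | nil => simp at hl
    | cons y z' =>
      simp only [disjointSlots, Bool.and_eq_true] at hd
      simp only [List.length_cons, Nat.add_right_cancel_iff] at hl
      have hp := slotLeaves_overlay hl hd.2
      rcases x with _ | ⟨q, r⟩ <;> rcases y with _ | ⟨q', r'⟩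
      · exact ih hl hd.2 h h' hR hR'
      · refine ⟨h'.1, h'.2.1, fun a ha => ?_, ih hl hd.2 h h'.2.2.2 ?_ ?_⟩
        · rcases List.mem_append.1 (hp.mem_iff.1 ha) with ha | ha
          exacts [hR' q' (by simp [slotQueries]) a ha, h'.2.2.1 a ha]
        · exact fun q hq a ha => hR q hq a (by simp [slotLeaves, ha])
        · exact fun q hq a ha => hR' q (by simp [slotQueries, hq]) a ha
      · refine ⟨h.1, h.2.1, fun a ha => ?_, ih hl hd.2 h.2.2.2 h' ?_ ?_⟩
        · rcases List.mem_append.1 (hp.mem_iff.1 ha) with ha | ha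
          exacts [h.2.2.1 a ha, hR q (by simp [slotQueries]) a ha]
        · exact fun q hq a ha => hR q (by simp [slotQueries, hq]) a ha
        · exact fun q hq a ha => hR' q hq a (by simp [slotLeaves, ha])
      · simp at hd

/-- The entry describes search trees for the trees of the forest, of at most the recorded cost. -/
structure Entry.Sound (R : ℕ → ℕ → Prop) (w : ℕ → ℕ) (cs : List RTree) (e : Entry) : Prop where
  splits : SlotsSplit R e.2
  leaves : (slotLeaves e.2).Perm (RTree.nodesList cs)
  queries : ∀ q ∈ slotQueries e.2, q ∈ RTree.nodesList cs
  cost : slotCost w 0 e.2 ≤ e.1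

theorem blank_eq_replicate (B : ℕ) :
    (List.replicate B none : Slots) = blank (List.replicate B none) := by
  simp [blank]

/-- The queries of the row lie strictly below `v`, so `v` answers "no" to all of them. The leaf `v`
can therefore end the "no"-path of the "yes"-subtree, and this subtree can be placed after the
earlier queries. -/
theorem sound_closings {T : RTree} (hT : T.Valid) {w : ℕ → ℕ} {p v : ℕ} {cs' cs : List RTree}
    (hp : T.Hangs p (.node v cs' :: cs)) {e x : Entry} (he : e.Sound T.Below w cs')
    (hx : x ∈ closings v (w v) e.1 e.2) : x.Sound T.Below w [.node v cs'] := by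
  obtain ⟨z1, z2, hz, rfl⟩ := mem_closings.1 hx
  obtain ⟨c, z⟩ := e
  obtain rfl : z = z1 ++ none :: z2 := hz
  obtain ⟨h1, h2, h3, h4⟩ := he
  simp only [slotsSplit_append, slotLeaves_append, slotQueries_append, slotCost_append,
    SlotsSplit, slotLeaves, slotQueries, slotCost] at h1 h2 h3 h4
  have hv : ∀ q ∈ slotQueries z1 ++ slotQueries z2, ¬ T.Below q v := fun q hq =>
    hp.not_below_head hT (h3 q hq)
  have hb := leaves_build_perm v z2
  have hlv : ∀ a ∈ slotLeaves z2, a ∈ RTree.nodesList cs' := fun a ha =>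
    h2.mem_iff.1 (by simp [ha])
  refine ⟨?_, ?_, ?_, ?_⟩
  · simp only [slotsSplit_append, SlotsSplit, slotLeaves, slotLeaves_blank, List.append_nil]
    refine ⟨h1.1, ⟨splits_build h1.2.1 fun q hq => hv q (by simp [hq]), fun a ha => ?_, by simp,
      slotsSplit_blank _ _⟩, fun q hq a ha => ?_⟩
    · rw [hp.below_head_iff hT]
      rcases List.mem_cons.1 (hb.mem_iff.1 ha) with rfl | ha
      exacts [Or.inl rfl, Or.inr (hlv a ha)]
    · rcases List.mem_cons.1 (hb.mem_iff.1 ha) with rfl | ha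
      exacts [hv q (by simp [hq]), h1.2.2 q hq a ha]
  · simp only [slotLeaves_append, slotLeaves, slotLeaves_blank, List.append_nil,
      RTree.nodesList_cons, RTree.nodesList_nil]
    exact ((hb.append_left _).trans List.perm_middle).trans (h2.cons v)
  · intro q hq
    simp only [slotQueries_append, slotQueries, slotQueries_blank, List.mem_append, List.mem_cons,
      List.not_mem_nil, or_false] at hq
    simp only [RTree.nodesList_cons, RTree.nodesList_nil, List.append_nil, List.mem_cons]
    rcases hq with hq | rfl
    exacts [Or.inr (h3 q (by simp [hq])), Or.inl rfl]
  -- The query occupies slot `z1.length`, so its "yes"-subtree starts one level deeper.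
  · have := costFrom_build_le w (z1.length + 1) v z2
    simp only [slotCost_append, slotCost, slotCost_blank, zero_add] at h4 ⊢
    rw [add_mul, one_mul, mul_comm] at this
    omega

theorem sound_forestTable {T : RTree} (hT : T.Valid) (w : ℕ → ℕ) (B : ℕ) (cs : List RTree) :
    ∀ p, T.Hangs p cs → ∀ e ∈ forestTable w (List.replicate B none) cs,
      e.Sound T.Below w cs := by
  induction cs using RTree.forest_induction with
  | nil =>
    intro p _ e he
    simp only [forestTable, List.mem_singleton] at he
    subst he
    rw [blank_eq_replicate]
    exact ⟨slotsSplit_blank _ _, by simp [slotLeaves_blank], by simp [slotQueries_blank],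
      by simp [slotCost_blank]⟩
  | cons v cs' cs ih' ih =>
    intro p hp x hx
    rw [forestTable_cons] at hx
    obtain ⟨e, he, f, hf, hd, rfl⟩ := mem_cross hx
    obtain ⟨g, hg, he'⟩ := mem_closeAll he
    have h1 := sound_closings hT hp (ih' v (RTree.hangs_children hp.head_mem) g hg) he'
    have h2 := ih p hp.tail f hf
    have hl : e.2.length = f.2.length := by
      rw [length_of_mem_closings he', (tableOK_forestTable w _ cs').1 g hg,
        (tableOK_forestTable w _ cs).1 f hf]
    have hm : ∀ a, a ∈ RTree.nodesList [.node v cs'] ↔ a = v ∨ a ∈ RTree.nodesList cs' := by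
      simp [RTree.nodesList_cons]
    refine ⟨h1.splits.overlay hl hd h2.splits (fun q hq a ha => ?_) (fun q hq a ha => ?_),
      ?_, fun q hq => ?_, ?_⟩
    · exact (hp.not_below_tail hT ((hm q).1 (h1.queries q hq)) (h2.leaves.mem_iff.1 ha)).1
    · exact (hp.not_below_tail hT ((hm a).1 (h1.leaves.mem_iff.1 ha)) (h2.queries q hq)).2
    · refine (slotLeaves_overlay hl hd).trans ((h1.leaves.append h2.leaves).trans ?_)
      simp [RTree.nodesList_cons]
    · rw [RTree.nodesList_cons]
      rcases mem_slotQueries_overlay hq with hq | hq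
      · have := (hm q).1 (h1.queries q hq)
        simp only [List.mem_cons, List.mem_append]
        tauto
      · simp [h2.queries q hq]
    · exact (slotCost_overlay_le w 0 _ _).trans (Nat.add_le_add h1.cost h2.cost)

theorem Entry.Sound.isSearchTree_build {r : ℕ} {cs : List RTree} (hT : (RTree.node r cs).Valid)
    {w : ℕ → ℕ} {e : Entry} (he : e.Sound (RTree.node r cs).Below w cs) :
    (build r e.2).IsSearchTree (.node r cs) ∧ (build r e.2).cost w ≤ e.1 + spanCost (w r) e.2 := by
  rw [DTree.isSearchTree_iff hT, RTree.nodes_node]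
  refine ⟨⟨splits_build he.splits fun q hq hqr => ?_,
    (leaves_build_perm r e.2).trans (he.leaves.cons r)⟩, ?_⟩
  -- A query above the root would be the root itself, but the queries are nodes of the forest below
  -- it.
  · have hr := (RTree.below_iff hT (RTree.mem_subtrees_self _) q).2
      (by rw [RTree.nodes_node]; simp [he.queries q hq])
    have := (RTree.laminar_below hT).antisymm hqr hr
    subst this
    unfold RTree.Valid at hT
    rw [RTree.nodes_node, List.nodup_cons] at hT
    exact hT.1 (he.queries _ hq)
  · have h1 := costFrom_build_le w 0 r e.2
    have h2 := he.cost
    rw [DTree.cost]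
    omega

/-! ### Completeness of the dynamic program -/

open Classical in
/-- The queries above the leaf `v`. -/
noncomputable def queryPath (R : ℕ → ℕ → Prop) : DTree → ℕ → List ℕ
  | .leaf _, _ => []
  | .query q l r, v => q :: if R q v then queryPath R r v else queryPath R l v

theorem length_queryPath_le (R : ℕ → ℕ → Prop) (D : DTree) (v : ℕ) :
    (queryPath R D v).length ≤ D.height := by
  induction D with
  | leaf u => simp [queryPath]
  | query q l r ihl ihr =>
    simp only [queryPath, DTree.height, List.length_cons]
    split_ifs <;> omega

/-- Written as a sum over nodes, the cost of a fixed tree splits along the forests of the dynamic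
program. -/
theorem cost_eq_sum_queryPath {R : ℕ → ℕ → Prop} (w : ℕ → ℕ) {D : DTree} (h : D.Splits R) :
    D.cost w = (D.leaves.map fun v => w v * (queryPath R D v).length).sum := by
  induction D with
  | leaf u => simp [queryPath, DTree.leaves]
  | query q l r ihl ihr =>
    have hl : (l.leaves.map fun v => w v * (queryPath R (.query q l r) v).length) =
        l.leaves.map fun v => w v * (queryPath R l v).length + w v :=
      List.map_congr_left fun v hv => by simp [queryPath, h.2.1 v hv, mul_add]
    have hr : (r.leaves.map fun v => w v * (queryPath R (.query q l r) v).length) =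
        r.leaves.map fun v => w v * (queryPath R r v).length + w v :=
      List.map_congr_left fun v hv => by simp [queryPath, h.1 v hv, mul_add]
    rw [DTree.cost_query, ihl h.2.2.1, ihr h.2.2.2, DTree.leaves, List.map_append, List.sum_append,
      hl, hr, List.sum_map_add, List.sum_map_add]
    unfold DTree.leafWeight
    ring

theorem queryPath_subset_labels (R : ℕ → ℕ → Prop) (D : DTree) (v : ℕ) {q : ℕ}
    (h : q ∈ queryPath R D v) : q ∈ D.labels := by
  induction D with
  | leaf u => simp [queryPath] at h
  | query q' l r ihl ihr =>
    simp only [queryPath, List.mem_cons, DTree.labels, List.mem_append] at h ⊢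
    split_ifs at h <;> tauto

/-- The paths to two leaves that are separated by one node `c` only. -/
theorem queryPath_adjacent {T : RTree} {D : DTree} (h : D.SearchProperty T) {p c : ℕ}
    (hc : c ∈ D.leaves) (hp : p ∈ D.leaves) (hcc : T.Below c c) (hcp : ¬ T.Below c p)
    (hq : ∀ q, q ≠ c → (T.Below q c ↔ T.Below q p)) :
    ∃ l a b, queryPath T.Below D c = l ++ c :: a ∧ queryPath T.Below D p = l ++ c :: b ∧ c ∉ l ∧
      ∀ x ∈ b, ¬ T.Below c x := by
  induction D with
  | leaf u =>
    simp only [DTree.leaves, List.mem_singleton] at hc hp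
    subst hc hp
    exact absurd hcc hcp
  | query q l r ihl ihr =>
    by_cases hqc : q = c
    · subst hqc
      exact ⟨[], queryPath T.Below r q, queryPath T.Below l p, by simp [queryPath, hcc],
        by simp [queryPath, hcp], by simp,
        fun x hx => h.2.1 x (queryPath_subset_labels _ _ _ hx)⟩
    · have hs := h.splits
      simp only [DTree.leaves, List.mem_append] at hc hp
      -- A query other than `c` gives `c` and `p` the same answer, so both paths continue into the
      -- same subtree.
      have hiff := hq q hqc
      by_cases hb : T.Below q c
      · have hb' := hiff.1 hb
        obtain ⟨l', a, b, h1, h2, h3, h4⟩ := ihr h.2.2.2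
          (hc.resolve_left fun h' => hs.2.1 c h' hb) (hp.resolve_left fun h' => hs.2.1 p h' hb')
        exact ⟨q :: l', a, b, by simp [queryPath, hb, h1], by simp [queryPath, hb', h2],
          by simp [h3, Ne.symm hqc], h4⟩
      · have hb' : ¬ T.Below q p := fun h' => hb (hiff.2 h')
        obtain ⟨l', a, b, h1, h2, h3, h4⟩ := ihl h.2.2.1
          (hc.resolve_right fun h' => hb (hs.1 c h')) (hp.resolve_right fun h' => hb' (hs.1 p h'))
        exact ⟨q :: l', a, b, by simp [queryPath, hb, h1], by simp [queryPath, hb', h2],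
          by simp [h3, Ne.symm hqc], h4⟩

/-- The positions of the elements of `S` in a list. -/
noncomputable def mask (S : ℕ → Prop) : ℕ → List ℕ → List Bool
  | 0, _ => []
  | n + 1, [] => false :: mask S n []
  | n + 1, x :: l => truth (S x) :: mask S n l

theorem mask_append (S : ℕ → Prop) (n : ℕ) (l l' : List ℕ) :
    mask S (l.length + n) (l ++ l') = mask S l.length l ++ mask S n l' := by
  induction l with
  | nil => simp [mask]
  | cons x l ih =>
    have e : l.length + 1 + n = l.length + n + 1 := by omega
    simp [e, mask, ih]

theorem length_mask (S : ℕ → Prop) (n : ℕ) (l : List ℕ) : (mask S n l).length = n := by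
  induction n generalizing l with
  | zero => simp [mask]
  | succ n ih => cases l <;> simp [mask, ih]

theorem mask_congr {S S' : ℕ → Prop} (n : ℕ) {l : List ℕ} (h : ∀ x ∈ l, (S x ↔ S' x)) :
    mask S n l = mask S' n l := by
  induction n generalizing l with
  | zero => simp [mask]
  | succ n ih =>
    cases l with
    | nil => simpa [mask] using ih (l := []) (by simp)
    | cons x l =>
      simp only [mask]
      rw [propext (h x (by simp)), ih fun y hy => h y (by simp [hy])]

theorem mask_eq_replicate {S : ℕ → Prop} (n : ℕ) {l : List ℕ} (h : ∀ x ∈ l, ¬ S x) :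
    mask S n l = List.replicate n false := by
  induction n generalizing l with
  | zero => simp [mask]
  | succ n ih =>
    cases l with
    | nil => simpa [mask, List.replicate_succ] using ih (l := []) (by simp)
    | cons x l =>
      have := ih (l := l) fun y hy => h y (by simp [hy])
      simp [mask, List.replicate_succ, h x (by simp), this]

theorem busy_blank (z : Slots) : busy (blank z) = List.replicate z.length false := by
  simp [busy, blank]

theorem spanCost_eq_zero {w : ℕ} {z : Slots} (h : ∀ b ∈ busy z, b = false) : spanCost w z = 0 := by
  induction z with
  | nil => simp [spanCost]
  | cons x z ih =>
    have hz := ih fun b hb => h b (by simp only [busy, List.map_cons, List.mem_cons] at hb ⊢; tauto)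
    cases x with
    | none => simp [spanCost, hz]
    | some x => simpa using h true (by simp [busy])

/-- Slots beyond the end of the path `l` are idle, and `spanCost` ignores idle slots at the end. -/
theorem spanCost_le {S : ℕ → Prop} (w : ℕ) {n : ℕ} {z : Slots} {l : List ℕ}
    (h : busy z = mask S n l) : spanCost w z ≤ w * l.length := by
  induction z generalizing n l with
  | nil => simp [spanCost]
  | cons x z ih =>
    cases n with
    | zero => simp [busy, mask] at h
    | succ n =>
      cases l with
      | nil =>
        rw [spanCost_eq_zero]
        · simp
        · intro b hb
          rw [h, mask_eq_replicate _ (by simp)] at hb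
          exact (List.mem_replicate.1 hb).2
      | cons y l =>
        simp only [busy, mask, List.map_cons, List.cons.injEq] at h
        have := ih h.2
        rw [List.length_cons, mul_add, mul_one]
        cases x with
        | none => simp only [spanCost]; split_ifs <;> omega
        | some x => simp only [spanCost]; omega

theorem disjointSlots_of_mask {S S' : ℕ → Prop} (hS : ∀ x, S x → ¬ S' x) {n : ℕ} {z z' : Slots}
    {l : List ℕ} (h : busy z = mask S n l) (h' : busy z' = mask S' n l) :
    disjointSlots z z' = true ∧ busy (overlay z z') = mask (fun x => S x ∨ S' x) n l := by
  induction n generalizing z z' l with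
  | zero =>
    simp only [busy, mask, List.map_eq_nil_iff] at h h'
    subst h h'
    simp [disjointSlots, overlay, busy, mask]
  | succ n ih =>
    cases l with
    | nil =>
      simp only [busy, mask, List.map_eq_cons_iff] at h h'
      obtain ⟨x, z, rfl, hx, h⟩ := h
      obtain ⟨y, z', rfl, hy, h'⟩ := h'
      have ih := ih h h'
      simp only [busy] at ih
      simp [disjointSlots, overlay, busy, mask, ih.1, ih.2, hx, hy]
    | cons u l =>
      simp only [busy, mask, List.map_eq_cons_iff] at h h'
      obtain ⟨x, z, rfl, hx, h⟩ := h
      obtain ⟨y, z', rfl, hy, h'⟩ := h'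
      have ih := ih h h'
      simp only [busy] at ih
      have := hS u
      by_cases h1 : S u <;> by_cases h2 : S' u <;>
        simp_all [disjointSlots, overlay, busy, mask]

/-- The row sought for the forest below `p` is the trace of the forest on the path to the leaf `p`
in `D`. For a child `v` of `p`, the trace of its subtree arises from the row for the children of
`v`, on the path to `v`, by closing it at the position of the query `v`. -/
theorem exists_mem_forestTable {T : RTree} (hT : T.Valid) (w : ℕ → ℕ) {D : DTree}
    (hD : D.IsSearchTree T) {B : ℕ} (hB : D.height ≤ B) (cs : List RTree) :
    ∀ p ∈ T.nodes, T.Hangs p cs → ∃ e ∈ forestTable w (List.replicate B none) cs,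
      busy e.2 = mask (fun x => x ∈ RTree.nodesList cs) B (queryPath T.Below D p) ∧
      e.1 ≤ ((RTree.nodesList cs).map fun v => w v * (queryPath T.Below D v).length).sum := by
  have hleaf : ∀ a ∈ T.nodes, a ∈ D.leaves := fun a ha =>
    ((DTree.isSearchTree_iff hT D).1 hD).2.mem_iff.2 ha
  induction cs using RTree.forest_induction with
  | nil =>
    intro p _ _
    refine ⟨(0, List.replicate B none), by simp [forestTable], ?_, by simp⟩
    rw [mask_eq_replicate _ (by simp)]
    simp [busy]
  | cons v cs' cs ih' ih =>
    intro p hpT hp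
    have hvT : v ∈ T.nodes := List.mem_map_of_mem hp.head_mem
    have hn := hp.nodup hT
    rw [RTree.nodesList_cons, List.nodup_cons] at hn
    obtain ⟨e, he, hbe, hce⟩ := ih' v hvT (RTree.hangs_children hp.head_mem)
    -- `l` is the common beginning of the two paths; `a` and `b` are what follows the query `v` on
    -- the way to `v` and to `p`.
    obtain ⟨l, a, b, hv, hpp, hvl, hb⟩ := queryPath_adjacent hD.2.2 (hleaf v hvT) (hleaf p hpT)
      (RTree.below_refl hvT) (hp.not_below_parent hT) (fun q hq => hp.below_head_iff_parent hT hq)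
    have hlen := (length_queryPath_le T.Below D v).trans hB
    rw [hv, List.length_append, List.length_cons] at hlen
    obtain ⟨n, rfl⟩ : ∃ n, B = l.length + (n + 1) := ⟨B - l.length - 1, by omega⟩
    set B := l.length + (n + 1) with hBdef
    rw [hv, mask_append, mask] at hbe
    simp only [busy, List.map_eq_append_iff, List.map_eq_cons_iff] at hbe
    obtain ⟨z1, zr, hz, hz1, x, z2, rfl, hx, hz2⟩ := hbe
    have hvcs' : ¬ v ∈ RTree.nodesList cs' := fun h => hn.1 (by simp [h])
    -- In the row for the children of `v`, the slot at the position of the query `v` is idle, since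
    -- `v` is not a node of that forest. So a closing at this position exists.
    obtain rfl : x = none := by
      simpa [hvcs', truth] using hx
    have hz1l : z1.length = l.length := by
      have := congrArg List.length hz1
      rwa [List.length_map, length_mask] at this
    have hz2l : z2.length = n := by
      have := congrArg List.length hz2
      rwa [List.length_map, length_mask] at this
    obtain ⟨f, hf, hbf, hcf⟩ := exists_mem_closeAll (tableOK_forestTable w _ cs') he
      (mem_closings (w := w v) (v := v).2 ⟨z1, z2, hz, rfl⟩)
    -- Before the query `v` both paths coincide; after it, the path to `p` contains no query from
    -- the subtree of `v`, which matches the slots cleared by the closing.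
    have hbf' : busy f.2 = mask (fun x => x = v ∨ x ∈ RTree.nodesList cs') B
        (queryPath T.Below D p) := by
      rw [hbf, hpp, hBdef, mask_append, mask, mask_eq_replicate n (l := b)]
      · have e1 : busy (z1 ++ some (v, build v z2) :: blank z2) =
            busy z1 ++ true :: busy (blank z2) := by simp [busy]
        rw [e1, busy_blank, hz2l]
        congr 1
        · exact hz1.trans (mask_congr _ fun y hy => ⟨Or.inr, fun h => h.resolve_left
            (by rintro rfl; exact hvl hy)⟩)
        · simp
      · exact fun x hx => by
          rw [← hp.below_head_iff hT]
          exact hb x hx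
    obtain ⟨g, hg, hbg, hcg⟩ := ih p hpT hp.tail
    have hdis : ∀ x, (x = v ∨ x ∈ RTree.nodesList cs') → ¬ x ∈ RTree.nodesList cs := by
      rintro x (rfl | hx) hx'
      · exact hn.1 (by simp [hx'])
      · exact (List.nodup_append.1 hn.2).2.2 x hx x hx' rfl
    obtain ⟨hd, ho⟩ := disjointSlots_of_mask hdis hbf' hbg
    obtain ⟨y, hy, hby, hcy⟩ := exists_mem_cross
      ((tableOK_forestTable w _ cs').closeAll v (w v)) (tableOK_forestTable w _ cs) hf hg hd
    refine ⟨y, by rw [forestTable_cons]; exact hy, ?_, ?_⟩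
    · rw [hby, ho]
      refine mask_congr _ fun x _ => ?_
      simp [RTree.nodesList_cons, or_assoc]
    -- The charge for `v` is at most `w v * (l.length + 1 + a.length)`, its share of the cost of
    -- `D`.
    · have h1 := spanCost_le (w v) hz2
      rw [RTree.nodesList_cons, List.map_cons, List.map_append, List.sum_cons, List.sum_append, hv,
        List.length_append, List.length_cons, mul_add, mul_add, mul_one]
      rw [hz1l] at hcf
      simp only at hcf
      omega

/-- The dynamic program finds an optimal search tree. -/
theorem exists_best_isOptimal {r : ℕ} {cs : List RTree} (hT : (RTree.node r cs).Valid)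
    (w : ℕ → ℕ) :
    ∃ e, best (w r) (forestTable w (List.replicate (slotCount w (.node r cs)) none) cs) = some e ∧
      (build r e.2).IsOptimal (.node r cs) w := by
  set T := RTree.node r cs with hTdef
  obtain ⟨D, hD, hB⟩ := DTree.exists_isOptimal_height_le hT w
  have hr : T.Hangs r cs := RTree.hangs_children (RTree.mem_subtrees_self T)
  obtain ⟨f, hf, hbf, hcf⟩ := exists_mem_forestTable hT w hD.1 hB cs r T.root_mem_nodes hr
  obtain ⟨e, he, hbest, hle⟩ := best_spec (w r) (List.ne_nil_of_mem hf)
  refine ⟨_, hbest, ?_⟩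
  obtain ⟨h1, h2⟩ := (sound_forestTable hT w _ cs r hr e he).isSearchTree_build hT
  refine ⟨h1, fun D' hD' => le_trans ?_ (hD.2 D' hD')⟩
  obtain ⟨hs, hp⟩ := (DTree.isSearchTree_iff hT D).1 hD.1
  have hnodes : T.nodes = r :: RTree.nodesList cs := RTree.nodes_node r cs
  rw [cost_eq_sum_queryPath w hs, (hp.map _).sum_eq, hnodes, List.map_cons, List.sum_cons]
  have h3 := hle f hf
  have h4 := spanCost_le (w r) hbf
  change (build r e.2).cost w ≤ _
  omega

/-! ### Rescaled weights -/

theorem leafWeight_le_of_mem {w w' : ℕ → ℕ} {D : DTree} (h : ∀ v ∈ D.leaves, w v ≤ w' v) :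
    D.leafWeight w ≤ D.leafWeight w' :=
  List.sum_le_sum h

theorem cost_le_of_mem {w w' : ℕ → ℕ} {D : DTree} (h : ∀ v ∈ D.leaves, w v ≤ w' v) :
    D.cost w ≤ D.cost w' := by
  induction D with
  | leaf v => simp
  | query q l r ihl ihr =>
    simp only [DTree.leaves, List.mem_append] at h
    have hl : ∀ v ∈ l.leaves, w v ≤ w' v := fun v hv => h v (Or.inl hv)
    have hr : ∀ v ∈ r.leaves, w v ≤ w' v := fun v hv => h v (Or.inr hv)
    have := ihl hl
    have := ihr hr
    have := leafWeight_le_of_mem hl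
    have := leafWeight_le_of_mem hr
    simp only [DTree.cost_query]
    omega

/-- Up to the factor `M / W`, the new weights are obtained by rounding down, with an error of less
than one unit per leaf. Summed over leaves and depths, the error is at most `n ^ 2` units, that is
`W n ^ 2 / M = W / E` in terms of `w`, and `W` is a lower bound for the cost of every search tree
with at least two leaves. -/
theorem mul_cost_le_of_isOptimal_capDiv {T : RTree} (hT : T.Valid) {w : ℕ → ℕ} {E : ℕ} {D D' : DTree}
    (hD : D.IsOptimal T fun v =>
      capDiv (w v * (T.size * T.size * E)) (T.weight w) (T.size * T.size * E))
    (hD' : D'.IsSearchTree T) : E * D.cost w ≤ (E + 1) * D'.cost w := by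
  set n := T.size with hn
  set W := T.weight w with hW
  set M := n * n * E with hM
  have hpos : 0 < n := List.length_pos_of_mem T.root_mem_nodes
  obtain ⟨-, hp⟩ := (DTree.isSearchTree_iff hT D).1 hD.1
  obtain ⟨-, hp'⟩ := (DTree.isSearchTree_iff hT D').1 hD'
  have hWD : D.leafWeight w = W := (hp.map w).sum_eq
  have hWD' : D'.leafWeight w = W := (hp'.map w).sum_eq
  rcases Nat.eq_zero_or_pos (D.cost w) with h0 | h0
  · simp [h0]
  have hW0 : 0 < W := by
    rw [Nat.pos_iff_ne_zero]
    intro h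
    have : ∀ v ∈ D.leaves, w v ≤ 0 := fun v hv => by
      rw [← h, ← hWD]
      exact List.le_sum_of_mem (List.mem_map_of_mem hv)
    have h1 := cost_le_of_mem (w' := fun v => 0 * w v) (fun v hv => by simpa using this v hv)
    rw [DTree.cost_mul] at h1
    omega
  -- If `D'` starts with a query, all leaves have depth at least one. Otherwise there is just one
  -- node, and `D` would be a leaf of cost zero.
  have hWc : W ≤ D'.cost w := by
    have hlen := hp.length_eq.trans hp'.length_eq.symm
    cases D' with
    | query q l r =>
      rw [← hWD', DTree.leafWeight_query, DTree.cost_query]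
      omega
    | leaf v =>
      cases D with
      | leaf u => simp at h0
      | query q l r =>
        have h1 := List.length_pos_of_ne_nil l.leaves_ne_nil
        have h2 := List.length_pos_of_ne_nil r.leaves_ne_nil
        simp only [DTree.leaves, List.length_append, List.length_singleton] at hlen
        omega
  set w' : ℕ → ℕ := fun v => capDiv (w v * M) W M with hw'
  have hle : ∀ v, W * w' v ≤ M * w v := fun v => by
    simp only [hw', capDiv, if_neg hW0.ne']
    calc W * min M (w v * M / W) ≤ W * (w v * M / W) := Nat.mul_le_mul_left _ (min_le_right _ _)
      _ ≤ w v * M := Nat.mul_div_le _ _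
      _ = M * w v := mul_comm _ _
  -- On nodes of `T` the cap is inactive, as no weight exceeds the total `W`.
  have hge : ∀ v ∈ D.leaves, M * w v ≤ W * (w' v + 1) := fun v hv => by
    have h1 : w v ≤ W := by
      rw [← hWD]
      exact List.le_sum_of_mem (List.mem_map_of_mem hv)
    have h2 : w v * M / W ≤ M := by
      calc w v * M / W ≤ W * M / W := Nat.div_le_div_right (Nat.mul_le_mul_right _ h1)
        _ = M := Nat.mul_div_cancel_left _ hW0
    simp only [hw', capDiv, if_neg hW0.ne', min_eq_right h2]
    rw [mul_comm M]
    exact (Nat.lt_mul_div_succ _ hW0).le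
  have h1 : M * D.cost w ≤ W * (D.cost w' + D.cost fun _ => 1) := by
    rw [← DTree.cost_mul, ← cost_add w' (fun _ => 1), ← DTree.cost_mul]
    exact cost_le_of_mem hge
  have h2 : W * D'.cost w' ≤ M * D'.cost w := by
    rw [← DTree.cost_mul, ← DTree.cost_mul]
    exact cost_le_of_mem fun v _ => hle v
  have h3 := hD.2 D' hD'
  have h4 := D.cost_one_le
  rw [hp.length_eq] at h4
  change _ ≤ n ^ 2 at h4
  have h5 : M * D.cost w ≤ M * D'.cost w + W * n ^ 2 :=
    calc _ ≤ W * (D'.cost w' + n ^ 2) := h1.trans (Nat.mul_le_mul_left _ (Nat.add_le_add h3 h4))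
      _ = W * D'.cost w' + W * n ^ 2 := mul_add _ _ _
      _ ≤ _ := Nat.add_le_add_right h2 _
  have h6 : n ^ 2 * (E * D.cost w) ≤ n ^ 2 * (E * D'.cost w + W) := by
    rw [hM] at h5
    calc _ = n * n * E * D.cost w := by ring
      _ ≤ _ := h5
      _ = _ := by ring
  have h7 := Nat.le_of_mul_le_mul_left h6 (by positivity)
  rw [add_mul, one_mul]
  omega

/-! ### The main function -/

theorem exists_call_core {T : RTree} (hT : T.Valid) (w : ℕ → ℕ) :
    ∃ D : DTree, D.IsOptimal T w ∧ Call program 22 (T.encode w) D.encode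
      (T.size * (20000 * (2 ^ slotCount w T) ^ 4)) := by
  obtain ⟨r, cs⟩ := T
  obtain ⟨e, he, h⟩ := exists_best_isOptimal hT w
  exact ⟨_, h, call_core w r cs he⟩

theorem RTree.size_pos (T : RTree) : 0 < T.size :=
  List.length_pos_of_mem T.root_mem_nodes

/-- Rounding up to a power of two at most doubles `1 + n + W ≤ 3 X`, which gives the base `6 X`; the
exponent depends on the degree only. -/
theorem two_pow_slotCount_le {T : RTree} {Δ : ℕ} (hΔ : T.maxDegree ≤ Δ) (w : ℕ → ℕ) {X : ℕ}
    (hX : T.size * max 1 (T.weight w) ≤ X) :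
    2 ^ slotCount w T ≤ (6 * X) ^ ((Δ + 2) * 36) := by
  have hn := T.size_pos
  set n := T.size
  set W := T.weight w
  have h1 : n ≤ X := (Nat.le_mul_of_pos_right n (by simp)).trans hX
  have h2 : W ≤ X := ((le_max_right 1 W).trans (Nat.le_mul_of_pos_left _ hn)).trans hX
  have h3 : 2 ^ Nat.clog 2 (1 + (n + W)) ≤ 6 * X := by
    have h4 := Nat.pow_pred_clog_lt_self (b := 2) (by norm_num) (x := 1 + (n + W)) (by omega)
    have h5 : 0 < Nat.clog 2 (1 + (n + W)) := Nat.clog_pos (by norm_num) (by omega)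
    obtain ⟨j, hj⟩ := Nat.exists_eq_succ_of_ne_zero h5.ne'
    rw [hj, Nat.pred_succ] at h4
    rw [hj, Nat.succ_eq_add_one, pow_succ]
    omega
  have h4 := T.maxChildren_le_maxDegree
  calc 2 ^ slotCount w T
      = (2 ^ Nat.clog 2 (1 + (n + W))) ^ ((1 + maxChildren [T] 0) * 36) := by
        rw [slotCount, ← pow_mul, mul_comm]
    _ ≤ (6 * X) ^ ((1 + maxChildren [T] 0) * 36) := Nat.pow_le_pow_left h3 _
    _ ≤ _ := Nat.pow_le_pow_right (by omega) (by omega)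

theorem core_steps_le {T : RTree} {Δ : ℕ} (hΔ : T.maxDegree ≤ Δ) (w : ℕ → ℕ) {X : ℕ}
    (hX : T.size * max 1 (T.weight w) ≤ X) :
    T.size * (20000 * (2 ^ slotCount w T) ^ 4) ≤
      20000 * 6 ^ ((Δ + 2) * 144) * X ^ ((Δ + 2) * 144 + 1) := by
  have h1 : T.size ≤ X := (Nat.le_mul_of_pos_right _ (by simp)).trans hX
  -- The fourth power of `2 ^ B` turns the exponent `36` per unit of degree into `144`.
  calc _ ≤ X * (20000 * ((6 * X) ^ ((Δ + 2) * 36)) ^ 4) :=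
        Nat.mul_le_mul h1 (Nat.mul_le_mul_left _
          (Nat.pow_le_pow_left (two_pow_slotCount_le hΔ w hX) 4))
    _ = _ := by
        have e : (Δ + 2) * 36 * 4 = (Δ + 2) * 144 := by ring
        rw [← pow_mul, e, mul_pow, pow_succ]
        generalize (Δ + 2) * 144 = k
        ring

theorem Call.exists_runs {x v : Val} {b : ℕ} (h : Call program 0 x v b) :
    ∃ t ≤ b + 2, program.Runs x v t := by
  obtain ⟨body, hf, t, ht, he⟩ := h
  exact ⟨1 + t + 1, by omega, .call hf (.var rfl) he⟩

theorem call_main {T : RTree} {w : ℕ → ℕ} {v : Val} {b : ℕ}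
    (h : Call program 22 (T.encode w) v b) : Call program 0 (T.encode w) v (b + 10) := by
  obtain ⟨r, cs⟩ := T
  rw [RTree.encode] at h ⊢
  refine .intro rfl ?_
  simp only [wp, Code.main, List.getElem?_cons_zero]
  exact ⟨_, _, h, rfl, by omega⟩

theorem call_main_rescale (T : RTree) (w : ℕ → ℕ) {p q E : ℕ} {v : Val} {b c : ℕ}
    (hE : Call program 23 (.pair (.nat p) (.nat q)) (.nat E) c)
    (h : Call program 22 (T.encode fun v =>
      capDiv (w v * (T.size * T.size * E)) (T.weight w) (T.size * T.size * E)) v b) :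
    Call program 0 (.pair (.pair (.nat p) (.nat q)) (T.encode w)) v
      (b + c + 200 * T.size + 40 * E +
        (2 * T.size + 1) * (200 * (T.size * T.size * E + 1)) + 300) := by
  have hs := call_size w [T]
  have hw := call_weight w [T]
  have hm := call_mul T.size T.size
  have hm' := call_mul (T.size * T.size) E
  have hr := call_rescale w (T.size * T.size * E) (T.weight w) [T]
  rw [RTree.nodesList_singleton] at hs hw hr
  simp only [RTree.encodeList] at hs hw hr
  refine .intro rfl ?_
  simp only [wp, Code.main, List.getElem?_cons_zero, List.getElem?_cons_succ]
  refine ⟨_, _, hs, _, _, hm, _, _, hE, _, _, hm', _, _, hw, _, _, hr, _, _, h, rfl, ?_⟩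
  have hlen : T.nodes.length = T.size := rfl
  rw [hlen]
  omega

theorem sum_map_capDiv_le (T : RTree) (w : ℕ → ℕ) (m d : ℕ) :
    T.weight (fun v => capDiv (w v * m) d m) ≤ T.size * m := by
  refine (List.sum_le_card_nsmul (T.nodes.map _) m fun x hx => ?_).trans ?_
  · obtain ⟨v, -, rfl⟩ := List.mem_map.1 hx
    simp only [capDiv]
    split_ifs <;> simp
  · simp [RTree.size]

end TreeSearch

-- The exact algorithm and the approximation scheme

theorem mainTheorem3 :
    (∃ P : TreeSearch.Program, ∀ Δ : ℕ, ∃ C k : ℕ,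
      ∀ (T : TreeSearch.RTree) (w : ℕ → ℕ), T.Valid → T.maxDegree ≤ Δ →
        ∃ (D : TreeSearch.DTree) (t : ℕ),
          P.Runs (T.encode w) D.encode t ∧
          D.IsOptimal T w ∧
          t ≤ C * (T.size * max 1 (T.weight w)) ^ k) ∧
    (∃ P : TreeSearch.Program, ∀ Δ : ℕ, ∃ C k : ℕ,
      ∀ (T : TreeSearch.RTree) (w : ℕ → ℕ) (p q : ℕ), T.Valid → T.maxDegree ≤ Δ →
        0 < p → 0 < q →
        ∃ (D : TreeSearch.DTree) (t : ℕ),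
          P.Runs (.pair (.pair (.nat p) (.nat q)) (T.encode w)) D.encode t ∧
          D.IsApprox T w ((p : ℚ) / (q : ℚ)) ∧
          (t : ℚ) ≤ C * ((T.size : ℚ) * max 1 (1 / ((p : ℚ) / (q : ℚ)))) ^ k) := by
  -- One program serves both claims: its main function recognizes the second kind of input by the
  -- pair `(p, q)` in the place of the number that names the root.
  refine ⟨⟨TreeSearch.program, fun Δ => ⟨20000 * 6 ^ ((Δ + 2) * 144) + 12, (Δ + 2) * 144 + 1,
    fun T w hT hΔ => ?_⟩⟩, ⟨TreeSearch.program, fun Δ =>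
      ⟨(20000 * 6 ^ ((Δ + 2) * 144) + 3000) * 2 ^ (4 * ((Δ + 2) * 144 + 1)),
        4 * ((Δ + 2) * 144 + 1), fun T w p q hT hΔ hp hq => ?_⟩⟩⟩
  · obtain ⟨D, hD, hc⟩ := TreeSearch.exists_call_core hT w
    obtain ⟨t, ht, hr⟩ := (TreeSearch.call_main hc).exists_runs
    refine ⟨D, t, hr, hD, ?_⟩
    have h1 := TreeSearch.core_steps_le hΔ w le_rfl
    have h2 : 0 < T.size * max 1 (T.weight w) := Nat.mul_pos T.size_pos (by simp)
    have h3 : 0 < (T.size * max 1 (T.weight w)) ^ ((Δ + 2) * 144 + 1) := by positivity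
    rw [add_mul]
    omega
  · obtain ⟨E, hE1, hE2, hE3⟩ := TreeSearch.call_ceilDiv p q hp
    have hn := T.size_pos
    have hE0 : 0 < E := Nat.pos_of_ne_zero (by rintro rfl; omega)
    obtain ⟨D, hD, hc⟩ := TreeSearch.exists_call_core hT fun v =>
      TreeSearch.capDiv (w v * (T.size * T.size * E)) (T.weight w) (T.size * T.size * E)
    obtain ⟨t, ht, hr⟩ := (TreeSearch.call_main_rescale T w hE3 hc).exists_runs
    have hpQ : (0 : ℚ) < p := by exact_mod_cast hp
    have hqQ : (0 : ℚ) < q := by exact_mod_cast hq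
    refine ⟨D, t, hr, ⟨hD.1, fun D' hD' => ?_⟩, ?_⟩
    · have h1 := TreeSearch.mul_cost_le_of_isOptimal_capDiv hT hD hD'
      have h1' : (E : ℚ) * D.cost w ≤ (E + 1) * D'.cost w := by exact_mod_cast h1
      have h2 : (q : ℚ) ≤ E * p := by exact_mod_cast hE1
      have hEQ : (0 : ℚ) < E := by exact_mod_cast hE0
      have h3 : (1 : ℚ) / E ≤ p / q := by
        rw [div_le_div_iff₀ hEQ hqQ]
        linarith
      have h4 : (D.cost w : ℚ) ≤ (1 + 1 / E) * D'.cost w := by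
        have : (1 + 1 / (E : ℚ)) * D'.cost w = (E + 1) * D'.cost w / E := by
          field_simp
        rw [this, le_div_iff₀ hEQ]
        linarith
      refine h4.trans (mul_le_mul_of_nonneg_right (by linarith) (by positivity))
    · set n := T.size with hn'
      -- The rescaled instance has total weight at most `n ^ 3 E ≤ Z ^ 3`, so its size times weight
      -- is at most `Z ^ 4`, which is the `X` of the exact algorithm.
      set Z := n * E with hZ
      have hZ1 : 1 ≤ Z := Nat.mul_pos hn hE0
      have hnZ : n ≤ Z := Nat.le_mul_of_pos_right n hE0
      have hEZ : E ≤ Z := Nat.le_mul_of_pos_left E hn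
      have hM : n * n * E ≤ Z ^ 3 :=
        calc n * n * E ≤ Z * Z * Z := Nat.mul_le_mul (Nat.mul_le_mul hnZ hnZ) hEZ
          _ = _ := by ring
      have hX : n * max 1 (T.weight fun v =>
          TreeSearch.capDiv (w v * (n * n * E)) (T.weight w) (n * n * E)) ≤ Z ^ 4 := by
        have h1 := TreeSearch.sum_map_capDiv_le T w (n * n * E) (T.weight w)
        have h2 : n * (n * n * E) ≤ Z ^ 3 := by
          calc n * (n * n * E) = n * n * Z := by rw [hZ]; ring
            _ ≤ Z * Z * Z := Nat.mul_le_mul_right _ (Nat.mul_le_mul hnZ hnZ)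
            _ = _ := by ring
        calc _ ≤ Z * Z ^ 3 :=
              Nat.mul_le_mul hnZ (max_le (Nat.one_le_pow _ _ hZ1) (h1.trans h2))
          _ = _ := by ring
      have hcore := TreeSearch.core_steps_le hΔ _ hX
      rw [← hn'] at hcore
      set K := (Δ + 2) * 144 + 1 with hK
      have hZ4 : Z ^ 4 ≤ (Z ^ 4) ^ K := Nat.le_self_pow (by omega) _
      have hZ3 : Z ≤ Z ^ 4 := Nat.le_self_pow (by norm_num) _
      have hZ31 : 1 ≤ Z ^ 3 := Nat.one_le_pow _ _ hZ1
      have hmid : (2 * n + 1) * (200 * (n * n * E + 1)) ≤ 1200 * Z ^ 4 :=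
        calc _ ≤ (3 * Z) * (400 * Z ^ 3) := Nat.mul_le_mul (by omega) (by omega)
          _ = _ := by ring
      have hfinal : t ≤ (20000 * 6 ^ ((Δ + 2) * 144) + 3000) * (Z ^ 4) ^ K := by
        rw [add_mul]
        omega
      -- From `E ≤ q / p + 1` it follows that `E` is at most twice `max 1 (1 / ε)`. This factor,
      -- raised to the power `4 K`, is the power of two in the constant.
      have hZY : (Z : ℚ) ≤ 2 * ((n : ℚ) * max 1 (1 / ((p : ℚ) / (q : ℚ)))) := by
        have h1 : (E : ℚ) * p ≤ q + p := by exact_mod_cast hE2.le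
        have h2 : (E : ℚ) ≤ 2 * max 1 (1 / ((p : ℚ) / (q : ℚ))) := by
          have h3 : (E : ℚ) ≤ q / p + 1 := by
            rw [← sub_le_iff_le_add, le_div_iff₀ hpQ]
            linarith
          rw [one_div_div]
          have h4 := le_max_left (1 : ℚ) (q / p)
          have h5 := le_max_right (1 : ℚ) (q / p)
          linarith
        rw [hZ]
        push_cast
        have : (0 : ℚ) ≤ n := by positivity
        nlinarith
      have hfinal' : (t : ℚ) ≤
          ((20000 * 6 ^ ((Δ + 2) * 144) + 3000 : ℕ) : ℚ) * ((Z : ℚ) ^ 4) ^ K := by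
        exact_mod_cast hfinal
      refine hfinal'.trans ?_
      push_cast
      rw [mul_assoc, ← mul_pow, ← pow_mul]
      exact mul_le_mul_of_nonneg_left (pow_le_pow_left₀ (by positivity) hZY _) (by positivity)
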